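/- **Setting.** Let $r_0,H,\Omega,R_0>0$. Write $p=(s,z)$, $q=(\Upsilon,Z)$, $\mathcal D=[0,\tfrac1{2r_0^2})\times[0,H]$, $\mathbb R^2_+=[0,\infty)^2$, and $e(s)=r_0^4/(1-2sr_0^2)^2$. Let $\Delta\subset[0,R_0]^2$ be closed and let $\sigma$ be a Borel probability measure on $\mathbb R^2$ with $\operatorname{spt}\sigma\subset\Delta$. Let $\mathcal H_0$ be the set of Borel functions $\rho:[0,H]\to[0,\tfrac1{2r_0^2})$, and for $\rho\in\mathcal H_0$ put $D_\rho=\{(s,z): z\in[0,H],\ 0\le s\le\rho(z)\}$. Let $\mathfrak L_\sigma$ be the set of $(\rho,\gamma)$ with $\rho\in\mathcal H_0$, $\int_{D_\rho}e(s)\,ds\,dz=1$, and $\gamma$ a Borel measure on $\mathbb R^2\times\mathbb R^2$ with marginals $e(s)\chi_{D_\rho}\mathcal L^2$ and $\sigma$. Define, with values in $(-\infty,+\infty]$ for $I$, $$I(\rho,\gamma)=\int_{D_\rho\times\Delta}\Bigl(-\langle p,q\rangle+\frac{\Upsilon}{2r_0^2}-\Omega\sqrt\Upsilon+\frac{r_0^2\Omega^2}{2(1-2r_0^2s)}\Bigr)\gamma(dp,dq),$$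 $$\Pi_P(t,z)=\int_0^{t}\Bigl(\frac{\Omega^2r_0^2}{2(1-2sr_0^2)}-P(s,z)\Bigr)e(s)\,ds,$$ $$J[\sigma](P,\Psi)=\int_{\mathbb R^2}\Bigl(\frac{\Upsilon}{2r_0^2}-\Omega\sqrt\Upsilon-\Psi(q)\Bigr)\sigma(dq)+\inf_{\rho\in\mathcal H_0}\int_0^H\Pi_P(\rho(z),z)\,dz .$$ Let $\mathcal U$ be the set of pairs $(P,\Psi)\in C(\overline{\mathcal D})\times C(\mathbb R^2_+)$ with $P(p)+\Psi(q)\ge\langle p,q\rangle$ on $\mathcal D\times\mathbb R^2_+$, and $\mathcal U_0$ the set of $(P,\Psi)\in\mathcal U$ with $P(p)=\sup_{q\in\Delta}(\langle p,q\rangle-\Psi(q))$ for $p\in\mathcal D$ and $\Psi(q)=\sup_{p\in\mathcal D}(\langle p,q\rangle-P(p))$ for $q\in\mathbb R^2_+$. Let $$M_P=\sup\Bigl\{t\in[0,\tfrac1{2r_0^2}):\ \frac{\Omega^2r_0^6(1-tr_0^2)t}{2(1-2tr_0^2)}\le\bigl[P(0,0)+R_0(\tfrac1{2r_0^2}+H)\bigr]r_0^4t\Bigr\}.$$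 **Proposition.** (i) Some $(P,\Psi)\in\mathcal U_0$ maximizes $J[\sigma]$ over $\mathcal U$. (ii) For all $(P,\Psi)\in\mathcal U_0$ and $(\rho,\gamma)\in\mathfrak L_\sigma$, $I(\rho,\gamma)\ge J[\sigma](P,\Psi)$. Equality holds if and only if $\mathbf{id}\times\nabla P$ pushes $e(s)\chi_{D_\rho}\mathcal L^2$ forward to $\gamma$ and $\rho(z)$ minimizes $\Pi_P(\cdot,z)$ over $[0,\tfrac1{2r_0^2})$ for a.e. $z\in[0,H]$. If $\sigma\ll\mathcal L^2$, the first of these two conditions may be replaced by: $\nabla\Psi\times\mathbf{id}$ pushes $\sigma$ forward to $\gamma$. (iii) $I$ has a minimizer $(\rho_0,\gamma_0)$ over $\mathfrak L_\sigma$ with $\rho_0$ nondecreasing on $[0,H]$, such that the following hold. If $\sigma(\{Z=0\})=0$, the minimizer is unique: every minimizer $(\rho,\gamma)$ satisfies $\gamma=\gamma_0$ and $\rho=\rho_0$ a.e. on $[0,H]$. For every $(P_0,\Psi_0)\in\mathcal U_0$ maximizing $J[\sigma]$ over $\mathcal U$: $J[\sigma](P_0,\Psi_0)=I(\rho_0,\gamma_0)$;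 $0\le\rho_0(z)\le M_{P_0}<\tfrac1{2r_0^2}$ for all $z\in[0,H]$; $2(1-2r_0^2\rho_0(z))P_0(\rho_0(z),z)=r_0^2\Omega^2$ for all $z$ with $\rho_0(z)>0$; and $\nabla P_0$ pushes $e(s)\chi_{D_{\rho_0}}\mathcal L^2$ forward to $\sigma$. If moreover $\sigma\ll\mathcal L^2$, then $\nabla\Psi_0\times\mathbf{id}$ pushes $\sigma$ forward to $\gamma_0$, $\nabla\Psi_0\circ\nabla P_0=\mathbf{id}$ holds $e(s)\chi_{D_{\rho_0}}\mathcal L^2$-a.e., and $\nabla P_0\circ\nabla\Psi_0=\mathbf{id}$ holds $\sigma$-a.e. (iv) With the same $\rho_0$: if $(P_0,\Psi_0)\in\mathcal U_0$ maximizes $J[\sigma]$ over $\mathcal U_0$, and $(P_1,\Psi_1)\in\mathcal U_0$ satisfies $J[\sigma](P_1,\Psi_1)=J[\sigma](P_0,\Psi_0)$, then $P_1(s,z)=P_0(s,z)$ at every $(s,z)\in D_{\rho_0}$ with $\rho_0(z)>0$, and $\Psi_1=\Psi_0$ on $\operatorname{spt}\sigma$. If $\operatorname{spt}\sigma=\Delta$,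 then $P_1=P_0$ on $D_{\rho_0}$ and $\Psi_1=\Psi_0$ on $\Delta$. -/

import Mathlib

open MeasureTheory Set
open scoped ENNReal

namespace Axisym

noncomputable section

/-- The scalar product of `p = (s, z)` and `q = (Υ, Z)`. -/
def dot (p q : ℝ × ℝ) : ℝ := p.1 * q.1 + p.2 * q.2

/-- The gradient of a function of two real variables. -/
def grad (f : ℝ × ℝ → ℝ) (p : ℝ × ℝ) : ℝ × ℝ :=
  (fderiv ℝ f p (1, 0), fderiv ℝ f p (0, 1))

/-- The integral, with values in `[-∞, ∞]`, of a function one of whose two parts (positive and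
negative) has finite integral. It is used below only for integrands that are bounded below and
for finite measures, and may then be `+∞`. -/
def extInt {X : Type*} [MeasurableSpace X] (μ : Measure X) (f : X → ℝ) : EReal :=
  ((∫⁻ x, ENNReal.ofReal (f x) ∂μ : ℝ≥0∞) : EReal)
    - ((∫⁻ x, ENNReal.ofReal (-f x) ∂μ : ℝ≥0∞) : EReal)

/-- The interval `[0, 1 / (2 r₀²))`. -/
def heights (r₀ : ℝ) : Set ℝ := Ico 0 (1 / (2 * r₀ ^ 2))

/-- The set `𝒟 = [0, 1 / (2 r₀²)) × [0, H]`. -/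
def dom (r₀ H : ℝ) : Set (ℝ × ℝ) := heights r₀ ×ˢ Icc 0 H

/-- The closed quadrant `[0, ∞)²`. -/
def quadrant : Set (ℝ × ℝ) := Ici 0 ×ˢ Ici 0

/-- The weight `e(s) = r₀⁴ / (1 - 2 s r₀²)²`. -/
def weight (r₀ s : ℝ) : ℝ := r₀ ^ 4 / (1 - 2 * s * r₀ ^ 2) ^ 2

/-- The class `ℋ₀` of Borel functions `[0, H] → [0, 1 / (2 r₀²))`; the values outside `[0, H]`
play no role. -/
def IsHeight (r₀ H : ℝ) (ρ : ℝ → ℝ) : Prop :=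
  Measurable (fun z : Icc 0 H => ρ z) ∧ ∀ z ∈ Icc 0 H, ρ z ∈ heights r₀

/-- The domain `D_ρ = {(s, z) : 0 ≤ s ≤ ρ(z), z ∈ [0, H]}`. -/
def region (H : ℝ) (ρ : ℝ → ℝ) : Set (ℝ × ℝ) :=
  {p | p.2 ∈ Icc 0 H ∧ 0 ≤ p.1 ∧ p.1 ≤ ρ p.2}

/-- The measure `e(s) χ_{D_ρ}(s, z) ℒ²`. -/
def fluid (r₀ H : ℝ) (ρ : ℝ → ℝ) : Measure (ℝ × ℝ) :=
  (volume.restrict (region H ρ)).withDensity fun p => ENNReal.ofReal (weight r₀ p.1)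

/-- `γ ∈ Γ(μ, ν)`: the marginals of `γ` are `μ` and `ν`. -/
def IsPlan (μ ν : Measure (ℝ × ℝ)) (γ : Measure ((ℝ × ℝ) × (ℝ × ℝ))) : Prop :=
  γ.map Prod.fst = μ ∧ γ.map Prod.snd = ν

/-- The set `𝔏_σ` of admissible pairs `(ρ, γ)` of the primal problem. -/
def admissible (r₀ H : ℝ) (σ : Measure (ℝ × ℝ)) :
    Set ((ℝ → ℝ) × Measure ((ℝ × ℝ) × (ℝ × ℝ))) :=
  {x | IsHeight r₀ H x.1 ∧ ∫ p in region H x.1, weight r₀ p.1 = 1 ∧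
    IsPlan (fluid r₀ H x.1) σ x.2}

/-- The primal functional `I(ρ, γ)`, an integral over `D_ρ × Δ`. -/
def primal (r₀ H Ω : ℝ) (Δ : Set (ℝ × ℝ)) (ρ : ℝ → ℝ)
    (γ : Measure ((ℝ × ℝ) × (ℝ × ℝ))) : EReal :=
  extInt (γ.restrict (region H ρ ×ˢ Δ)) fun x =>
    -dot x.1 x.2 + x.2.1 / (2 * r₀ ^ 2) - Ω * √x.2.1
      + r₀ ^ 2 * Ω ^ 2 / (2 * (1 - 2 * r₀ ^ 2 * x.1.1))

/-- `Π_P(t, z) = ∫₀ᵗ (Ω² r₀² / (2 (1 - 2 s r₀²)) - P(s, z)) e(s) ds`. -/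
def boundaryEnergy (r₀ Ω : ℝ) (P : ℝ × ℝ → ℝ) (t z : ℝ) : ℝ :=
  ∫ s in (0 : ℝ)..t, (Ω ^ 2 * r₀ ^ 2 / (2 * (1 - 2 * s * r₀ ^ 2)) - P (s, z)) * weight r₀ s

/-- `j(P)`, the infimum over `ρ ∈ ℋ₀` of `∫₀ᴴ Π_P(ρ(z), z) dz`. -/
def dualBoundary (r₀ H Ω : ℝ) (P : ℝ × ℝ → ℝ) : EReal :=
  ⨅ ρ ∈ {ρ : ℝ → ℝ | IsHeight r₀ H ρ},
    extInt (volume.restrict (Icc 0 H)) fun z => boundaryEnergy r₀ Ω P (ρ z) z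

/-- The dual functional `J[σ](P, Ψ)`; the argument is the pair `(P, Ψ)`. -/
def dual (r₀ H Ω : ℝ) (σ : Measure (ℝ × ℝ)) (f : (ℝ × ℝ → ℝ) × (ℝ × ℝ → ℝ)) : EReal :=
  ((∫ q, (q.1 / (2 * r₀ ^ 2) - Ω * √q.1 - f.2 q) ∂σ : ℝ) : EReal) + dualBoundary r₀ H Ω f.1

/-- The set `𝒰` of pairs `(P, Ψ)` with `P` continuous on the closure of `𝒟`, `Ψ` continuous on the
quadrant and `P(p) + Ψ(q) ≥ ⟨p, q⟩`. Only the values of `P` on the closure of `𝒟` and of `Ψ` on the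
quadrant matter. -/
def dualPairs (r₀ H : ℝ) : Set ((ℝ × ℝ → ℝ) × (ℝ × ℝ → ℝ)) :=
  {f | ContinuousOn f.1 (closure (dom r₀ H)) ∧ ContinuousOn f.2 quadrant ∧
    ∀ p ∈ dom r₀ H, ∀ q ∈ quadrant, dot p q ≤ f.1 p + f.2 q}

/-- The set `𝒰₀` of Legendre pairs: `P(p)` is the supremum of `⟨p, q⟩ - Ψ(q)` over `q ∈ Δ`, and
`Ψ(q)` is the supremum of `⟨p, q⟩ - P(p)` over `p ∈ 𝒟`. -/
def legendrePairs (r₀ H : ℝ) (Δ : Set (ℝ × ℝ)) : Set ((ℝ × ℝ → ℝ) × (ℝ × ℝ → ℝ)) :=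
  {f | f ∈ dualPairs r₀ H ∧
    (∀ p ∈ dom r₀ H, IsLUB ((fun q => dot p q - f.2 q) '' Δ) (f.1 p)) ∧
    (∀ q ∈ quadrant, IsLUB ((fun p => dot p q - f.1 p) '' dom r₀ H) (f.2 q))}

/-- `ρ(z)` minimizes `Π_P(·, z)` over `[0, 1 / (2 r₀²))` for almost every `z ∈ [0, H]`. -/
def MinimizesAE (r₀ H Ω : ℝ) (P : ℝ × ℝ → ℝ) (ρ : ℝ → ℝ) : Prop :=
  ∀ᵐ z ∂volume.restrict (Icc 0 H),
    IsMinOn (fun t => boundaryEnergy r₀ Ω P t z) (heights r₀) (ρ z)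

/-- The constant `M_P`: the supremum of the `t ∈ [0, 1 / (2 r₀²))` with
`Ω² r₀⁶ (1 - t r₀²) t / (2 (1 - 2 t r₀²)) ≤ (P(0, 0) + A) r₀⁴ t`,
where `A = R₀ (1 / (2 r₀²) + H)`. -/
def heightBound (r₀ H Ω R₀ : ℝ) (P : ℝ × ℝ → ℝ) : ℝ :=
  sSup {t | t ∈ heights r₀ ∧
    Ω ^ 2 * r₀ ^ 6 * (1 - t * r₀ ^ 2) * t / (2 * (1 - 2 * t * r₀ ^ 2)) ≤
      (P (0, 0) + R₀ * (1 / (2 * r₀ ^ 2) + H)) * r₀ ^ 4 * t}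

end

end Axisym

/-! Integrating P(p) + Ψ(q) ≥ ⟨p, q⟩ against γ writes a finite primal value as the dual value plus
two nonnegative gaps: the integral of P + Ψ − ⟨p, q⟩ over γ, and the excess of the energy of ρ over
the least energy for P (`weak_duality`). Equality means that γ sits on the contact set, which by
Rademacher's theorem is a.e. the graph of ∇P, and that ρ minimizes Π_P on almost every slice. It is
therefore enough to find one Legendre pair and one height function with slicewise minimality and
with ∇P pushing the fluid measure to σ (`exists_solution`). Both are then optimal, and the same (ρ₀,
γ₀) closes the gap for every other dual maximizer.

The pair is found by maximizing the dual functional in the potential ψ alone, P being its Legendre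
transform; the push-forward identity is the Euler–Lagrange equation. Differentiating requires the
minimizing heights to be stable, hence unique on almost every slice, and this may fail where P does
not depend on z. So P is replaced by P + δz. Since Δ lies in the quadrant, P is nondecreasing in z,
and a minimizer at z can lie above one at z' > z only if the pressure is constant in between
(`pressure_eq_of_minimizers_cross`). Strict monotonicity in z thus leaves countably many slices with
several minimizers (`countable_multiple_minimizers`). Perturbed maximizers exist by coercivity and
Arzelà–Ascoli (`exists_objective_max`) and satisfy the push-forward identity
(`integral_comp_grad_le`). The bounds do not depend on δ, so Arzelà–Ascoli for the potentials and
Helly's theorem for the monotone heights allow δ → 0.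

For uniqueness, σ({Z = 0}) = 0 makes ∂P/∂z nonzero a.e. in the fluid, which rules out crossing
minimizers (`ae_le_of_minimizesAE`). Two dual maximizers have the same gradient a.e. in the fluid
and the same values at the free boundary, prescribed there by the first-order condition, so they
agree below it (`pressure_eq_on_region`). -/

namespace Axisym

open Filter Topology
open scoped NNReal BoundedContinuousFunction

/-! ### Elementary properties of the weight and of the centrifugal term -/

/-- The centrifugal term `Ω² r₀² / (2 (1 - 2 s r₀²))`. -/
noncomputable def centrifugal (r₀ Ω s : ℝ) : ℝ := Ω ^ 2 * r₀ ^ 2 / (2 * (1 - 2 * s * r₀ ^ 2))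

theorem one_sub_pos_of_mem_heights {r₀ s : ℝ} (hr : 0 < r₀) (hs : s ∈ heights r₀) :
    0 < 1 - 2 * s * r₀ ^ 2 := by
  have h := hs.2
  rw [lt_div_iff₀ (by positivity)] at h
  linarith

theorem weight_pos {r₀ s : ℝ} (hr : 0 < r₀) (hs : s ∈ heights r₀) : 0 < weight r₀ s := by
  have := one_sub_pos_of_mem_heights hr hs
  unfold weight; positivity

theorem weight_nonneg (r₀ s : ℝ) : 0 ≤ weight r₀ s := by
  unfold weight; positivity

theorem continuousOn_weight {r₀ : ℝ} (hr : 0 < r₀) : ContinuousOn (weight r₀) (heights r₀) := by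
  unfold weight
  refine ContinuousOn.div (by fun_prop) (by fun_prop) fun s hs => ?_
  have := one_sub_pos_of_mem_heights hr hs
  positivity

theorem measurable_weight (r₀ : ℝ) : Measurable (weight r₀) := by
  unfold weight; fun_prop

theorem continuousOn_centrifugal {r₀ : ℝ} (hr : 0 < r₀) (Ω : ℝ) :
    ContinuousOn (centrifugal r₀ Ω) (heights r₀) := by
  unfold centrifugal
  refine ContinuousOn.div (by fun_prop) (by fun_prop) fun s hs => ?_
  have := one_sub_pos_of_mem_heights hr hs
  positivity

theorem measurable_centrifugal (r₀ Ω : ℝ) : Measurable (centrifugal r₀ Ω) := by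
  unfold centrifugal; fun_prop

theorem centrifugal_nonneg {r₀ s : ℝ} (hr : 0 < r₀) (Ω : ℝ) (hs : s ∈ heights r₀) :
    0 ≤ centrifugal r₀ Ω s := by
  have := one_sub_pos_of_mem_heights hr hs
  unfold centrifugal; positivity

theorem centrifugal_le_of_le {r₀ s t : ℝ} (hr : 0 < r₀) (Ω : ℝ) (ht : t ∈ heights r₀)
    (hst : s ≤ t) : centrifugal r₀ Ω s ≤ centrifugal r₀ Ω t := by
  have := one_sub_pos_of_mem_heights hr ht
  unfold centrifugal
  gcongr

theorem weight_le_of_le {r₀ s t : ℝ} (hr : 0 < r₀) (ht : t ∈ heights r₀)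
    (hst : s ≤ t) : weight r₀ s ≤ weight r₀ t := by
  have := one_sub_pos_of_mem_heights hr ht
  unfold weight
  gcongr

theorem zero_mem_heights {r₀ : ℝ} (hr : 0 < r₀) : (0 : ℝ) ∈ heights r₀ :=
  ⟨le_rfl, by positivity⟩

theorem mem_heights_of_le {r₀ s t : ℝ} (ht : t ∈ heights r₀) (h0 : 0 ≤ s) (hst : s ≤ t) :
    s ∈ heights r₀ := ⟨h0, hst.trans_lt ht.2⟩

theorem ordConnected_heights (r₀ : ℝ) : OrdConnected (heights r₀) := ordConnected_Ico

/-- A height above which the centrifugal term exceeds `B`. -/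
noncomputable def cutoff (r₀ Ω B : ℝ) : ℝ :=
  max 0 (1 / (2 * r₀ ^ 2) * (1 - Ω ^ 2 * r₀ ^ 2 / (2 * (|B| + 1))))

theorem cutoff_mem_heights {r₀ Ω : ℝ} (hr : 0 < r₀) (hΩ : 0 < Ω) (B : ℝ) :
    cutoff r₀ Ω B ∈ heights r₀ := by
  refine ⟨le_max_left _ _, max_lt (by positivity) ?_⟩
  have h1 : 0 < 1 / (2 * r₀ ^ 2) := by positivity
  have h2 : 0 < Ω ^ 2 * r₀ ^ 2 / (2 * (|B| + 1)) := by positivity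
  nlinarith

theorem lt_centrifugal_of_cutoff_le {r₀ Ω B s : ℝ} (hr : 0 < r₀)
    (hs : s ∈ heights r₀) (h : cutoff r₀ Ω B ≤ s) : B < centrifugal r₀ Ω s := by
  have h1 := one_sub_pos_of_mem_heights hr hs
  have h2 : 1 / (2 * r₀ ^ 2) * (1 - Ω ^ 2 * r₀ ^ 2 / (2 * (|B| + 1))) ≤ s :=
    (le_max_right _ _).trans h
  have h3 : 1 - 2 * s * r₀ ^ 2 ≤ Ω ^ 2 * r₀ ^ 2 / (2 * (|B| + 1)) := by
    rw [one_div_mul_eq_div, div_le_iff₀ (by positivity)] at h2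
    linarith
  have h4 : |B| + 1 ≤ centrifugal r₀ Ω s := by
    unfold centrifugal
    have hB : 0 < |B| + 1 := by positivity
    rw [le_div_iff₀ (by positivity)] at h3 ⊢
    linarith
  linarith [le_abs_self B]

theorem hasDerivAt_mass {r₀ s : ℝ} (hr : 0 < r₀) (hs : s ∈ heights r₀) :
    HasDerivAt (fun t => r₀ ^ 4 * t / (1 - 2 * t * r₀ ^ 2)) (weight r₀ s) s := by
  have h := one_sub_pos_of_mem_heights hr hs
  have h1 : HasDerivAt (fun t : ℝ => r₀ ^ 4 * t) (r₀ ^ 4) s := by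
    simpa using (hasDerivAt_id s).const_mul (r₀ ^ 4)
  have h2 : HasDerivAt (fun t : ℝ => 1 - 2 * t * r₀ ^ 2) (-(2 * r₀ ^ 2)) s := by
    simpa using (((hasDerivAt_id s).const_mul 2).mul_const (r₀ ^ 2)).const_sub 1
  refine (h1.div h2 h.ne').congr_deriv ?_
  unfold weight
  congr 1
  ring

/-- With `hasDerivAt_mass`, this supplies the closed forms behind the inequality that defines M_P.
-/
theorem hasDerivAt_centrifugal_energy {r₀ s : ℝ} (hr : 0 < r₀) (Ω : ℝ) (hs : s ∈ heights r₀) :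
    HasDerivAt
      (fun t => Ω ^ 2 * r₀ ^ 6 * ((1 - t * r₀ ^ 2) * t) / (2 * (1 - 2 * t * r₀ ^ 2) ^ 2))
      (centrifugal r₀ Ω s * weight r₀ s) s := by
  have h := one_sub_pos_of_mem_heights hr hs
  have h2 : HasDerivAt (fun t : ℝ => 1 - 2 * t * r₀ ^ 2) (-(2 * r₀ ^ 2)) s := by
    simpa using (((hasDerivAt_id s).const_mul 2).mul_const (r₀ ^ 2)).const_sub 1
  have h1 : HasDerivAt (fun t : ℝ => 1 - t * r₀ ^ 2) (-r₀ ^ 2) s := by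
    simpa using ((hasDerivAt_id s).mul_const (r₀ ^ 2)).const_sub 1
  have h3 := ((h1.mul (hasDerivAt_id s)).const_mul (Ω ^ 2 * r₀ ^ 6)).div
    ((h2.pow 2).const_mul 2) (mul_pos two_pos (pow_pos h 2)).ne'
  refine h3.congr_deriv ?_
  unfold weight centrifugal
  simp only [id, Pi.mul_apply, Pi.pow_apply]
  rw [div_mul_div_comm, div_eq_div_iff (by positivity) (by positivity)]
  ring

theorem uIcc_subset_heights {r₀ a b : ℝ} (ha : a ∈ heights r₀) (hb : b ∈ heights r₀) :
    uIcc a b ⊆ heights r₀ :=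
  (ordConnected_heights r₀).uIcc_subset ha hb

section Integrals

variable {r₀ : ℝ} (hr : 0 < r₀)
include hr

theorem intervalIntegrable_weight {a b : ℝ} (ha : a ∈ heights r₀) (hb : b ∈ heights r₀) :
    IntervalIntegrable (weight r₀) volume a b :=
  ((continuousOn_weight hr).mono (uIcc_subset_heights ha hb)).intervalIntegrable

theorem integral_weight {t : ℝ} (ht : t ∈ heights r₀) :
    ∫ s in (0 : ℝ)..t, weight r₀ s = r₀ ^ 4 * t / (1 - 2 * t * r₀ ^ 2) := by
  have h0 := zero_mem_heights hr
  rw [intervalIntegral.integral_eq_sub_of_hasDerivAt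
    (fun s hs => hasDerivAt_mass hr (uIcc_subset_heights h0 ht hs))
    (intervalIntegrable_weight hr h0 ht)]
  simp

theorem integral_centrifugal_mul_weight (Ω : ℝ) {t : ℝ} (ht : t ∈ heights r₀) :
    ∫ s in (0 : ℝ)..t, centrifugal r₀ Ω s * weight r₀ s =
      Ω ^ 2 * r₀ ^ 6 * ((1 - t * r₀ ^ 2) * t) / (2 * (1 - 2 * t * r₀ ^ 2) ^ 2) := by
  have h0 := zero_mem_heights hr
  have hsub := uIcc_subset_heights h0 ht
  rw [intervalIntegral.integral_eq_sub_of_hasDerivAt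
    (fun s hs => hasDerivAt_centrifugal_energy hr Ω (hsub hs))
    (((continuousOn_centrifugal hr Ω).mono hsub).mul
      ((continuousOn_weight hr).mono hsub)).intervalIntegrable]
  simp

end Integrals

/-! ### The boundary energy and its minimizers -/

/-- Continuous functions on `𝒟`, bounded by `B` and nondecreasing in the vertical variable. -/
structure Regular (r₀ H B : ℝ) (Q : ℝ × ℝ → ℝ) : Prop where
  cont : ContinuousOn Q (dom r₀ H)
  abs_le : ∀ p ∈ dom r₀ H, |Q p| ≤ B
  mono : ∀ s ∈ heights r₀, MonotoneOn (fun z => Q (s, z)) (Icc 0 H)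

section Energy

variable {r₀ H Ω B : ℝ} {Q : ℝ × ℝ → ℝ}

theorem Regular.continuousOn_slice (hQ : Regular r₀ H B Q) {z : ℝ} (hz : z ∈ Icc 0 H) :
    ContinuousOn (fun s => Q (s, z)) (heights r₀) :=
  hQ.cont.comp (by fun_prop) fun _ hs => ⟨hs, hz⟩

theorem continuousOn_energy_integrand (hr : 0 < r₀) (hQ : Regular r₀ H B Q) {z : ℝ}
    (hz : z ∈ Icc 0 H) :
    ContinuousOn (fun s => (centrifugal r₀ Ω s - Q (s, z)) * weight r₀ s) (heights r₀) :=
  ((continuousOn_centrifugal hr Ω).sub (hQ.continuousOn_slice hz)).mul (continuousOn_weight hr)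

theorem intervalIntegrable_energy (hr : 0 < r₀) (hQ : Regular r₀ H B Q) {z a b : ℝ}
    (hz : z ∈ Icc 0 H) (ha : a ∈ heights r₀) (hb : b ∈ heights r₀) :
    IntervalIntegrable (fun s => (centrifugal r₀ Ω s - Q (s, z)) * weight r₀ s) volume a b :=
  ((continuousOn_energy_integrand hr hQ hz).mono (uIcc_subset_heights ha hb)).intervalIntegrable

theorem boundaryEnergy_eq (r₀ Ω : ℝ) (Q : ℝ × ℝ → ℝ) (t z : ℝ) : boundaryEnergy r₀ Ω Q t z =
    ∫ s in (0 : ℝ)..t, (centrifugal r₀ Ω s - Q (s, z)) * weight r₀ s := rfl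

theorem boundaryEnergy_zero (r₀ Ω : ℝ) (Q : ℝ × ℝ → ℝ) (z : ℝ) :
    boundaryEnergy r₀ Ω Q 0 z = 0 := by
  simp [boundaryEnergy]

theorem boundaryEnergy_sub (hr : 0 < r₀) (hQ : Regular r₀ H B Q) {z a b : ℝ}
    (hz : z ∈ Icc 0 H) (ha : a ∈ heights r₀) (hb : b ∈ heights r₀) :
    boundaryEnergy r₀ Ω Q b z - boundaryEnergy r₀ Ω Q a z =
      ∫ s in a..b, (centrifugal r₀ Ω s - Q (s, z)) * weight r₀ s := by
  have h0 := zero_mem_heights hr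
  rw [boundaryEnergy_eq, boundaryEnergy_eq,
    intervalIntegral.integral_interval_sub_left (intervalIntegrable_energy hr hQ hz h0 hb)
      (intervalIntegrable_energy hr hQ hz h0 ha)]

/-- Above the cutoff the centrifugal term exceeds the bound B on the pressure, so the energy
increases strictly there. The resulting bound depends on the pressure only through B, which keeps
sequences of minimizers in one compact interval. -/
theorem le_cutoff_of_isMinOn (hr : 0 < r₀) (hΩ : 0 < Ω) (hQ : Regular r₀ H B Q) {z t : ℝ}
    (hz : z ∈ Icc 0 H) (ht : t ∈ heights r₀)
    (hmin : IsMinOn (fun t => boundaryEnergy r₀ Ω Q t z) (heights r₀) t) :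
    t ≤ cutoff r₀ Ω B := by
  by_contra! hlt
  have hT := cutoff_mem_heights hr hΩ B
  have h1 := boundaryEnergy_sub (Ω := Ω) hr hQ hz hT ht
  have h2 : boundaryEnergy r₀ Ω Q t z ≤ boundaryEnergy r₀ Ω Q (cutoff r₀ Ω B) z := hmin hT
  have h3 : 0 < ∫ s in (cutoff r₀ Ω B)..t, (centrifugal r₀ Ω s - Q (s, z)) * weight r₀ s := by
    refine intervalIntegral.intervalIntegral_pos_of_pos_on
      (intervalIntegrable_energy hr hQ hz hT ht) (fun s hs => ?_) hlt
    have hs' : s ∈ heights r₀ := ⟨hT.1.trans hs.1.le, hs.2.trans ht.2⟩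
    refine mul_pos ?_ (weight_pos hr hs')
    linarith [lt_centrifugal_of_cutoff_le hr hs' hs.1.le, hQ.abs_le (s, z) ⟨hs', hz⟩,
      le_abs_self (Q (s, z))]
  linarith

theorem boundaryEnergy_le_of_cutoff_le (hr : 0 < r₀) (hΩ : 0 < Ω) (hQ : Regular r₀ H B Q)
    {z t : ℝ} (hz : z ∈ Icc 0 H) (ht : t ∈ heights r₀) (h : cutoff r₀ Ω B ≤ t) :
    boundaryEnergy r₀ Ω Q (cutoff r₀ Ω B) z ≤ boundaryEnergy r₀ Ω Q t z := by
  have hT := cutoff_mem_heights hr hΩ B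
  have h1 := boundaryEnergy_sub (Ω := Ω) hr hQ hz hT ht
  have h3 : 0 ≤ ∫ s in (cutoff r₀ Ω B)..t, (centrifugal r₀ Ω s - Q (s, z)) * weight r₀ s := by
    refine intervalIntegral.integral_nonneg h fun s hs => ?_
    have hs' : s ∈ heights r₀ := ⟨hT.1.trans hs.1, hs.2.trans_lt ht.2⟩
    refine mul_nonneg ?_ (weight_nonneg _ _)
    linarith [lt_centrifugal_of_cutoff_le hr hs' hs.1, hQ.abs_le (s, z) ⟨hs', hz⟩,
      le_abs_self (Q (s, z))]
  linarith

/-- The boundary energies converge when the heights and the pressures do. -/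
theorem tendsto_boundaryEnergy (hr : 0 < r₀) {T : ℝ} (hT : T ∈ heights r₀)
    {Qn : ℕ → ℝ × ℝ → ℝ} (hQn : ∀ n, Regular r₀ H B (Qn n)) {tn zn : ℕ → ℝ} {t z : ℝ}
    (htn : ∀ n, tn n ∈ Icc 0 T) (ht : Tendsto tn atTop (𝓝 t)) (hzn : ∀ n, zn n ∈ Icc 0 H)
    (hlim : ∀ s ∈ heights r₀, Tendsto (fun n => Qn n (s, zn n)) atTop (𝓝 (Q (s, z)))) :
    Tendsto (fun n => boundaryEnergy r₀ Ω (Qn n) (tn n) (zn n)) atTop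
      (𝓝 (boundaryEnergy r₀ Ω Q t z)) := by
  have htT : t ∈ Icc 0 T := isClosed_Icc.mem_of_tendsto ht (Eventually.of_forall htn)
  -- The moving endpoint is put into an indicator, so that dominated convergence applies on a fixed
  -- interval.
  have key : ∀ (R : ℝ × ℝ → ℝ) (τ ζ : ℝ), τ ∈ Icc 0 T → boundaryEnergy r₀ Ω R τ ζ =
      ∫ s in Ioc 0 T, (Iic τ).indicator
        (fun s => (centrifugal r₀ Ω s - R (s, ζ)) * weight r₀ s) s := by
    intro R τ ζ hτ
    rw [boundaryEnergy_eq, intervalIntegral.integral_of_le hτ.1,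
      setIntegral_indicator measurableSet_Iic, Ioc_inter_Iic, min_eq_right hτ.2]
  rw [key Q t z htT]
  simp_rw [fun n => key (Qn n) (tn n) (zn n) (htn n)]
  have hmem : ∀ s ∈ Ioc 0 T, s ∈ heights r₀ := fun s hs => mem_heights_of_le hT hs.1.le hs.2
  refine tendsto_integral_of_dominated_convergence
    (fun _ => (centrifugal r₀ Ω T + B) * weight r₀ T) (fun n => ?_) ?_ (fun n => ?_) ?_
  · exact ((((continuousOn_energy_integrand hr (hQn n) (hzn n)).mono hmem).aestronglyMeasurable
      measurableSet_Ioc).indicator measurableSet_Iic)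
  · exact integrable_const _
  · filter_upwards [ae_restrict_mem measurableSet_Ioc] with s hs
    have hs' := hmem s hs
    have h1 := (hQn n).abs_le (s, zn n) ⟨hs', hzn n⟩
    refine (norm_indicator_le_norm_self _ _).trans ?_
    rw [norm_mul, Real.norm_eq_abs, Real.norm_eq_abs, abs_of_nonneg (weight_nonneg r₀ s)]
    have h2 : |centrifugal r₀ Ω s - Qn n (s, zn n)| ≤ centrifugal r₀ Ω T + B := by
      refine (abs_sub _ _).trans ?_
      rw [abs_of_nonneg (centrifugal_nonneg hr Ω hs')]
      exact add_le_add (centrifugal_le_of_le hr Ω hT hs.2) h1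
    exact mul_le_mul h2 (weight_le_of_le hr hT hs.2) (weight_nonneg _ _)
      ((abs_nonneg _).trans h2)
  -- The limiting indicator jumps only at s = t, a null set.
  · have hne : ∀ᵐ s ∂(volume.restrict (Ioc 0 T)), s ≠ t :=
      ae_restrict_of_ae (Measure.ae_ne volume t)
    filter_upwards [hne, ae_restrict_mem measurableSet_Ioc] with s hst hs
    rcases lt_or_gt_of_ne hst with h | h
    · have e1 : ∀ᶠ n in atTop, s < tn n := ht.eventually (lt_mem_nhds h)
      rw [indicator_of_mem (show s ∈ Iic t from h.le)]
      refine Tendsto.congr' (f₁ := fun n => (centrifugal r₀ Ω s - Qn n (s, zn n)) * weight r₀ s)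
        ?_ (((hlim s (hmem s hs)).const_sub _).mul_const _)
      filter_upwards [e1] with n hn
      rw [indicator_of_mem (show s ∈ Iic (tn n) from hn.le)]
    · have e1 : ∀ᶠ n in atTop, tn n < s := ht.eventually (gt_mem_nhds h)
      rw [indicator_of_notMem (show s ∉ Iic t from not_le.2 h)]
      refine tendsto_const_nhds.congr' ?_
      filter_upwards [e1] with n hn
      rw [indicator_of_notMem (show s ∉ Iic (tn n) from not_le.2 hn)]

/-- Limits of minimizers are minimizers. -/
theorem isMinOn_boundaryEnergy_of_tendsto (hr : 0 < r₀) {T : ℝ} (hT : T ∈ heights r₀)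
    {Qn : ℕ → ℝ × ℝ → ℝ} (hQn : ∀ n, Regular r₀ H B (Qn n)) {tn zn : ℕ → ℝ} {t z : ℝ}
    (htn : ∀ n, tn n ∈ Icc 0 T) (ht : Tendsto tn atTop (𝓝 t)) (hzn : ∀ n, zn n ∈ Icc 0 H)
    (hlim : ∀ s ∈ heights r₀, Tendsto (fun n => Qn n (s, zn n)) atTop (𝓝 (Q (s, z))))
    (hmin : ∀ n, IsMinOn (fun t => boundaryEnergy r₀ Ω (Qn n) t (zn n)) (heights r₀) (tn n)) :
    IsMinOn (fun t => boundaryEnergy r₀ Ω Q t z) (heights r₀) t := by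
  intro τ hτ
  exact le_of_tendsto_of_tendsto' (tendsto_boundaryEnergy hr hT hQn htn ht hzn hlim)
    (tendsto_boundaryEnergy hr hτ hQn (fun _ => ⟨hτ.1, le_rfl⟩) tendsto_const_nhds hzn hlim)
    fun n => hmin n hτ

theorem continuousOn_boundaryEnergy (hr : 0 < r₀) (hQ : Regular r₀ H B Q) {z T : ℝ}
    (hz : z ∈ Icc 0 H) (hT : T ∈ heights r₀) :
    ContinuousOn (fun t => boundaryEnergy r₀ Ω Q t z) (Icc 0 T) := by
  have h0 := zero_mem_heights hr
  refine intervalIntegral.continuousOn_primitive_interval' (a := 0)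
    (intervalIntegrable_energy hr hQ hz h0 hT) left_mem_uIcc |>.mono ?_
  rw [uIcc_of_le hT.1]

theorem isCompact_minimizers (hr : 0 < r₀) (hΩ : 0 < Ω) (hQ : Regular r₀ H B Q) {z : ℝ}
    (hz : z ∈ Icc 0 H) :
    IsCompact {t | t ∈ heights r₀ ∧
      IsMinOn (fun t => boundaryEnergy r₀ Ω Q t z) (heights r₀) t} := by
  have hT := cutoff_mem_heights hr hΩ B
  refine (isCompact_Icc (a := (0 : ℝ)) (b := cutoff r₀ Ω B)).of_isClosed_subset ?_
    fun t ht => ⟨ht.1.1, le_cutoff_of_isMinOn hr hΩ hQ hz ht.1 ht.2⟩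
  refine isSeqClosed_iff_isClosed.1 fun tn t htn ht => ?_
  have hb : ∀ n, tn n ∈ Icc 0 (cutoff r₀ Ω B) :=
    fun n => ⟨(htn n).1.1, le_cutoff_of_isMinOn hr hΩ hQ hz (htn n).1 (htn n).2⟩
  have htT := isClosed_Icc.mem_of_tendsto ht (Eventually.of_forall hb)
  exact ⟨mem_heights_of_le hT htT.1 htT.2,
    isMinOn_boundaryEnergy_of_tendsto hr hT (fun _ => hQ) hb ht (fun _ => hz)
      (fun _ _ => tendsto_const_nhds) fun n => (htn n).2⟩

theorem nonempty_minimizers (hr : 0 < r₀) (hΩ : 0 < Ω) (hQ : Regular r₀ H B Q) {z : ℝ}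
    (hz : z ∈ Icc 0 H) :
    {t | t ∈ heights r₀ ∧
      IsMinOn (fun t => boundaryEnergy r₀ Ω Q t z) (heights r₀) t}.Nonempty := by
  have hT := cutoff_mem_heights hr hΩ B
  obtain ⟨t, ht, hmin⟩ := isCompact_Icc.exists_isMinOn (nonempty_Icc.2 hT.1)
    (continuousOn_boundaryEnergy (Ω := Ω) hr hQ hz hT)
  refine ⟨t, mem_heights_of_le hT ht.1 ht.2, fun τ hτ => ?_⟩
  rcases le_total τ (cutoff r₀ Ω B) with h | h
  · exact hmin ⟨hτ.1, h⟩
  · exact (hmin ⟨hT.1, le_rfl⟩ : boundaryEnergy r₀ Ω Q t z ≤ _).trans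
      (boundaryEnergy_le_of_cutoff_le hr hΩ hQ hz hτ h)

/-- The largest minimizer of `Π_Q(·, z)`. -/
noncomputable def topHeight (r₀ Ω : ℝ) (Q : ℝ × ℝ → ℝ) (z : ℝ) : ℝ :=
  sSup {t | t ∈ heights r₀ ∧ IsMinOn (fun t => boundaryEnergy r₀ Ω Q t z) (heights r₀) t}

theorem topHeight_mem (hr : 0 < r₀) (hΩ : 0 < Ω) (hQ : Regular r₀ H B Q) {z : ℝ}
    (hz : z ∈ Icc 0 H) : topHeight r₀ Ω Q z ∈ heights r₀ ∧
      IsMinOn (fun t => boundaryEnergy r₀ Ω Q t z) (heights r₀) (topHeight r₀ Ω Q z) :=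
  (isCompact_minimizers hr hΩ hQ hz).sSup_mem (nonempty_minimizers hr hΩ hQ hz)

theorem le_topHeight (hr : 0 < r₀) (hΩ : 0 < Ω) (hQ : Regular r₀ H B Q) {z t : ℝ}
    (hz : z ∈ Icc 0 H) (ht : t ∈ heights r₀)
    (hmin : IsMinOn (fun t => boundaryEnergy r₀ Ω Q t z) (heights r₀) t) :
    t ≤ topHeight r₀ Ω Q z :=
  le_csSup (isCompact_minimizers hr hΩ hQ hz).bddAbove ⟨ht, hmin⟩

/-- The centrifugal term does not depend on z and cancels. Hence increments of the energy in the
height decrease with z when the pressure increases with z, the submodularity behind monotone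
minimizers. -/
theorem boundaryEnergy_diff_eq (hr : 0 < r₀) (hQ : Regular r₀ H B Q) {z z' a b : ℝ}
    (hz : z ∈ Icc 0 H) (hz' : z' ∈ Icc 0 H) (ha : a ∈ heights r₀) (hb : b ∈ heights r₀) :
    (boundaryEnergy r₀ Ω Q b z - boundaryEnergy r₀ Ω Q a z) -
      (boundaryEnergy r₀ Ω Q b z' - boundaryEnergy r₀ Ω Q a z') =
      ∫ s in a..b, (Q (s, z') - Q (s, z)) * weight r₀ s := by
  rw [boundaryEnergy_sub hr hQ hz ha hb, boundaryEnergy_sub hr hQ hz' ha hb,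
    ← intervalIntegral.integral_sub (intervalIntegrable_energy hr hQ hz ha hb)
      (intervalIntegrable_energy hr hQ hz' ha hb)]
  congr 1; ext s; ring

/-- If a minimizer at `z` lies above a minimizer at `z' ≥ z`, then the pressure does not change
between `z` and `z'` at the heights in between. -/
theorem pressure_eq_of_minimizers_cross (hr : 0 < r₀) (hQ : Regular r₀ H B Q)
    {z z' t t' : ℝ} (hz : z ∈ Icc 0 H) (hz' : z' ∈ Icc 0 H) (hzz : z ≤ z')
    (ht : t ∈ heights r₀) (ht' : t' ∈ heights r₀)
    (hmin : IsMinOn (fun t => boundaryEnergy r₀ Ω Q t z) (heights r₀) t)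
    (hmin' : IsMinOn (fun t => boundaryEnergy r₀ Ω Q t z') (heights r₀) t') (htt : t' < t) :
    (∀ s ∈ Icc t' t, Q (s, z') = Q (s, z)) ∧
      boundaryEnergy r₀ Ω Q t z' = boundaryEnergy r₀ Ω Q t' z' := by
  -- The left side is nonpositive by the two minimality properties and the right side nonnegative by
  -- monotonicity of the pressure, so both vanish.
  have h1 := boundaryEnergy_diff_eq (Ω := Ω) hr hQ hz hz' ht' ht
  have h2 : boundaryEnergy r₀ Ω Q t z ≤ boundaryEnergy r₀ Ω Q t' z := hmin ht'
  have h3 : boundaryEnergy r₀ Ω Q t' z' ≤ boundaryEnergy r₀ Ω Q t z' := hmin' ht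
  have hsub : Icc t' t ⊆ heights r₀ := (ordConnected_heights r₀).out ht' ht
  have hnn : ∀ s ∈ Icc t' t, 0 ≤ (Q (s, z') - Q (s, z)) * weight r₀ s := fun s hs =>
    mul_nonneg (sub_nonneg.2 (hQ.mono s (hsub hs) hz hz' hzz)) (weight_nonneg _ _)
  have h4 : 0 ≤ ∫ s in t'..t, (Q (s, z') - Q (s, z)) * weight r₀ s :=
    intervalIntegral.integral_nonneg htt.le hnn
  have hc : ContinuousOn (fun s => (Q (s, z') - Q (s, z)) * weight r₀ s) (Icc t' t) :=
    (((hQ.continuousOn_slice hz').sub (hQ.continuousOn_slice hz)).mul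
      (continuousOn_weight hr)).mono hsub
  refine ⟨fun s hs => ?_, by linarith⟩
  by_contra hne
  have hpos : 0 < ∫ s in t'..t, (Q (s, z') - Q (s, z)) * weight r₀ s := by
    refine intervalIntegral.integral_pos htt hc
      (fun s hs => hnn s (Ioc_subset_Icc_self hs)) ⟨s, hs, ?_⟩
    refine mul_pos (lt_of_le_of_ne (sub_nonneg.2 (hQ.mono s (hsub hs) hz hz' hzz)) ?_)
      (weight_pos hr (hsub hs))
    exact fun h => hne (sub_eq_zero.1 h.symm)
  linarith

/-- If the largest minimizer dropped between z and z', the higher value would, by the crossing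
lemma, also minimize at z', against the choice of the largest. Monotonicity provides measurability
here and compactness later. -/
theorem monotoneOn_topHeight (hr : 0 < r₀) (hΩ : 0 < Ω) (hQ : Regular r₀ H B Q) :
    MonotoneOn (topHeight r₀ Ω Q) (Icc 0 H) := by
  intro z hz z' hz' hzz
  by_contra! hlt
  obtain ⟨ht, hmin⟩ := topHeight_mem hr hΩ hQ hz
  obtain ⟨ht', hmin'⟩ := topHeight_mem hr hΩ hQ hz'
  have h := (pressure_eq_of_minimizers_cross hr hQ hz hz' hzz ht ht' hmin hmin' hlt).2
  refine hlt.not_ge (le_topHeight hr hΩ hQ hz' ht fun τ hτ => ?_)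
  have := hmin' hτ
  simp only [mem_ofPred_eq] at this ⊢
  rwa [h]

/-- If the pressure is strictly increasing in the vertical variable, then minimizers are unique
for all but countably many `z`. -/
theorem countable_multiple_minimizers (hr : 0 < r₀) (hQ : Regular r₀ H B Q)
    (hstrict : ∀ s ∈ heights r₀, StrictMonoOn (fun z => Q (s, z)) (Icc 0 H)) :
    {z | z ∈ Icc 0 H ∧ ∃ t ∈ heights r₀, ∃ t' ∈ heights r₀, t' < t ∧
      IsMinOn (fun t => boundaryEnergy r₀ Ω Q t z) (heights r₀) t ∧
      IsMinOn (fun t => boundaryEnergy r₀ Ω Q t z) (heights r₀) t'}.Countable := by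
  set N := {z | z ∈ Icc 0 H ∧ ∃ t ∈ heights r₀, ∃ t' ∈ heights r₀, t' < t ∧
      IsMinOn (fun t => boundaryEnergy r₀ Ω Q t z) (heights r₀) t ∧
      IsMinOn (fun t => boundaryEnergy r₀ Ω Q t z) (heights r₀) t'}
  -- A rational is chosen in each gap between two minimizers. If z < z' shared one, the upper
  -- minimizer at z would lie above the lower one at z', and the pressure could not increase
  -- strictly.
  have hq : ∀ z : N, ∃ q : ℚ, ∃ t ∈ heights r₀, ∃ t' ∈ heights r₀, t' < q ∧ (q : ℝ) < t ∧
      IsMinOn (fun t => boundaryEnergy r₀ Ω Q t z) (heights r₀) t ∧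
      IsMinOn (fun t => boundaryEnergy r₀ Ω Q t z) (heights r₀) t' := by
    rintro ⟨z, hz, t, ht, t', ht', hlt, h1, h2⟩
    obtain ⟨q, hq1, hq2⟩ := exists_rat_btwn hlt
    exact ⟨q, t, ht, t', ht', hq1, hq2, h1, h2⟩
  choose q hq using hq
  have key : ∀ z z' : N, (z : ℝ) < z' → q z ≠ q z' := by
    intro z z' hlt heq
    obtain ⟨t, ht, -, -, -, hqt, hmin, -⟩ := hq z
    obtain ⟨-, -, t', ht', hq't', -, -, hmin'⟩ := hq z'
    rw [heq] at hqt
    have hlt' : t' < t := hq't'.trans hqt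
    have := (pressure_eq_of_minimizers_cross hr hQ z.2.1 z'.2.1 hlt.le ht ht' hmin hmin' hlt').1 t
      ⟨hlt'.le, le_rfl⟩
    exact (hstrict t ht z.2.1 z'.2.1 hlt).ne' this
  have hinj : Function.Injective q := by
    intro z z' h
    by_contra hne
    rcases lt_or_gt_of_ne (fun h => hne (Subtype.ext h) : (z : ℝ) ≠ z') with hlt | hlt
    · exact key z z' hlt h
    · exact key z' z hlt h.symm
  exact countable_coe_iff.1 hinj.countable

/-- The first-order condition at the free boundary. -/
theorem centrifugal_eq_of_isMinOn (hr : 0 < r₀) (hQ : Regular r₀ H B Q) {z t : ℝ}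
    (hz : z ∈ Icc 0 H) (ht : t ∈ heights r₀) (ht0 : 0 < t)
    (hmin : IsMinOn (fun t => boundaryEnergy r₀ Ω Q t z) (heights r₀) t) :
    Q (t, z) = centrifugal r₀ Ω t := by
  have hnhds : heights r₀ ∈ 𝓝 t := Ico_mem_nhds ht0 ht.2
  have hc := continuousOn_energy_integrand (Ω := Ω) hr hQ hz
  have hd := intervalIntegral.integral_hasDerivAt_right
    (intervalIntegrable_energy (Ω := Ω) hr hQ hz (zero_mem_heights hr) ht)
    (hc.stronglyMeasurableAtFilter_nhdsWithin measurableSet_Ico t |>.filter_mono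
      (le_of_eq (nhdsWithin_eq_nhds.2 hnhds).symm))
    (hc.continuousAt hnhds)
  have h0 := (hmin.isLocalMin hnhds).hasDerivAt_eq_zero hd
  rcases mul_eq_zero.1 h0 with h | h
  · linarith
  · exact absurd h (weight_pos hr ht).ne'

/-- Since 1 − t r₀² ≥ 1/2, the defining inequality at t > 0 forces the centrifugal term to be at
most 2A, so t stays below the cutoff for 2A. Boundedness is recorded because `le_csSup` needs it. -/
theorem heightBound_lt {R₀ : ℝ} (hr : 0 < r₀) (hΩ : 0 < Ω) (P : ℝ × ℝ → ℝ) :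
    BddAbove {t | t ∈ heights r₀ ∧
      Ω ^ 2 * r₀ ^ 6 * (1 - t * r₀ ^ 2) * t / (2 * (1 - 2 * t * r₀ ^ 2)) ≤
        (P (0, 0) + R₀ * (1 / (2 * r₀ ^ 2) + H)) * r₀ ^ 4 * t} ∧
      heightBound r₀ H Ω R₀ P < 1 / (2 * r₀ ^ 2) := by
  set A := P (0, 0) + R₀ * (1 / (2 * r₀ ^ 2) + H)
  have hT := cutoff_mem_heights hr hΩ (2 * A)
  have hb : ∀ t ∈ {t | t ∈ heights r₀ ∧
      Ω ^ 2 * r₀ ^ 6 * (1 - t * r₀ ^ 2) * t / (2 * (1 - 2 * t * r₀ ^ 2)) ≤ A * r₀ ^ 4 * t},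
      t ≤ cutoff r₀ Ω (2 * A) := by
    rintro t ⟨ht, hle⟩
    by_contra! hlt
    have hpos := one_sub_pos_of_mem_heights hr ht
    have ht0 : 0 < t := hT.1.trans_lt hlt
    have h1 := lt_centrifugal_of_cutoff_le hr ht hlt.le
    unfold centrifugal at h1
    rw [lt_div_iff₀ (by positivity)] at h1
    rw [div_le_iff₀ (by positivity)] at hle
    have h2 : (Ω ^ 2 * r₀ ^ 2 * (1 - t * r₀ ^ 2)) * (r₀ ^ 4 * t) ≤
        (A * (2 * (1 - 2 * t * r₀ ^ 2))) * (r₀ ^ 4 * t) := by linarith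
    have h3 := le_of_mul_le_mul_right h2 (by positivity)
    have h4 : 1 / 2 * (Ω ^ 2 * r₀ ^ 2) ≤ Ω ^ 2 * r₀ ^ 2 * (1 - t * r₀ ^ 2) := by
      have : 0 < Ω ^ 2 * r₀ ^ 2 := by positivity
      nlinarith
    linarith
  refine ⟨⟨_, hb⟩, lt_of_le_of_lt (csSup_le ?_ hb) hT.2⟩
  exact ⟨0, zero_mem_heights hr, by simp⟩

/-- Comparison with height 0 gives Π(t) ≤ 0. Replacing the pressure by its upper bound A makes the
integral explicit, and multiplication by 1 − 2 t r₀² gives the inequality that defines M_P. -/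
theorem le_heightBound_of_isMinOn {R₀ : ℝ} (hr : 0 < r₀) (hΩ : 0 < Ω)
    (hQ : Regular r₀ H B Q) {z t : ℝ} (hz : z ∈ Icc 0 H) (ht : t ∈ heights r₀)
    (hmin : IsMinOn (fun t => boundaryEnergy r₀ Ω Q t z) (heights r₀) t)
    (hle : ∀ p ∈ dom r₀ H, Q p ≤ Q (0, 0) + R₀ * (1 / (2 * r₀ ^ 2) + H)) :
    t ≤ heightBound r₀ H Ω R₀ Q := by
  refine le_csSup (heightBound_lt hr hΩ Q).1 ⟨ht, ?_⟩
  set A := Q (0, 0) + R₀ * (1 / (2 * r₀ ^ 2) + H)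
  have h0 := zero_mem_heights hr
  have hsub := uIcc_subset_heights h0 ht
  have hpos := one_sub_pos_of_mem_heights hr ht
  have h1 : boundaryEnergy r₀ Ω Q t z ≤ 0 := by
    have : boundaryEnergy r₀ Ω Q t z ≤ boundaryEnergy r₀ Ω Q 0 z := hmin h0
    rwa [boundaryEnergy_zero] at this
  have hi1 : IntervalIntegrable (fun s => centrifugal r₀ Ω s * weight r₀ s) volume 0 t :=
    (((continuousOn_centrifugal hr Ω).mono hsub).mul
      ((continuousOn_weight hr).mono hsub)).intervalIntegrable
  have hi2 := (intervalIntegrable_weight hr h0 ht).const_mul A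
  have h2 : (∫ s in (0 : ℝ)..t, centrifugal r₀ Ω s * weight r₀ s) -
      A * ∫ s in (0 : ℝ)..t, weight r₀ s ≤ boundaryEnergy r₀ Ω Q t z := by
    rw [← intervalIntegral.integral_const_mul, ← intervalIntegral.integral_sub hi1 hi2,
      boundaryEnergy_eq]
    refine intervalIntegral.integral_mono_on ht.1 (hi1.sub hi2)
      (intervalIntegrable_energy hr hQ hz h0 ht) fun s hs => ?_
    have hs' := mem_heights_of_le ht hs.1 hs.2
    have h3 := mul_le_mul_of_nonneg_right (hle (s, z) ⟨hs', hz⟩) (weight_nonneg r₀ s)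
    linarith
  rw [integral_centrifugal_mul_weight hr Ω ht, integral_weight hr ht] at h2
  have h3 : Ω ^ 2 * r₀ ^ 6 * ((1 - t * r₀ ^ 2) * t) / (2 * (1 - 2 * t * r₀ ^ 2) ^ 2) ≤
      A * (r₀ ^ 4 * t / (1 - 2 * t * r₀ ^ 2)) := by linarith
  have h4 := mul_le_mul_of_nonneg_right h3 hpos.le
  have e1 : Ω ^ 2 * r₀ ^ 6 * ((1 - t * r₀ ^ 2) * t) / (2 * (1 - 2 * t * r₀ ^ 2) ^ 2) *
      (1 - 2 * t * r₀ ^ 2) =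
      Ω ^ 2 * r₀ ^ 6 * (1 - t * r₀ ^ 2) * t / (2 * (1 - 2 * t * r₀ ^ 2)) := by
    field_simp
  have e2 : A * (r₀ ^ 4 * t / (1 - 2 * t * r₀ ^ 2)) * (1 - 2 * t * r₀ ^ 2) = A * r₀ ^ 4 * t := by
    rw [mul_assoc, div_mul_cancel₀ _ hpos.ne', mul_assoc]
  rwa [e1, e2] at h4

end Energy

/-! ### Extended integrals -/

section ExtInt

variable {X : Type*} [MeasurableSpace X] {μ : Measure X} {f g : X → ℝ}

theorem extInt_eq_integral (hf : Integrable f μ) : extInt μ f = ((∫ x, f x ∂μ : ℝ) : EReal) := by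
  have h1 : ∫⁻ x, ENNReal.ofReal (f x) ∂μ ≠ ∞ := hf.lintegral_lt_top.ne
  have h2 : ∫⁻ x, ENNReal.ofReal (-f x) ∂μ ≠ ∞ := hf.neg.lintegral_lt_top.ne
  rw [extInt, integral_eq_lintegral_pos_part_sub_lintegral_neg_part hf, EReal.coe_sub,
    EReal.coe_ennreal_toReal h1, EReal.coe_ennreal_toReal h2]

/-- Monotonicity of the positive and negative parts suffices; no integrability is required. -/
theorem extInt_mono (h : f ≤ᵐ[μ] g) : extInt μ f ≤ extInt μ g := by
  refine EReal.sub_le_sub ?_ ?_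
  · exact EReal.coe_ennreal_le_coe_ennreal_iff.2
      (lintegral_mono_ae (h.mono fun x hx => ENNReal.ofReal_le_ofReal hx))
  · exact EReal.coe_ennreal_le_coe_ennreal_iff.2
      (lintegral_mono_ae (h.mono fun x hx => ENNReal.ofReal_le_ofReal (neg_le_neg hx)))

/-- On a finite measure the lower bound makes the negative part integrable, so an infinite positive
part would give the value ⊤. -/
theorem integrable_of_extInt_ne_top [IsFiniteMeasure μ] (hf : AEStronglyMeasurable f μ) {C : ℝ}
    (hC : ∀ᵐ x ∂μ, -C ≤ f x) (h : extInt μ f ≠ ⊤) : Integrable f μ := by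
  have h2 : ∫⁻ x, ENNReal.ofReal (-f x) ∂μ ≠ ∞ := by
    refine ((lintegral_mono_ae (hC.mono fun x hx =>
      ENNReal.ofReal_le_ofReal (by linarith : -f x ≤ C))).trans_lt ?_).ne
    rw [lintegral_const]
    exact ENNReal.mul_lt_top ENNReal.ofReal_lt_top (measure_lt_top _ _)
  have h1 : ∫⁻ x, ENNReal.ofReal (f x) ∂μ ≠ ∞ := by
    intro htop
    apply h
    rw [extInt, htop, EReal.coe_ennreal_top]
    lift (∫⁻ x, ENNReal.ofReal (-f x) ∂μ) to NNReal using h2 with b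
    exact EReal.top_sub_coe b
  refine ⟨hf, ?_⟩
  rw [HasFiniteIntegral]
  calc ∫⁻ x, ‖f x‖ₑ ∂μ ≤ ∫⁻ x, (ENNReal.ofReal (f x) + ENNReal.ofReal (-f x)) ∂μ := by
        refine lintegral_mono fun x => ?_
        rw [← ofReal_norm, Real.norm_eq_abs]
        rcases le_total 0 (f x) with h | h
        · rw [abs_of_nonneg h]; exact le_self_add
        · rw [abs_of_nonpos h]; exact le_add_self
    _ = (∫⁻ x, ENNReal.ofReal (f x) ∂μ) + ∫⁻ x, ENNReal.ofReal (-f x) ∂μ :=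
        lintegral_add_left' hf.aemeasurable.ennreal_ofReal _
    _ < ∞ := ENNReal.add_lt_top.2 ⟨h1.lt_top, h2.lt_top⟩

end ExtInt

/-! ### The measures `e(s) χ_{D_ρ} ℒ²` -/

section Fluid

variable {r₀ H Ω B T : ℝ} {ρ : ℝ → ℝ} {Q : ℝ × ℝ → ℝ}

theorem region_congr {ρ' : ℝ → ℝ} (h : EqOn ρ ρ' (Icc 0 H)) : region H ρ = region H ρ' := by
  ext p
  constructor <;> rintro ⟨h1, h2, h3⟩
  · exact ⟨h1, h2, h h1 ▸ h3⟩
  · exact ⟨h1, h2, (h h1).symm ▸ h3⟩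

theorem IsHeight.exists_measurable (hρ : IsHeight r₀ H ρ) :
    ∃ ρ' : ℝ → ℝ, Measurable ρ' ∧ EqOn ρ ρ' (Icc 0 H) := by
  obtain ⟨g, hg, hgρ⟩ := (MeasurableEmbedding.subtype_coe
    (measurableSet_Icc (a := (0 : ℝ)) (b := H))).exists_measurable_extend hρ.1
    (fun _ => ⟨(0 : ℝ)⟩)
  exact ⟨g, hg, fun z hz => (congrFun hgρ ⟨z, hz⟩).symm⟩

theorem measurableSet_region_of_measurable (hρ : Measurable ρ) :
    MeasurableSet (region H ρ) := by
  have h1 : MeasurableSet {p : ℝ × ℝ | p.2 ∈ Icc 0 H} := measurable_snd measurableSet_Icc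
  have h2 : MeasurableSet {p : ℝ × ℝ | 0 ≤ p.1} := measurableSet_le measurable_const measurable_fst
  have h3 : MeasurableSet {p : ℝ × ℝ | p.1 ≤ ρ p.2} :=
    measurableSet_le measurable_fst (hρ.comp measurable_snd)
  exact h1.inter (h2.inter h3)

theorem IsHeight.measurableSet_region (hρ : IsHeight r₀ H ρ) : MeasurableSet (region H ρ) := by
  obtain ⟨ρ', hm, he⟩ := hρ.exists_measurable
  rw [region_congr he]
  exact measurableSet_region_of_measurable hm

theorem IsHeight.region_subset_dom (hρ : IsHeight r₀ H ρ) : region H ρ ⊆ dom r₀ H :=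
  fun p hp => ⟨mem_heights_of_le (hρ.2 p.2 hp.1) hp.2.1 hp.2.2, hp.1⟩

theorem fluid_absolutelyContinuous (r₀ H : ℝ) (ρ : ℝ → ℝ) :
    fluid r₀ H ρ ≪ volume.restrict (region H ρ) :=
  withDensity_absolutelyContinuous _ _

theorem IsHeight.ae_fluid_mem (hρ : IsHeight r₀ H ρ) : ∀ᵐ p ∂fluid r₀ H ρ, p ∈ region H ρ :=
  (fluid_absolutelyContinuous r₀ H ρ).ae_le (ae_restrict_mem hρ.measurableSet_region)

theorem fluid_absolutelyContinuous_volume (r₀ H : ℝ) (ρ : ℝ → ℝ) : fluid r₀ H ρ ≪ volume :=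
  (fluid_absolutelyContinuous r₀ H ρ).trans Measure.restrict_le_self.absolutelyContinuous

theorem measurable_density (r₀ : ℝ) :
    Measurable fun p : ℝ × ℝ => ENNReal.ofReal (weight r₀ p.1) :=
  ((measurable_weight r₀).comp measurable_fst).ennreal_ofReal

theorem integrable_fluid_iff (g : ℝ × ℝ → ℝ) :
    Integrable g (fluid r₀ H ρ) ↔
      IntegrableOn (fun p => g p * weight r₀ p.1) (region H ρ) := by
  rw [fluid, integrable_withDensity_iff (measurable_density r₀)
    (Eventually.of_forall fun _ => ENNReal.ofReal_lt_top)]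
  simp only [ENNReal.toReal_ofReal (weight_nonneg r₀ _)]
  rfl

theorem integral_fluid (g : ℝ × ℝ → ℝ) :
    ∫ p, g p ∂fluid r₀ H ρ = ∫ p in region H ρ, g p * weight r₀ p.1 := by
  rw [fluid, integral_withDensity_eq_integral_toReal_smul (measurable_density r₀)
    (Eventually.of_forall fun _ => ENNReal.ofReal_lt_top)]
  simp only [ENNReal.toReal_ofReal (weight_nonneg r₀ _), smul_eq_mul, mul_comm]

/-- Integration over `D_ρ` by slices. -/
theorem IsHeight.fubini (hρ : IsHeight r₀ H ρ) {g : ℝ × ℝ → ℝ}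
    (hg : Integrable g (fluid r₀ H ρ)) :
    IntegrableOn (fun z => ∫ s in (0 : ℝ)..ρ z, g (s, z) * weight r₀ s) (Icc 0 H) ∧
      ∫ p, g p ∂fluid r₀ H ρ = ∫ z in Icc 0 H, ∫ s in (0 : ℝ)..ρ z, g (s, z) * weight r₀ s := by
  have hm := hρ.measurableSet_region
  have hi := (integrable_indicator_iff hm).2 ((integrable_fluid_iff g).1 hg)
  rw [Measure.volume_eq_prod] at hi
  have key : (fun z => ∫ s, (region H ρ).indicator (fun p => g p * weight r₀ p.1) (s, z)) =
      (Icc 0 H).indicator fun z => ∫ s in (0 : ℝ)..ρ z, g (s, z) * weight r₀ s := by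
    ext z
    by_cases hz : z ∈ Icc 0 H
    · rw [indicator_of_mem hz, intervalIntegral.integral_of_le (hρ.2 z hz).1,
        ← integral_Icc_eq_integral_Ioc, ← integral_indicator measurableSet_Icc]
      congr 1; ext s
      by_cases hs : s ∈ Icc 0 (ρ z)
      · rw [indicator_of_mem hs, indicator_of_mem (show (s, z) ∈ region H ρ from ⟨hz, hs.1, hs.2⟩)]
      · rw [indicator_of_notMem hs, indicator_of_notMem
          (show (s, z) ∉ region H ρ from fun h => hs ⟨h.2.1, h.2.2⟩)]
    · rw [indicator_of_notMem hz]
      refine integral_eq_zero_of_ae (Eventually.of_forall fun s => ?_)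
      exact indicator_of_notMem (fun h => hz h.1) _
  constructor
  · have := hi.integral_prod_right
    rw [key] at this
    exact (integrable_indicator_iff measurableSet_Icc).1 this
  · rw [integral_fluid, ← integral_indicator hm, Measure.volume_eq_prod, integral_prod_symm _ hi,
      key, integral_indicator measurableSet_Icc]

theorem Regular.measurable_piece (hQ : Regular r₀ H B Q) (hρ : IsHeight r₀ H ρ) :
    AEStronglyMeasurable Q (fluid r₀ H ρ) :=
  ((hQ.cont.mono hρ.region_subset_dom).aestronglyMeasurable hρ.measurableSet_region).mono_ac
    (fluid_absolutelyContinuous r₀ H ρ)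

theorem Regular.integrable_fluid [IsFiniteMeasure (fluid r₀ H ρ)] (hQ : Regular r₀ H B Q)
    (hρ : IsHeight r₀ H ρ) : Integrable Q (fluid r₀ H ρ) :=
  Integrable.of_bound (hQ.measurable_piece hρ) B
    (hρ.ae_fluid_mem.mono fun p hp => hQ.abs_le p (hρ.region_subset_dom hp))

theorem isFiniteMeasure_fluid_of_le (hr : 0 < r₀) (hT : T ∈ heights r₀)
    (hρT : ∀ z ∈ Icc 0 H, ρ z ≤ T) : IsFiniteMeasure (fluid r₀ H ρ) := by
  have hsub : region H ρ ⊆ Icc 0 T ×ˢ Icc 0 H :=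
    fun p hp => ⟨⟨hp.2.1, hp.2.2.trans (hρT p.2 hp.1)⟩, hp.1⟩
  refine isFiniteMeasure_withDensity_ofReal ?_
  have hc : IntegrableOn (fun p : ℝ × ℝ => weight r₀ p.1) (Icc 0 T ×ˢ Icc 0 H) := by
    refine ContinuousOn.integrableOn_compact (isCompact_Icc.prod isCompact_Icc) ?_
    exact (continuousOn_weight hr).comp continuousOn_fst
      fun p hp => mem_heights_of_le hT hp.1.1 hp.1.2
  exact (hc.mono_set hsub).2

theorem integrable_centrifugal_of_ae_le [IsFiniteMeasure (fluid r₀ H ρ)] (hr : 0 < r₀)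
    (hρ : IsHeight r₀ H ρ) (hT : T ∈ heights r₀)
    (hρT : ∀ᵐ p ∂fluid r₀ H ρ, p.1 ≤ T) :
    Integrable (fun p : ℝ × ℝ => centrifugal r₀ Ω p.1) (fluid r₀ H ρ) := by
  refine Integrable.of_bound
    ((measurable_centrifugal r₀ Ω).comp measurable_fst).aestronglyMeasurable
    (centrifugal r₀ Ω T) ?_
  filter_upwards [hρ.ae_fluid_mem, hρT] with p hp hpT
  rw [Real.norm_eq_abs,
    abs_of_nonneg (centrifugal_nonneg hr Ω (hρ.region_subset_dom hp).1)]
  exact centrifugal_le_of_le hr Ω hT hpT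

theorem ae_fluid_of_ae_snd {p : ℝ → Prop} (h : ∀ᵐ z ∂volume.restrict (Icc 0 H), p z) :
    ∀ᵐ x ∂fluid r₀ H ρ, x.2 ∈ Icc 0 H → p x.2 := by
  have h1 : ∀ᵐ z : ℝ, z ∈ Icc 0 H → p z := (ae_restrict_iff' measurableSet_Icc).1 h
  exact (fluid_absolutelyContinuous_volume r₀ H ρ).ae_le
    (Measure.quasiMeasurePreserving_snd.ae h1)

/-- The energy `∫ (h - Q) e χ_{D_ρ}`. -/
noncomputable def energy (r₀ H Ω : ℝ) (Q : ℝ × ℝ → ℝ) (ρ : ℝ → ℝ) : ℝ :=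
  ∫ p, (centrifugal r₀ Ω p.1 - Q p) ∂fluid r₀ H ρ

theorem integrable_boundaryEnergy [IsFiniteMeasure (fluid r₀ H ρ)]
    (hQ : Regular r₀ H B Q) (hρ : IsHeight r₀ H ρ)
    (hc : Integrable (fun p : ℝ × ℝ => centrifugal r₀ Ω p.1) (fluid r₀ H ρ)) :
    IntegrableOn (fun z => boundaryEnergy r₀ Ω Q (ρ z) z) (Icc 0 H) ∧
      energy r₀ H Ω Q ρ = ∫ z in Icc 0 H, boundaryEnergy r₀ Ω Q (ρ z) z :=
  hρ.fubini (g := fun p => centrifugal r₀ Ω p.1 - Q p) (hc.sub (hQ.integrable_fluid hρ))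

theorem integrable_centrifugal_of_le (hr : 0 < r₀)
    (hρ : IsHeight r₀ H ρ) (hT : T ∈ heights r₀) (hρT : ∀ z ∈ Icc 0 H, ρ z ≤ T) :
    Integrable (fun p : ℝ × ℝ => centrifugal r₀ Ω p.1) (fluid r₀ H ρ) := by
  have := isFiniteMeasure_fluid_of_le hr hT hρT
  exact integrable_centrifugal_of_ae_le hr hρ hT
    (hρ.ae_fluid_mem.mono fun p hp => hp.2.2.trans (hρT p.2 hp.1))

theorem isHeight_of_monotoneOn (hmono : MonotoneOn ρ (Icc 0 H))
    (hmem : ∀ z ∈ Icc 0 H, ρ z ∈ heights r₀) : IsHeight r₀ H ρ :=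
  ⟨Monotone.measurable fun a b hab => hmono a.2 b.2 hab, hmem⟩

theorem isHeight_topHeight (hr : 0 < r₀) (hΩ : 0 < Ω) (hQ : Regular r₀ H B Q) :
    IsHeight r₀ H (topHeight r₀ Ω Q) :=
  isHeight_of_monotoneOn (monotoneOn_topHeight hr hΩ hQ)
    fun _ hz => (topHeight_mem hr hΩ hQ hz).1

theorem topHeight_le_cutoff (hr : 0 < r₀) (hΩ : 0 < Ω) (hQ : Regular r₀ H B Q) :
    ∀ z ∈ Icc 0 H, topHeight r₀ Ω Q z ≤ cutoff r₀ Ω B := fun _ hz =>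
  le_cutoff_of_isMinOn hr hΩ hQ hz (topHeight_mem hr hΩ hQ hz).1 (topHeight_mem hr hΩ hQ hz).2

theorem energy_topHeight_le (hr : 0 < r₀) (hΩ : 0 < Ω) (hQ : Regular r₀ H B Q)
    (hρ : IsHeight r₀ H ρ) [IsFiniteMeasure (fluid r₀ H ρ)]
    (hc : Integrable (fun p : ℝ × ℝ => centrifugal r₀ Ω p.1) (fluid r₀ H ρ)) :
    energy r₀ H Ω Q (topHeight r₀ Ω Q) ≤ energy r₀ H Ω Q ρ := by
  have hT := cutoff_mem_heights hr hΩ B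
  have hle := topHeight_le_cutoff hr hΩ hQ
  have hfin := isFiniteMeasure_fluid_of_le hr hT hle
  have h1 := isHeight_topHeight hr hΩ hQ
  obtain ⟨i1, e1⟩ := integrable_boundaryEnergy hQ h1
    (integrable_centrifugal_of_le (Ω := Ω) hr h1 hT hle)
  obtain ⟨i2, e2⟩ := integrable_boundaryEnergy hQ hρ hc
  rw [e1, e2]
  refine setIntegral_mono_on i1 i2 measurableSet_Icc fun z hz => ?_
  exact (topHeight_mem hr hΩ hQ hz).2 (hρ.2 z hz)

/-- The slicewise minimizer is monotone, hence itself an admissible height function, so the infimum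
can be taken under the integral. -/
theorem dualBoundary_eq_energy (hr : 0 < r₀) (hΩ : 0 < Ω) (hQ : Regular r₀ H B Q) :
    dualBoundary r₀ H Ω Q = (energy r₀ H Ω Q (topHeight r₀ Ω Q) : EReal) := by
  have hT := cutoff_mem_heights hr hΩ B
  have hle := topHeight_le_cutoff hr hΩ hQ
  have hfin := isFiniteMeasure_fluid_of_le hr hT hle
  have h1 := isHeight_topHeight hr hΩ hQ
  obtain ⟨i1, e1⟩ := integrable_boundaryEnergy hQ h1
    (integrable_centrifugal_of_le (Ω := Ω) hr h1 hT hle)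
  rw [e1, ← extInt_eq_integral i1]
  refine le_antisymm (iInf₂_le (topHeight r₀ Ω Q) h1) (le_iInf₂ fun ρ hρ => extInt_mono ?_)
  filter_upwards [ae_restrict_mem measurableSet_Icc] with z hz
  exact (topHeight_mem hr hΩ hQ hz).2 (hρ.2 z hz)

/-- A height function attains the minimal energy exactly if it minimizes on almost every slice. -/
theorem minimizesAE_iff_energy_eq (hr : 0 < r₀) (hΩ : 0 < Ω) (hQ : Regular r₀ H B Q)
    (hρ : IsHeight r₀ H ρ) [IsFiniteMeasure (fluid r₀ H ρ)]
    (hc : Integrable (fun p : ℝ × ℝ => centrifugal r₀ Ω p.1) (fluid r₀ H ρ)) :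
    MinimizesAE r₀ H Ω Q ρ ↔ energy r₀ H Ω Q ρ = energy r₀ H Ω Q (topHeight r₀ Ω Q) := by
  have hT := cutoff_mem_heights hr hΩ B
  have hle := topHeight_le_cutoff hr hΩ hQ
  have hfin := isFiniteMeasure_fluid_of_le hr hT hle
  have h1 := isHeight_topHeight hr hΩ hQ
  obtain ⟨i1, e1⟩ := integrable_boundaryEnergy hQ h1
    (integrable_centrifugal_of_le (Ω := Ω) hr h1 hT hle)
  obtain ⟨i2, e2⟩ := integrable_boundaryEnergy hQ hρ hc
  have hmono : (fun z => boundaryEnergy r₀ Ω Q (topHeight r₀ Ω Q z) z) ≤ᵐ[volume.restrict (Icc 0 H)]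
      fun z => boundaryEnergy r₀ Ω Q (ρ z) z := by
    filter_upwards [ae_restrict_mem measurableSet_Icc] with z hz
    exact (topHeight_mem hr hΩ hQ hz).2 (hρ.2 z hz)
  rw [e1, e2, eq_comm, integral_eq_iff_of_ae_le i1 i2 hmono, MinimizesAE]
  constructor
  · intro h
    filter_upwards [h, ae_restrict_mem measurableSet_Icc, hmono] with z hz hzI hm
    exact le_antisymm hm (hz (topHeight_mem hr hΩ hQ hzI).1)
  · intro h
    filter_upwards [h, ae_restrict_mem measurableSet_Icc] with z hz hzI τ hτ
    have := (topHeight_mem hr hΩ hQ hzI).2 hτ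
    simp only [mem_ofPred_eq] at this ⊢
    rwa [← hz]

theorem ae_fluid_le_cutoff_of_minimizesAE (hr : 0 < r₀) (hΩ : 0 < Ω) (hQ : Regular r₀ H B Q)
    (hρ : IsHeight r₀ H ρ) (hmin : MinimizesAE r₀ H Ω Q ρ) :
    ∀ᵐ p ∂fluid r₀ H ρ, p.1 ≤ cutoff r₀ Ω B := by
  filter_upwards [ae_fluid_of_ae_snd hmin, hρ.ae_fluid_mem] with p hp hpm
  exact hpm.2.2.trans
    (le_cutoff_of_isMinOn hr hΩ hQ hpm.1 (hρ.2 p.2 hpm.1) (hp hpm.1))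

/-- A graph is a null set. Off it, convergence of the heights implies convergence of the indicators
of the regions. -/
theorem ae_fst_ne_height (hρ : Measurable ρ) : ∀ᵐ p : ℝ × ℝ, p.1 ≠ ρ p.2 := by
  have hm : MeasurableSet {p : ℝ × ℝ | p.1 = ρ p.2} :=
    measurableSet_eq_fun measurable_fst (hρ.comp measurable_snd)
  rw [ae_iff]
  simp only [ne_eq, not_not]
  rw [Measure.volume_eq_prod, Measure.prod_apply_symm hm]
  have : ∀ z : ℝ, (fun s : ℝ => (s, z)) ⁻¹' {p : ℝ × ℝ | p.1 = ρ p.2} = {ρ z} := by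
    intro z; ext s; simp
  simp [this]

/-- Dominated convergence over varying domains `D_ρ`. -/
theorem tendsto_integral_fluid (hr : 0 < r₀) (hT : T ∈ heights r₀) {ρn : ℕ → ℝ → ℝ}
    (hρn : ∀ n, IsHeight r₀ H (ρn n)) (hρnT : ∀ n, ∀ z ∈ Icc 0 H, ρn n z ≤ T)
    (hρ : IsHeight r₀ H ρ) (hρT : ∀ z ∈ Icc 0 H, ρ z ≤ T)
    (hlim : ∀ᵐ z ∂volume.restrict (Icc 0 H), Tendsto (fun n => ρn n z) atTop (𝓝 (ρ z)))
    {g : ℝ × ℝ → ℝ} {gn : ℕ → ℝ × ℝ → ℝ} {C : ℝ}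
    (hgm : ∀ n, AEStronglyMeasurable (gn n) (volume.restrict (Icc 0 T ×ˢ Icc 0 H)))
    (hgC : ∀ n, ∀ᵐ p ∂volume.restrict (Icc 0 T ×ˢ Icc 0 H), |gn n p| ≤ C)
    (hg : ∀ᵐ p ∂volume.restrict (Icc 0 T ×ˢ Icc 0 H), Tendsto (fun n => gn n p) atTop (𝓝 (g p))) :
    Tendsto (fun n => ∫ p, gn n p ∂fluid r₀ H (ρn n)) atTop
      (𝓝 (∫ p, g p ∂fluid r₀ H ρ)) := by
  have hbox : MeasurableSet (Icc 0 T ×ˢ Icc 0 H) := measurableSet_Icc.prod measurableSet_Icc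
  have key : ∀ (τ : ℝ → ℝ) (f : ℝ × ℝ → ℝ), IsHeight r₀ H τ → (∀ z ∈ Icc 0 H, τ z ≤ T) →
      ∫ p, f p ∂fluid r₀ H τ = ∫ p in Icc 0 T ×ˢ Icc 0 H,
        (region H τ).indicator (fun p => f p * weight r₀ p.1) p := by
    intro τ f hτ hτT
    rw [integral_fluid, setIntegral_indicator hτ.measurableSet_region, inter_eq_right.2]
    exact fun p hp => ⟨⟨hp.2.1, hp.2.2.trans (hτT p.2 hp.1)⟩, hp.1⟩
  rw [key ρ g hρ hρT]
  simp_rw [fun n => key (ρn n) (gn n) (hρn n) (hρnT n)]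
  have hvol : volume (Icc 0 T ×ˢ Icc 0 H) ≠ ∞ :=
    (isCompact_Icc.prod isCompact_Icc).measure_lt_top.ne
  refine tendsto_integral_of_dominated_convergence
    (fun _ => C * weight r₀ T) (fun n => ?_) ?_ (fun n => ?_) ?_
  · exact ((hgm n).mul ((measurable_weight r₀).comp measurable_fst).aestronglyMeasurable).indicator
      (hρn n).measurableSet_region
  · exact integrableOn_const hvol
  · filter_upwards [ae_restrict_mem hbox, hgC n] with p hp hpC
    refine (norm_indicator_le_norm_self _ _).trans ?_
    rw [norm_mul, Real.norm_eq_abs, Real.norm_eq_abs, abs_of_nonneg (weight_nonneg r₀ _)]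
    exact mul_le_mul hpC (weight_le_of_le hr hT hp.1.2) (weight_nonneg _ _)
      ((abs_nonneg _).trans hpC)
  · obtain ⟨ρ', hm, he⟩ := hρ.exists_measurable
    have hl : ∀ᵐ p : ℝ × ℝ, p.2 ∈ Icc 0 H → Tendsto (fun n => ρn n p.2) atTop (𝓝 (ρ p.2)) :=
      Measure.quasiMeasurePreserving_snd.ae ((ae_restrict_iff' measurableSet_Icc).1 hlim)
    filter_upwards [ae_restrict_mem hbox, hg, ae_restrict_of_ae hl,
      ae_restrict_of_ae (ae_fst_ne_height hm)] with p hp hpg hpl hpne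
    rw [← he hp.2] at hpne
    have hpl := hpl hp.2
    rcases lt_or_gt_of_ne hpne with h | h
    · have e1 := hpl.eventually (lt_mem_nhds h)
      rw [indicator_of_mem (show p ∈ region H ρ from ⟨hp.2, hp.1.1, h.le⟩)]
      refine Tendsto.congr' (f₁ := fun n => gn n p * weight r₀ p.1) ?_ (hpg.mul_const _)
      filter_upwards [e1] with n hn
      rw [indicator_of_mem (show p ∈ region H (ρn n) from ⟨hp.2, hp.1.1, hn.le⟩)]
    · have e1 := hpl.eventually (gt_mem_nhds h)
      rw [indicator_of_notMem (show p ∉ region H ρ from fun h' => h.not_ge h'.2.2)]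
      refine tendsto_const_nhds.congr' ?_
      filter_upwards [e1] with n hn
      rw [indicator_of_notMem (show p ∉ region H (ρn n) from fun h' => hn.not_ge h'.2.2)]

/-- Almost all points of `D_ρ` are interior points of `𝒟`. -/
theorem IsHeight.ae_fluid_mem_interior (hρ : IsHeight r₀ H ρ) :
    ∀ᵐ p ∂fluid r₀ H ρ, p ∈ Ioo 0 (1 / (2 * r₀ ^ 2)) ×ˢ Ioo 0 H := by
  have h1 : ∀ᵐ p : ℝ × ℝ, p.1 ≠ 0 := Measure.quasiMeasurePreserving_fst.ae (Measure.ae_ne volume 0)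
  have h2 : ∀ᵐ p : ℝ × ℝ, p.2 ≠ 0 := Measure.quasiMeasurePreserving_snd.ae (Measure.ae_ne volume 0)
  have h3 : ∀ᵐ p : ℝ × ℝ, p.2 ≠ H := Measure.quasiMeasurePreserving_snd.ae (Measure.ae_ne volume H)
  have hac := (fluid_absolutelyContinuous_volume r₀ H ρ).ae_le
  filter_upwards [hac h1, hac h2, hac h3, hρ.ae_fluid_mem] with p h1 h2 h3 hp
  have hd := hρ.region_subset_dom hp
  exact ⟨⟨lt_of_le_of_ne hd.1.1 h1.symm, hd.1.2⟩, lt_of_le_of_ne hd.2.1 h2.symm,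
    lt_of_le_of_ne hd.2.2 h3⟩

theorem isProbabilityMeasure_fluid (h1 : ∫ p in region H ρ, weight r₀ p.1 = 1) :
    IsProbabilityMeasure (fluid r₀ H ρ) := by
  constructor
  have hi : IntegrableOn (fun p : ℝ × ℝ => weight r₀ p.1) (region H ρ) := by
    -- A non-integrable weight would have Bochner integral 0 by convention, so the value 1 forces
    -- integrability.
    by_contra h
    rw [integral_undef h] at h1
    exact zero_ne_one h1
  rw [fluid, withDensity_apply _ MeasurableSet.univ, Measure.restrict_univ,
    ← ofReal_integral_eq_lintegral_ofReal hi (Eventually.of_forall fun p => weight_nonneg r₀ p.1),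
    h1, ENNReal.ofReal_one]

theorem integral_weight_region_eq_one [IsProbabilityMeasure (fluid r₀ H ρ)] :
    ∫ p in region H ρ, weight r₀ p.1 = 1 := by
  have := integral_fluid (r₀ := r₀) (H := H) (ρ := ρ) fun _ => 1
  simpa using this.symm

end Fluid

/-! ### Legendre transforms -/

/-- The Legendre transform `P(p) = sup_{q ∈ Δ} (⟨p, q⟩ - ψ(q))`. -/
noncomputable def leg (Δ : Set (ℝ × ℝ)) (ψ : ℝ × ℝ → ℝ) (p : ℝ × ℝ) : ℝ :=
  sSup ((fun q => dot p q - ψ q) '' Δ)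

/-- The Legendre transform `Ψ(q) = sup_{p ∈ 𝒟} (⟨p, q⟩ - P(p))`. -/
noncomputable def dleg (r₀ H : ℝ) (P : ℝ × ℝ → ℝ) (q : ℝ × ℝ) : ℝ :=
  sSup ((fun p => dot p q - P p) '' dom r₀ H)

theorem continuous_dot_right (p : ℝ × ℝ) : Continuous fun q => dot p q := by
  unfold dot; fun_prop

theorem continuous_dot_left (q : ℝ × ℝ) : Continuous fun p => dot p q := by
  unfold dot; fun_prop

theorem dot_sub_dot_left_le {R : ℝ} {q : ℝ × ℝ} (hq : q ∈ Icc 0 R ×ˢ Icc 0 R) (p p' : ℝ × ℝ) :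
    dot p q - dot p' q ≤ 2 * R * ‖p - p'‖ := by
  have h1 : p.1 - p'.1 ≤ ‖p - p'‖ := (le_abs_self _).trans (norm_fst_le (p - p'))
  have h2 : p.2 - p'.2 ≤ ‖p - p'‖ := (le_abs_self _).trans (norm_snd_le (p - p'))
  have h3 : dot p q - dot p' q = (p.1 - p'.1) * q.1 + (p.2 - p'.2) * q.2 := by unfold dot; ring
  rw [h3]
  have h4 := mul_le_mul h1 hq.1.2 hq.1.1 (norm_nonneg (p - p'))
  have h5 := mul_le_mul h2 hq.2.2 hq.2.1 (norm_nonneg (p - p'))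
  linarith

theorem dot_sub_dot_right_le {r₀ H : ℝ} {p : ℝ × ℝ} (hp : p ∈ dom r₀ H) (q q' : ℝ × ℝ) :
    dot p q - dot p q' ≤ (1 / (2 * r₀ ^ 2) + H) * ‖q - q'‖ := by
  have h1 : q.1 - q'.1 ≤ ‖q - q'‖ := (le_abs_self _).trans (norm_fst_le (q - q'))
  have h2 : q.2 - q'.2 ≤ ‖q - q'‖ := (le_abs_self _).trans (norm_snd_le (q - q'))
  have h3 : dot p q - dot p q' = (q.1 - q'.1) * p.1 + (q.2 - q'.2) * p.2 := by unfold dot; ring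
  rw [h3]
  have h4 := mul_le_mul h1 hp.1.2.le hp.1.1 (norm_nonneg (q - q'))
  have h5 := mul_le_mul h2 hp.2.2 hp.2.1 (norm_nonneg (q - q'))
  linarith

theorem dot_le_of_mem {r₀ H R : ℝ} {p q : ℝ × ℝ} (hp : p ∈ dom r₀ H)
    (hq : q ∈ Icc 0 R ×ˢ Icc 0 R) : dot p q ≤ R * (1 / (2 * r₀ ^ 2) + H) := by
  have h4 := mul_le_mul hp.1.2.le hq.1.2 hq.1.1 (hp.1.1.trans hp.1.2.le)
  have h5 := mul_le_mul hp.2.2 hq.2.2 hq.2.1 (hp.2.1.trans hp.2.2)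
  unfold dot
  linarith

theorem dot_nonneg_of_mem {r₀ H : ℝ} {p q : ℝ × ℝ} (hp : p ∈ dom r₀ H)
    (hq : q ∈ quadrant) : 0 ≤ dot p q :=
  add_nonneg (mul_nonneg hp.1.1 hq.1) (mul_nonneg hp.2.1 hq.2)

theorem box_subset_quadrant (R : ℝ) : Icc 0 R ×ˢ Icc 0 R ⊆ quadrant :=
  fun _ hq => ⟨hq.1.1, hq.2.1⟩

theorem zero_mem_dom {r₀ H : ℝ} (hr : 0 < r₀) (hH : 0 < H) : ((0, 0) : ℝ × ℝ) ∈ dom r₀ H :=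
  ⟨zero_mem_heights hr, le_rfl, hH.le⟩

theorem lipschitzWith_of_le_add {L : ℝ} {f : ℝ × ℝ → ℝ}
    (h : ∀ x y, f x - f y ≤ L * ‖x - y‖) : LipschitzWith L.toNNReal f := by
  refine LipschitzWith.of_le_add_mul' L fun x y => ?_
  rw [dist_eq_norm]
  linarith [h x y]

section Leg

variable {Δ : Set (ℝ × ℝ)} {R₀ : ℝ} {ψ ψ' : ℝ × ℝ → ℝ}

theorem leg_congr (h : EqOn ψ ψ' Δ) : leg Δ ψ = leg Δ ψ' := by
  ext p
  unfold leg
  congr 1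
  exact image_congr fun q hq => by rw [h hq]

variable (hΔ : IsCompact Δ) (hne : Δ.Nonempty)

include hΔ hne in
theorem exists_leg_eq (hψ : ContinuousOn ψ Δ) (p : ℝ × ℝ) :
    ∃ q ∈ Δ, leg Δ ψ p = dot p q - ψ q := by
  obtain ⟨q, hq, h⟩ := hΔ.exists_sSup_image_eq hne
    ((continuous_dot_right p).continuousOn.sub hψ)
  exact ⟨q, hq, h⟩

include hΔ in
theorem le_leg (hψ : ContinuousOn ψ Δ) (p : ℝ × ℝ) {q : ℝ × ℝ} (hq : q ∈ Δ) :
    dot p q - ψ q ≤ leg Δ ψ p :=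
  le_csSup (hΔ.bddAbove_image ((continuous_dot_right p).continuousOn.sub hψ))
    (mem_image_of_mem _ hq)

include hΔ hne in
theorem isLUB_leg (hψ : ContinuousOn ψ Δ) (p : ℝ × ℝ) :
    IsLUB ((fun q => dot p q - ψ q) '' Δ) (leg Δ ψ p) :=
  isLUB_csSup (hne.image _) (hΔ.bddAbove_image ((continuous_dot_right p).continuousOn.sub hψ))

include hΔ hne in
theorem abs_leg_sub_leg_le (hψ : ContinuousOn ψ Δ) (hψ' : ContinuousOn ψ' Δ) {ε : ℝ}
    (h : ∀ q ∈ Δ, |ψ q - ψ' q| ≤ ε) (p : ℝ × ℝ) : |leg Δ ψ p - leg Δ ψ' p| ≤ ε := by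
  obtain ⟨q, hq, e⟩ := exists_leg_eq hΔ hne hψ p
  obtain ⟨q', hq', e'⟩ := exists_leg_eq hΔ hne hψ' p
  have h1 := le_leg hΔ hψ p hq'
  have h2 := le_leg hΔ hψ' p hq
  have h3 := abs_le.1 (h q hq)
  have h4 := abs_le.1 (h q' hq')
  rw [abs_le]
  constructor <;> linarith

include hΔ hne in
theorem tendsto_leg {ψn : ℕ → ℝ × ℝ → ℝ} (hψ : ContinuousOn ψ Δ)
    (hψn : ∀ n, ContinuousOn (ψn n) Δ) (hlim : TendstoUniformlyOn ψn ψ atTop Δ) (p : ℝ × ℝ) :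
    Tendsto (fun n => leg Δ (ψn n) p) atTop (𝓝 (leg Δ ψ p)) := by
  rw [Metric.tendsto_nhds]
  intro ε hε
  filter_upwards [Metric.tendstoUniformlyOn_iff.1 hlim (ε / 2) (half_pos hε)] with n hn
  rw [Real.dist_eq]
  refine lt_of_le_of_lt (abs_leg_sub_leg_le hΔ hne (hψn n) hψ (ε := ε / 2) (fun q hq => ?_) p)
    (half_lt_self hε)
  rw [← Real.dist_eq, dist_comm]
  exact (hn q hq).le

variable (hR : Δ ⊆ Icc 0 R₀ ×ˢ Icc 0 R₀)

include hΔ hne hR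

/-- A maximizer at p competes at p'; its slopes lie in [0, R₀], and the sup norm on the plane costs
the factor 2. The transform is defined on the whole plane, so Rademacher's theorem applies without
boundary issues. -/
theorem lipschitzWith_leg (hψ : ContinuousOn ψ Δ) :
    LipschitzWith (2 * R₀).toNNReal (leg Δ ψ) := by
  refine lipschitzWith_of_le_add fun p p' => ?_
  obtain ⟨q, hq, e⟩ := exists_leg_eq hΔ hne hψ p
  linarith [le_leg hΔ hψ p' hq, dot_sub_dot_left_le (hR hq) p p']

/-- All slopes q ∈ Δ have nonnegative coordinates. -/
theorem leg_mono (hψ : ContinuousOn ψ Δ) : Monotone (leg Δ ψ) := by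
  intro p p' h
  obtain ⟨q, hq, e⟩ := exists_leg_eq hΔ hne hψ p
  have h1 := le_leg hΔ hψ p' hq
  have h2 := mul_le_mul_of_nonneg_right h.1 (hR hq).1.1
  have h3 := mul_le_mul_of_nonneg_right h.2 (hR hq).2.1
  have h4 : dot p q ≤ dot p' q := add_le_add h2 h3
  linarith

/-- The maximizer at p competes at the origin, where ⟨p, q⟩ vanishes. This is the source of the
constant A in M_P. -/
theorem leg_le_add {r₀ H : ℝ} (hψ : ContinuousOn ψ Δ) {p : ℝ × ℝ} (hp : p ∈ dom r₀ H) :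
    leg Δ ψ p ≤ leg Δ ψ (0, 0) + R₀ * (1 / (2 * r₀ ^ 2) + H) := by
  obtain ⟨q, hq, e⟩ := exists_leg_eq hΔ hne hψ p
  have h1 := le_leg hΔ hψ (0, 0) hq
  have h2 : dot (0, 0) q = 0 := by simp [dot]
  linarith [dot_le_of_mem hp (hR hq)]

theorem abs_leg_le {r₀ H C : ℝ} (hψ : ContinuousOn ψ Δ) (hC : ∀ q ∈ Δ, |ψ q| ≤ C) {p : ℝ × ℝ}
    (hp : p ∈ dom r₀ H) : |leg Δ ψ p| ≤ C + R₀ * (1 / (2 * r₀ ^ 2) + H) := by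
  obtain ⟨q, hq, e⟩ := exists_leg_eq hΔ hne hψ p
  have h1 := abs_le.1 (hC q hq)
  have h2 := dot_le_of_mem hp (hR hq)
  have h3 := dot_nonneg_of_mem hp (box_subset_quadrant R₀ (hR hq))
  rw [e, abs_le]
  constructor <;> linarith

theorem regular_leg_add {r₀ H C δ : ℝ} (hψ : ContinuousOn ψ Δ) (hC : ∀ q ∈ Δ, |ψ q| ≤ C)
    (hδ : 0 ≤ δ) (hδ1 : δ ≤ 1) :
    Regular r₀ H (C + R₀ * (1 / (2 * r₀ ^ 2) + H) + H) (fun p => leg Δ ψ p + δ * p.2) where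
  cont := ((lipschitzWith_leg hΔ hne hR hψ).continuous.add (by fun_prop)).continuousOn
  abs_le p hp := by
    have h1 := abs_leg_le hΔ hne hR hψ hC hp
    refine (abs_add_le _ _).trans (add_le_add h1 ?_)
    rw [abs_of_nonneg (mul_nonneg hδ hp.2.1)]
    have := mul_le_mul hδ1 hp.2.2 hp.2.1 zero_le_one
    linarith
  mono s hs z hz z' hz' hzz := by
    have h1 : leg Δ ψ (s, z) ≤ leg Δ ψ (s, z') :=
      leg_mono hΔ hne hR hψ (show ((s, z) : ℝ × ℝ) ≤ (s, z') from ⟨le_rfl, hzz⟩)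
    have h2 := mul_le_mul_of_nonneg_left hzz hδ
    exact add_le_add h1 h2

omit hΔ hne hR in
theorem tendsto_argmax_aux {X : Type*} [TopologicalSpace X] {K : Set X} {fn : ℕ → X → ℝ}
    {f : X → ℝ} (hlim : TendstoUniformlyOn fn f atTop K) (hf : ContinuousOn f K) {xn : ℕ → X}
    {x : X} (hxn : ∀ n, xn n ∈ K) (hx : x ∈ K) (h : Tendsto xn atTop (𝓝 x)) :
    Tendsto (fun n => fn n (xn n)) atTop (𝓝 (f x)) := by
  have hw : Tendsto xn atTop (𝓝[K] x) :=
    tendsto_nhdsWithin_iff.2 ⟨h, Eventually.of_forall hxn⟩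
  exact (hlim.tendsto_comp (hf x hx) hw)

end Leg

/-! ### Gradients -/

section Grad

/-- The linear form `⟨·, q⟩`. -/
noncomputable def dotCLM (q : ℝ × ℝ) : ℝ × ℝ →L[ℝ] ℝ :=
  q.1 • ContinuousLinearMap.fst ℝ ℝ ℝ + q.2 • ContinuousLinearMap.snd ℝ ℝ ℝ

theorem dotCLM_apply (q p : ℝ × ℝ) : dotCLM q p = dot p q := by
  simp [dotCLM, dot, mul_comm]

theorem measurable_grad (f : ℝ × ℝ → ℝ) : Measurable (grad f) :=
  (measurable_fderiv_apply_const ℝ f (1, 0)).prodMk (measurable_fderiv_apply_const ℝ f (0, 1))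

theorem grad_congr {f g : ℝ × ℝ → ℝ} {p : ℝ × ℝ} (h : f =ᶠ[𝓝 p] g) : grad f p = grad g p := by
  unfold grad; rw [h.fderiv_eq]

/-- An affine function of slope q touches g from below at p, so p is a critical point of the
difference. -/
theorem grad_eq_of_touching {g : ℝ × ℝ → ℝ} {p q : ℝ × ℝ} (hg : DifferentiableAt ℝ g p)
    (h : ∀ᶠ p' in 𝓝 p, dot p' q - g p' ≤ dot p q - g p) : grad g p = q := by
  have hmax : IsLocalMax (fun p' => dotCLM q p' - g p') p := by
    simpa only [IsLocalMax, IsMaxFilter, dotCLM_apply] using h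
  have hd : HasFDerivAt (fun p' => dotCLM q p' - g p') (dotCLM q - fderiv ℝ g p) p :=
    (dotCLM q).hasFDerivAt.sub hg.hasFDerivAt
  have h0 := sub_eq_zero.1 (hmax.hasFDerivAt_eq_zero hd)
  unfold grad
  rw [← h0, dotCLM_apply, dotCLM_apply]
  simp [dot]

variable {Δ : Set (ℝ × ℝ)} {R₀ : ℝ} {ψ : ℝ × ℝ → ℝ}
  (hΔ : IsCompact Δ) (hne : Δ.Nonempty)

include hΔ in
theorem grad_leg_eq (hψ : ContinuousOn ψ Δ) {p q : ℝ × ℝ} (hq : q ∈ Δ)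
    (hd : DifferentiableAt ℝ (leg Δ ψ) p) (h : leg Δ ψ p = dot p q - ψ q) :
    grad (leg Δ ψ) p = q := by
  refine grad_eq_of_touching hd (Eventually.of_forall fun p' => ?_)
  linarith [le_leg hΔ hψ p' hq]

include hΔ hne

theorem grad_leg_mem (hψ : ContinuousOn ψ Δ) {p : ℝ × ℝ}
    (hd : DifferentiableAt ℝ (leg Δ ψ) p) :
    grad (leg Δ ψ) p ∈ Δ ∧
      leg Δ ψ p = dot p (grad (leg Δ ψ) p) - ψ (grad (leg Δ ψ) p) := by
  obtain ⟨q, hq, e⟩ := exists_leg_eq hΔ hne hψ p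
  rw [grad_leg_eq hΔ hψ hq hd e]
  exact ⟨hq, e⟩

/-- Maximizers of `⟨p, ·⟩ - ψₙ` converge to `∇P(p)`. -/
theorem tendsto_argmax {ψn : ℕ → ℝ × ℝ → ℝ} (hψ : ContinuousOn ψ Δ)
    (hψn : ∀ n, ContinuousOn (ψn n) Δ) (hlim : TendstoUniformlyOn ψn ψ atTop Δ) {p : ℝ × ℝ}
    (hd : DifferentiableAt ℝ (leg Δ ψ) p) {qn : ℕ → ℝ × ℝ} (hqn : ∀ n, qn n ∈ Δ)
    (he : ∀ n, leg Δ (ψn n) p = dot p (qn n) - ψn n (qn n)) :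
    Tendsto qn atTop (𝓝 (grad (leg Δ ψ) p)) := by
  -- Every subsequential limit maximizes the limit problem, and at a point of differentiability the
  -- only maximizer is the gradient.
  refine tendsto_of_subseq_tendsto fun ns hns => ?_
  obtain ⟨q, hq, φ, hφ, hφq⟩ := hΔ.tendsto_subseq fun n => hqn (ns n)
  refine ⟨φ, ?_⟩
  have hsub : Tendsto (fun n => ns (φ n)) atTop atTop := hns.comp hφ.tendsto_atTop
  have h1 : Tendsto (fun n => ψn (ns (φ n)) (qn (ns (φ n)))) atTop (𝓝 (ψ q)) :=
    tendsto_argmax_aux (fn := fun n => ψn (ns (φ n)))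
      (fun u hu => hsub.eventually (hlim u hu)) hψ (fun n => hqn _) hq hφq
  have h2 : Tendsto (fun n => dot p (qn (ns (φ n)))) atTop (𝓝 (dot p q)) :=
    ((continuous_dot_right p).tendsto q).comp hφq
  have h3 := (tendsto_leg hΔ hne hψ hψn hlim p).comp hsub
  have h4 : leg Δ ψ p = dot p q - ψ q := by
    refine tendsto_nhds_unique h3 ((h2.sub h1).congr fun n => ?_)
    exact (he _).symm
  rw [grad_leg_eq hΔ hψ hq hd h4]
  exact hφq

end Grad

/-! ### Legendre pairs -/

section Pairs

variable {Δ : Set (ℝ × ℝ)} {r₀ H R₀ B : ℝ} {P ψ : ℝ × ℝ → ℝ}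

theorem bddAbove_dleg (hP : ∀ p ∈ dom r₀ H, |P p| ≤ B) (q : ℝ × ℝ) :
    BddAbove ((fun p => dot p q - P p) '' dom r₀ H) := by
  refine ⟨(1 / (2 * r₀ ^ 2) + H) * ‖q‖ + B, ?_⟩
  rintro _ ⟨p, hp, rfl⟩
  have h1 := dot_sub_dot_right_le hp q 0
  have h2 := (abs_le.1 (hP p hp)).1
  have h3 : dot p 0 = 0 := by simp [dot]
  rw [sub_zero] at h1
  simp only
  linarith

theorem le_dleg (hP : ∀ p ∈ dom r₀ H, |P p| ≤ B) {p : ℝ × ℝ} (hp : p ∈ dom r₀ H) (q : ℝ × ℝ) :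
    dot p q - P p ≤ dleg r₀ H P q :=
  le_csSup (bddAbove_dleg hP q) (mem_image_of_mem _ hp)

theorem isLUB_dleg (hr : 0 < r₀) (hH : 0 < H) (hP : ∀ p ∈ dom r₀ H, |P p| ≤ B) (q : ℝ × ℝ) :
    IsLUB ((fun p => dot p q - P p) '' dom r₀ H) (dleg r₀ H P q) :=
  isLUB_csSup (Nonempty.image _ ⟨_, zero_mem_dom hr hH⟩) (bddAbove_dleg hP q)

theorem lipschitzWith_dleg (hr : 0 < r₀) (hH : 0 < H) (hP : ∀ p ∈ dom r₀ H, |P p| ≤ B) :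
    LipschitzWith (1 / (2 * r₀ ^ 2) + H).toNNReal (dleg r₀ H P) := by
  refine lipschitzWith_of_le_add fun q q' => ?_
  rw [sub_le_iff_le_add]
  refine (isLUB_dleg hr hH hP q).2 ?_
  rintro _ ⟨p, hp, rfl⟩
  have h1 := dot_sub_dot_right_le hp q q'
  have h2 := le_dleg hP hp q'
  simp only
  linarith

variable (hΔ : IsCompact Δ) (hne : Δ.Nonempty) (hR : Δ ⊆ Icc 0 R₀ ×ˢ Icc 0 R₀)

include hΔ hne hR

theorem exists_bound_leg (r₀ H : ℝ) (hψ : ContinuousOn ψ Δ) :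
    ∃ B, ∀ p ∈ dom r₀ H, |leg Δ ψ p| ≤ B := by
  obtain ⟨C, hC⟩ := hΔ.exists_bound_of_continuousOn hψ
  exact ⟨_, fun p hp => abs_leg_le hΔ hne hR hψ hC hp⟩

theorem dleg_leg_le (hr : 0 < r₀) (hH : 0 < H) (hψ : ContinuousOn ψ Δ) {q : ℝ × ℝ} (hq : q ∈ Δ) :
    dleg r₀ H (leg Δ ψ) q ≤ ψ q := by
  obtain ⟨B, hB⟩ := exists_bound_leg hΔ hne hR r₀ H hψ
  refine (isLUB_dleg hr hH hB q).2 ?_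
  rintro _ ⟨p, hp, rfl⟩
  have := le_leg hΔ hψ p hq
  simp only
  linarith

/-- One inequality is the definition of the second transform. The other holds because the double
transform lies below ψ on Δ and transforming reverses order. -/
theorem leg_dleg_leg (hr : 0 < r₀) (hH : 0 < H) (hψ : ContinuousOn ψ Δ) :
    EqOn (leg Δ (dleg r₀ H (leg Δ ψ))) (leg Δ ψ) (dom r₀ H) := by
  obtain ⟨B, hB⟩ := exists_bound_leg hΔ hne hR r₀ H hψ
  have hc := (lipschitzWith_dleg hr hH hB).continuous.continuousOn (s := Δ)
  intro p hp
  apply le_antisymm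
  · obtain ⟨q, hq, e⟩ := exists_leg_eq hΔ hne hc p
    rw [e]
    linarith [le_dleg hB hp q]
  · obtain ⟨q, hq, e⟩ := exists_leg_eq hΔ hne hψ p
    rw [e]
    linarith [dleg_leg_le hΔ hne hR hr hH hψ hq, le_leg hΔ hc p hq]

theorem leg_mem_legendrePairs (hr : 0 < r₀) (hH : 0 < H) (hψ : ContinuousOn ψ Δ) :
    (leg Δ ψ, dleg r₀ H (leg Δ ψ)) ∈ legendrePairs r₀ H Δ := by
  obtain ⟨B, hB⟩ := exists_bound_leg hΔ hne hR r₀ H hψ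
  have hc := (lipschitzWith_dleg hr hH hB).continuous
  refine ⟨⟨(lipschitzWith_leg hΔ hne hR hψ).continuous.continuousOn, hc.continuousOn,
    fun p hp q _ => ?_⟩, fun p hp => ?_, fun q _ => isLUB_dleg hr hH hB q⟩
  · have := le_dleg hB hp q
    simp only
    linarith
  · simp only
    rw [← leg_dleg_leg hΔ hne hR hr hH hψ hp]
    exact isLUB_leg hΔ hne hc.continuousOn p

end Pairs

/-! ### Compactness of Lipschitz functions -/

theorem exists_subseq_tendstoUniformlyOn_of_lipschitzWith {X : Type*} [PseudoMetricSpace X]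
    {K : Set X} (hK : IsCompact K) {L : ℝ≥0} {C : ℝ} {ψn : ℕ → X → ℝ}
    (hL : ∀ n, LipschitzWith L (ψn n)) (hC : ∀ n, ∀ x ∈ K, |ψn n x| ≤ C) :
    ∃ ψ : X → ℝ, LipschitzWith L ψ ∧ ∃ φ : ℕ → ℕ, StrictMono φ ∧
      TendstoUniformlyOn (fun n => ψn (φ n)) ψ atTop K := by
  have : CompactSpace K := isCompact_iff_compactSpace.1 hK
  let A : Set (K →ᵇ ℝ) := {f | LipschitzWith L f ∧ ∀ x, f x ∈ Icc (-C) C}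
  have hclosed : IsClosed A := by
    have hA : A = (⋂ x, ⋂ y, {f : K →ᵇ ℝ | dist (f x) (f y) ≤ L * dist x y}) ∩
        ⋂ x, {f : K →ᵇ ℝ | f x ∈ Icc (-C) C} := by
      ext f
      simp [A, lipschitzWith_iff_dist_le_mul]
    rw [hA]
    refine IsClosed.inter (isClosed_iInter fun x => isClosed_iInter fun y => ?_)
      (isClosed_iInter fun x => ?_)
    · exact isClosed_le ((continuous_eval_const x).dist
        (continuous_eval_const y)) continuous_const
    · exact isClosed_Icc.preimage (continuous_eval_const x)
  have hequi : Equicontinuous ((↑) : A → K → ℝ) :=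
    (LipschitzWith.uniformEquicontinuous _ L fun f => f.2.1).equicontinuous
  have hA : IsCompact A := BoundedContinuousFunction.arzela_ascoli₂ (Icc (-C) C) isCompact_Icc A
    hclosed (fun f x hf => hf.2 x) hequi
  let g : ℕ → K →ᵇ ℝ := fun n => BoundedContinuousFunction.mkOfCompact
    ⟨fun x : K => ψn n x, (hL n).continuous.comp continuous_subtype_val⟩
  have hg : ∀ n, g n ∈ A := fun n =>
    ⟨(mul_one L) ▸ (hL n).comp (LipschitzWith.subtype_val K), fun x => abs_le.1 (hC n x x.2)⟩
  obtain ⟨f, hf, φ, hφ, hlim⟩ := hA.tendsto_subseq hg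
  -- Arzelà–Ascoli gives a limit only on K. It is extended by the junk value 0, and `extend_real`
  -- then yields a function on X with the same Lipschitz constant.
  have hf' : LipschitzOnWith L (Function.extend (Subtype.val : K → X) f 0) K := by
    rw [lipschitzOnWith_iff_restrict]
    convert hf.1
    ext x
    exact Subtype.val_injective.extend_apply f 0 x
  obtain ⟨ψ, hψ, he⟩ := hf'.extend_real
  refine ⟨ψ, hψ, φ, hφ, ?_⟩
  have h1 := BoundedContinuousFunction.tendsto_iff_tendstoUniformly.1 hlim
  rw [Metric.tendstoUniformlyOn_iff]
  intro ε hε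
  filter_upwards [Metric.tendstoUniformly_iff.1 h1 ε hε] with n hn x hx
  have h2 := hn ⟨x, hx⟩
  have h3 : ψ x = f ⟨x, hx⟩ := by
    rw [← he hx]
    exact Subtype.val_injective.extend_apply f 0 ⟨x, hx⟩
  rw [h3]
  exact h2

/-! ### The perturbed dual problem -/

/-- The data of the problem. -/
structure Setting (r₀ H Ω R₀ : ℝ) (Δ : Set (ℝ × ℝ)) (σ : Measure (ℝ × ℝ)) : Prop where
  r₀_pos : 0 < r₀
  H_pos : 0 < H
  Ω_pos : 0 < Ω
  isCompact : IsCompact Δ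
  nonempty : Δ.Nonempty
  subset : Δ ⊆ Icc 0 R₀ ×ˢ Icc 0 R₀
  prob : IsProbabilityMeasure σ
  ae_mem : ∀ᵐ q ∂σ, q ∈ Δ

/-- The pressure `P(s, z) + δ z`, where `P` is the Legendre transform of `ψ`. -/
noncomputable def pressure (Δ : Set (ℝ × ℝ)) (δ : ℝ) (ψ : ℝ × ℝ → ℝ) (p : ℝ × ℝ) : ℝ :=
  leg Δ ψ p + δ * p.2

/-- The part of the dual functional that depends on the pair, for the pressure `P + δ z`. -/
noncomputable def objective (r₀ H Ω : ℝ) (Δ : Set (ℝ × ℝ)) (σ : Measure (ℝ × ℝ)) (δ : ℝ)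
    (ψ : ℝ × ℝ → ℝ) : ℝ :=
  energy r₀ H Ω (pressure Δ δ ψ) (topHeight r₀ Ω (pressure Δ δ ψ)) - ∫ q, ψ q ∂σ

/-- The bound of the pressure `P + δ z` for `|ψ| ≤ C` and `δ ∈ [0, 1]`. -/
noncomputable def pressureBound (r₀ H R₀ C : ℝ) : ℝ := C + R₀ * (1 / (2 * r₀ ^ 2) + H) + H

/-! ### Comparison of energies and minimizers for different pressures -/

section Energy

variable {r₀ H Ω B B' : ℝ} {Q Q' : ℝ × ℝ → ℝ} {ρ : ℝ → ℝ}

theorem energy_sub_energy [IsFiniteMeasure (fluid r₀ H ρ)] (hQ : Regular r₀ H B Q)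
    (hQ' : Regular r₀ H B' Q') (hρ : IsHeight r₀ H ρ)
    (hc : Integrable (fun p : ℝ × ℝ => centrifugal r₀ Ω p.1) (fluid r₀ H ρ)) :
    energy r₀ H Ω Q ρ - energy r₀ H Ω Q' ρ = ∫ p, (Q' p - Q p) ∂fluid r₀ H ρ := by
  rw [energy, energy, ← integral_sub (f := fun p => centrifugal r₀ Ω p.1 - Q p)
    (g := fun p => centrifugal r₀ Ω p.1 - Q' p) (hc.sub (hQ.integrable_fluid hρ))
    (hc.sub (hQ'.integrable_fluid hρ))]
  congr 1; ext p; ring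

/-- The minimizer for one pressure is a competitor for the other. This envelope comparison serves
both semicontinuity and the first variation. -/
theorem energy_topHeight_le_energy_topHeight (hr : 0 < r₀) (hΩ : 0 < Ω) (hQ : Regular r₀ H B Q)
    (hQ' : Regular r₀ H B' Q') :
    energy r₀ H Ω Q (topHeight r₀ Ω Q) ≤ energy r₀ H Ω Q (topHeight r₀ Ω Q') := by
  have hρ := isHeight_topHeight hr hΩ hQ'
  have hT := cutoff_mem_heights hr hΩ B'
  have hle := topHeight_le_cutoff hr hΩ hQ'
  have := isFiniteMeasure_fluid_of_le hr hT hle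
  exact energy_topHeight_le hr hΩ hQ hρ (integrable_centrifugal_of_le hr hρ hT hle)

theorem energy_topHeight_anti (hr : 0 < r₀) (hΩ : 0 < Ω) (hQ : Regular r₀ H B Q)
    (hQ' : Regular r₀ H B' Q') (h : ∀ p ∈ dom r₀ H, Q p ≤ Q' p) :
    energy r₀ H Ω Q' (topHeight r₀ Ω Q') ≤ energy r₀ H Ω Q (topHeight r₀ Ω Q) := by
  have hρ := isHeight_topHeight hr hΩ hQ
  have hT := cutoff_mem_heights hr hΩ B
  have hle := topHeight_le_cutoff hr hΩ hQ
  have := isFiniteMeasure_fluid_of_le hr hT hle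
  have hc := integrable_centrifugal_of_le (Ω := Ω) hr hρ hT hle
  refine (energy_topHeight_le_energy_topHeight hr hΩ hQ' hQ).trans ?_
  have h1 := energy_sub_energy hQ hQ' hρ hc
  have h2 : 0 ≤ ∫ p, (Q' p - Q p) ∂fluid r₀ H (topHeight r₀ Ω Q) :=
    integral_nonneg_of_ae (hρ.ae_fluid_mem.mono fun p hp =>
      sub_nonneg.2 (h p (hρ.region_subset_dom hp)))
  linarith

theorem isHeight_const {t : ℝ} (ht : t ∈ heights r₀) : IsHeight r₀ H fun _ => t :=
  ⟨measurable_const, fun _ _ => ht⟩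

theorem energy_topHeight_nonpos (hr : 0 < r₀) (hΩ : 0 < Ω) (hQ : Regular r₀ H B Q) :
    energy r₀ H Ω Q (topHeight r₀ Ω Q) ≤ 0 := by
  have h0 := zero_mem_heights hr
  have := isFiniteMeasure_fluid_of_le (H := H) (ρ := fun _ => 0) hr h0 fun _ _ => le_rfl
  have hc := integrable_centrifugal_of_le (H := H) (Ω := Ω) hr (isHeight_const h0) h0
    fun _ _ => le_rfl
  refine (energy_topHeight_le hr hΩ hQ (isHeight_const h0) hc).trans ?_
  rw [(integrable_boundaryEnergy hQ (isHeight_const h0) hc).2]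
  simp [boundaryEnergy_zero]

/-- A height at which the constant height function has mass two. -/
theorem exists_height_mass_two (hr : 0 < r₀) (hH : 0 < H) :
    ∃ t ∈ heights r₀, ∫ _, (1 : ℝ) ∂fluid r₀ H (fun _ => t) = 2 := by
  -- This is the solution t of H r₀⁴ t / (1 − 2 t r₀²) = 2.
  have hmem : 2 / (H * r₀ ^ 4 + 4 * r₀ ^ 2) ∈ heights r₀ := by
    refine ⟨by positivity, ?_⟩
    rw [div_lt_div_iff₀ (by positivity) (by positivity)]
    have : 0 < H * r₀ ^ 4 := by positivity
    linarith
  refine ⟨_, hmem, ?_⟩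
  have := isFiniteMeasure_fluid_of_le (H := H) (ρ := fun _ => 2 / (H * r₀ ^ 4 + 4 * r₀ ^ 2)) hr hmem
    fun _ _ => le_rfl
  rw [((isHeight_const hmem).fubini (g := fun _ => 1) (integrable_const 1)).2]
  simp only [one_mul]
  rw [integral_weight hr hmem, setIntegral_const, smul_eq_mul, Real.volume_real_Icc_of_le hH.le]
  have h : 1 - 2 * (2 / (H * r₀ ^ 4 + 4 * r₀ ^ 2)) * r₀ ^ 2 =
      H * r₀ ^ 4 / (H * r₀ ^ 4 + 4 * r₀ ^ 2) := by
    rw [eq_div_iff (by positivity), sub_mul, mul_right_comm, mul_assoc 2,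
      div_mul_cancel₀ _ (by positivity)]
    ring
  have hD : 0 < H * r₀ ^ 4 + 4 * r₀ ^ 2 := by positivity
  rw [h, sub_zero]
  field_simp

/-- Minimizers of a converging sequence of energies converge to the minimizer, if it is unique. -/
theorem tendsto_minimizer (hr : 0 < r₀) {T : ℝ} (hT : T ∈ heights r₀) {Qn : ℕ → ℝ × ℝ → ℝ}
    (hQn : ∀ n, Regular r₀ H B (Qn n)) {tn : ℕ → ℝ} {t z : ℝ} (hz : z ∈ Icc 0 H)
    (htn : ∀ n, tn n ∈ Icc 0 T)
    (hlim : ∀ s ∈ heights r₀, Tendsto (fun n => Qn n (s, z)) atTop (𝓝 (Q (s, z))))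
    (hmin : ∀ n, IsMinOn (fun t => boundaryEnergy r₀ Ω (Qn n) t z) (heights r₀) (tn n))
    (huniq : ∀ τ ∈ heights r₀, IsMinOn (fun t => boundaryEnergy r₀ Ω Q t z) (heights r₀) τ → τ = t) :
    Tendsto tn atTop (𝓝 t) := by
  refine tendsto_of_subseq_tendsto fun ns hns => ?_
  obtain ⟨τ, hτ, φ, hφ, hφτ⟩ := isCompact_Icc.tendsto_subseq fun n => htn (ns n)
  refine ⟨φ, ?_⟩
  have hsub : Tendsto (fun n => ns (φ n)) atTop atTop := hns.comp hφ.tendsto_atTop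
  have h := isMinOn_boundaryEnergy_of_tendsto hr hT (Qn := fun n => Qn (ns (φ n)))
    (fun n => hQn _) (fun n => htn _) hφτ (fun _ => hz) (fun s hs => (hlim s hs).comp hsub)
    fun n => hmin _
  rw [← huniq τ (mem_heights_of_le hT hτ.1 hτ.2) h]
  exact hφτ

end Energy

/-! ### Maximizers of the perturbed objective and their first variation -/

namespace Setting

variable {r₀ H Ω R₀ C δ : ℝ} {Δ : Set (ℝ × ℝ)} {σ : Measure (ℝ × ℝ)} {ψ ψ' : ℝ × ℝ → ℝ}
  (S : Setting r₀ H Ω R₀ Δ σ)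

include S

theorem regular_pressure (hψ : ContinuousOn ψ Δ) (hC : ∀ q ∈ Δ, |ψ q| ≤ C) (hδ : δ ∈ Icc 0 1) :
    Regular r₀ H (pressureBound r₀ H R₀ C) (pressure Δ δ ψ) :=
  regular_leg_add S.isCompact S.nonempty S.subset hψ hC hδ.1 hδ.2

theorem exists_regular_pressure (hψ : ContinuousOn ψ Δ) (hδ : δ ∈ Icc 0 1) :
    ∃ B, Regular r₀ H B (pressure Δ δ ψ) := by
  obtain ⟨C, hC⟩ := S.isCompact.exists_bound_of_continuousOn hψ
  exact ⟨_, S.regular_pressure hψ hC hδ⟩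

theorem integrable (hψ : ContinuousOn ψ Δ) : Integrable ψ σ := by
  have := S.prob
  rw [← Measure.restrict_eq_self_of_ae_mem S.ae_mem]
  exact hψ.integrableOn_compact S.isCompact

/-- The double transform keeps the pressure on 𝒟 and lowers ψ on Δ. Its Lipschitz constant depends
only on 𝒟, so maximization can be restricted to an equicontinuous class. -/
theorem objective_le_dleg_leg (hψ : ContinuousOn ψ Δ) (hδ : δ ∈ Icc 0 1) :
    objective r₀ H Ω Δ σ δ ψ ≤ objective r₀ H Ω Δ σ δ (dleg r₀ H (leg Δ ψ)) := by
  have h := S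
  obtain ⟨hr, hH, hΩ, hΔ, hne, hR, -, hae⟩ := h
  obtain ⟨B, hB⟩ := exists_bound_leg hΔ hne hR r₀ H hψ
  have hc := (lipschitzWith_dleg hr hH hB).continuous.continuousOn (s := Δ)
  obtain ⟨B₁, h₁⟩ := S.exists_regular_pressure hψ hδ
  obtain ⟨B₂, h₂⟩ := S.exists_regular_pressure hc hδ
  have h3 := energy_topHeight_anti hr hΩ h₂ h₁ fun p hp => by
    simp only [pressure, leg_dleg_leg hΔ hne hR hr hH hψ hp, le_refl]
  have h4 : ∫ q, dleg r₀ H (leg Δ ψ) q ∂σ ≤ ∫ q, ψ q ∂σ :=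
    integral_mono_ae (S.integrable hc) (S.integrable hψ)
      (hae.mono fun q hq => dleg_leg_le hΔ hne hR hr hH hψ hq)
  exact sub_le_sub h3 h4

theorem dist_le {q q' : ℝ × ℝ} (hq : q ∈ Δ) (hq' : q' ∈ Δ) : dist q q' ≤ R₀ := by
  have h1 := S.subset hq
  have h2 := S.subset hq'
  rw [Prod.dist_eq, Real.dist_eq, Real.dist_eq]
  refine max_le (abs_le.2 ⟨?_, ?_⟩) (abs_le.2 ⟨?_, ?_⟩) <;>
    linarith [h1.1.1, h1.1.2, h1.2.1, h1.2.2, h2.1.1, h2.1.2, h2.2.1, h2.2.2]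

theorem length_pos : 0 < 1 / (2 * r₀ ^ 2) + H := by
  have := S.r₀_pos
  have := S.H_pos
  positivity

theorem abs_sub_le (hψ : LipschitzWith (1 / (2 * r₀ ^ 2) + H).toNNReal ψ) {q q' : ℝ × ℝ}
    (hq : q ∈ Δ) (hq' : q' ∈ Δ) : |ψ q - ψ q'| ≤ (1 / (2 * r₀ ^ 2) + H) * R₀ := by
  have h1 := hψ.dist_le_mul q q'
  rw [Real.dist_eq, Real.coe_toNNReal _ S.length_pos.le] at h1
  exact h1.trans (mul_le_mul_of_nonneg_left (S.dist_le hq hq') S.length_pos.le)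

theorem sub_le_integral (hψ : LipschitzWith (1 / (2 * r₀ ^ 2) + H).toNNReal ψ) {q₀ : ℝ × ℝ}
    (hq₀ : q₀ ∈ Δ) : ψ q₀ - (1 / (2 * r₀ ^ 2) + H) * R₀ ≤ ∫ q, ψ q ∂σ := by
  have := S.prob
  have h1 : ∫ _, (ψ q₀ - (1 / (2 * r₀ ^ 2) + H) * R₀) ∂σ ≤ ∫ q, ψ q ∂σ := by
    refine integral_mono_ae (integrable_const _) (S.integrable hψ.continuous.continuousOn) ?_
    filter_upwards [S.ae_mem] with q hq
    linarith [(abs_le.1 (S.abs_sub_le hψ hq₀ hq)).2]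
  simpa using h1

/-- The objective is coercive, uniformly in the perturbation. -/
theorem exists_objective_le {q₀ : ℝ × ℝ} (hq₀ : q₀ ∈ Δ) : ∃ c : ℝ, ∀ δ ∈ Icc (0 : ℝ) 1,
    ∀ ψ, LipschitzWith (1 / (2 * r₀ ^ 2) + H).toNNReal ψ →
      objective r₀ H Ω Δ σ δ ψ ≤ c - |ψ q₀| := by
  have h := S
  obtain ⟨hr, hH, hΩ, hΔ, hne, hR, -, hae⟩ := h
  obtain ⟨t, ht, hmass⟩ := exists_height_mass_two hr hH
  have hfin := isFiniteMeasure_fluid_of_le (H := H) (ρ := fun _ => t) hr ht fun _ _ => le_rfl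
  have hcen := integrable_centrifugal_of_le (H := H) (Ω := Ω) hr (isHeight_const ht) ht
    fun _ _ => le_rfl
  set c₀ := ∫ p, centrifugal r₀ Ω p.1 ∂fluid r₀ H (fun _ => t)
  have hc₀ : 0 ≤ c₀ := integral_nonneg_of_ae ((isHeight_const ht).ae_fluid_mem.mono fun p hp =>
    centrifugal_nonneg hr Ω ((isHeight_const ht).region_subset_dom hp).1)
  refine ⟨c₀ + (1 / (2 * r₀ ^ 2) + H) * R₀, fun δ hδ ψ hψ => ?_⟩
  have hψc := hψ.continuous.continuousOn (s := Δ)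
  obtain ⟨B, hB⟩ := S.exists_regular_pressure hψc hδ
  have h1 := energy_topHeight_nonpos hr hΩ hB
  have h2 := S.sub_le_integral hψ hq₀
  have h3 := energy_topHeight_le hr hΩ hB (isHeight_const ht) hcen
  -- The pressure is at least −ψ(q₀). A trial fluid of mass two outweighs the unit mass of σ, which
  -- gives decay as ψ(q₀) → −∞; the empty fluid in `h1` handles ψ(q₀) → +∞.
  have h4 : energy r₀ H Ω (pressure Δ δ ψ) (fun _ => t) ≤ c₀ + 2 * ψ q₀ := by
    rw [energy, integral_sub hcen (hB.integrable_fluid (isHeight_const ht)), ← hmass,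
      ← integral_mul_const, sub_eq_add_neg, ← integral_neg]
    simp only [one_mul]
    refine add_le_add_right (integral_mono_ae (hB.integrable_fluid (isHeight_const ht)).neg
      (integrable_const _) ((isHeight_const ht).ae_fluid_mem.mono fun p hp => ?_)) _
    have hp' := (isHeight_const ht).region_subset_dom hp
    have h5 := le_leg hΔ hψc p hq₀
    have h6 := dot_nonneg_of_mem hp' (box_subset_quadrant R₀ (hR hq₀))
    have h7 := mul_nonneg hδ.1 hp'.2.1
    simp only [Pi.neg_apply, pressure]
    linarith
  unfold objective
  rcases abs_cases (ψ q₀) with ⟨h5, -⟩ | ⟨h5, -⟩ <;> linarith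

/-- The pressure grows with δ, so the energy falls. The value at δ = 1, ψ = 0 is thus a lower bound
for the supremum that is uniform in δ. -/
theorem objective_one_zero_le (hδ : δ ∈ Icc 0 1) :
    objective r₀ H Ω Δ σ 1 0 ≤ objective r₀ H Ω Δ σ δ 0 := by
  have hc : ContinuousOn (0 : ℝ × ℝ → ℝ) Δ := continuousOn_const
  obtain ⟨B₁, h₁⟩ := S.exists_regular_pressure hc hδ
  obtain ⟨B₂, h₂⟩ := S.exists_regular_pressure hc (δ := 1) ⟨zero_le_one, le_rfl⟩
  refine sub_le_sub_right (energy_topHeight_anti S.r₀_pos S.Ω_pos h₁ h₂ fun p hp => ?_) _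
  exact add_le_add_right (mul_le_mul_of_nonneg_right hδ.2 hp.2.1) _

/-- A maximizer of the perturbed objective, with a bound uniform in the perturbation. -/
theorem exists_objective_max : ∃ C : ℝ, ∀ δ ∈ Icc (0 : ℝ) 1,
    ∃ ψ, LipschitzWith (1 / (2 * r₀ ^ 2) + H).toNNReal ψ ∧ (∀ q ∈ Δ, |ψ q| ≤ C) ∧
      ∀ ψ', ContinuousOn ψ' Δ → objective r₀ H Ω Δ σ δ ψ' ≤ objective r₀ H Ω Δ σ δ ψ := by
  obtain ⟨q₀, hq₀⟩ := S.nonempty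
  obtain ⟨c, hc⟩ := S.exists_objective_le hq₀
  set L := 1 / (2 * r₀ ^ 2) + H with hL
  set m := objective r₀ H Ω Δ σ 1 0
  have hr := S.r₀_pos
  have hΩ := S.Ω_pos
  -- An objective of at least m − 1 gives |ψ(q₀)| ≤ c − m + 1 by coercivity, and L R₀ bounds the
  -- oscillation on Δ. Neither c nor m depends on δ.
  refine ⟨c - m + 1 + L * R₀, fun δ hδ => ?_⟩
  let A : Set ℝ := {x | ∃ ψ, LipschitzWith L.toNNReal ψ ∧ objective r₀ H Ω Δ σ δ ψ = x}
  have h0A : objective r₀ H Ω Δ σ δ 0 ∈ A := ⟨0, LipschitzWith.const' 0, rfl⟩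
  have hA : BddAbove A := by
    refine ⟨c, ?_⟩
    rintro _ ⟨ψ, hψ, rfl⟩
    linarith [hc δ hδ ψ hψ, abs_nonneg (ψ q₀)]
  have hbound : ∀ ψ, LipschitzWith L.toNNReal ψ → m - 1 ≤ objective r₀ H Ω Δ σ δ ψ →
      ∀ q ∈ Δ, |ψ q| ≤ c - m + 1 + L * R₀ := by
    intro ψ hψ hm q hq
    have h1 := hc δ hδ ψ hψ
    have h2 := S.abs_sub_le hψ hq hq₀
    have h3 := abs_sub_abs_le_abs_sub (ψ q) (ψ q₀)
    linarith
  have hseq : ∀ n : ℕ, ∃ ψ, LipschitzWith L.toNNReal ψ ∧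
      sSup A - 1 / ((n : ℝ) + 1) < objective r₀ H Ω Δ σ δ ψ := by
    intro n
    have : sSup A - 1 / ((n : ℝ) + 1) < sSup A := sub_lt_self _ (by positivity)
    obtain ⟨_, ⟨ψ, hψ, rfl⟩, hlt⟩ := exists_lt_of_lt_csSup ⟨_, h0A⟩ this
    exact ⟨ψ, hψ, hlt⟩
  choose ψn hψn hlt using hseq
  have hm : m ≤ sSup A := (S.objective_one_zero_le hδ).trans (le_csSup hA h0A)
  have hnb : ∀ n, ∀ q ∈ Δ, |ψn n q| ≤ c - m + 1 + L * R₀ := fun n => by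
    refine hbound _ (hψn n) ?_
    have : 1 / ((n : ℝ) + 1) ≤ 1 := by
      rw [div_le_one (by positivity)]
      linarith [(Nat.cast_nonneg n : (0 : ℝ) ≤ n)]
    linarith [hlt n]
  obtain ⟨ψ, hψ, φ, hφ, hlim⟩ :=
    exists_subseq_tendstoUniformlyOn_of_lipschitzWith S.isCompact hψn hnb
  have hψc := hψ.continuous.continuousOn (s := Δ)
  have hψnc := fun n => (hψn n).continuous.continuousOn (s := Δ)
  have hψC : ∀ q ∈ Δ, |ψ q| ≤ c - m + 1 + L * R₀ := fun q hq =>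
    le_of_tendsto (hlim.tendsto_at hq).abs (Eventually.of_forall fun n => hnb _ q hq)
  have hQ := S.regular_pressure hψc hψC hδ
  have hQn := fun n => S.regular_pressure (hψnc n) (hnb n) hδ
  set ρ := topHeight r₀ Ω (pressure Δ δ ψ) with hρdef
  have hρ := isHeight_topHeight hr hΩ hQ
  have hT := cutoff_mem_heights hr hΩ (pressureBound r₀ H R₀ (c - m + 1 + L * R₀))
  have hle := topHeight_le_cutoff hr hΩ hQ
  have hfin := isFiniteMeasure_fluid_of_le hr hT hle
  have hcen := integrable_centrifugal_of_le (Ω := Ω) hr hρ hT hle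
  have hprob := S.prob
  -- Upper semicontinuity: the limit's height function is a fixed competitor for every term of the
  -- sequence, so only the pressure varies in the limit.
  have hmax : sSup A ≤ objective r₀ H Ω Δ σ δ ψ := by
    have t1 : Tendsto (fun n : ℕ => sSup A - 1 / (((φ n : ℕ) : ℝ) + 1)) atTop (𝓝 (sSup A)) := by
      have := (tendsto_one_div_add_atTop_nhds_zero_nat (𝕜 := ℝ)).comp hφ.tendsto_atTop
      simpa using this.const_sub (sSup A)
    have t2 : Tendsto (fun n => energy r₀ H Ω (pressure Δ δ (ψn (φ n))) ρ) atTop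
        (𝓝 (energy r₀ H Ω (pressure Δ δ ψ) ρ)) := by
      refine tendsto_integral_of_dominated_convergence
        (fun p => |centrifugal r₀ Ω p.1| + pressureBound r₀ H R₀ (c - m + 1 + L * R₀))
        (fun n => (hcen.sub ((hQn _).integrable_fluid hρ)).aestronglyMeasurable)
        (hcen.abs.add (integrable_const _)) (fun n => ?_) (Eventually.of_forall fun p => ?_)
      · filter_upwards [hρ.ae_fluid_mem] with p hp
        exact (abs_sub _ _).trans
          (add_le_add_right ((hQn _).abs_le p (hρ.region_subset_dom hp)) _)
      · exact ((tendsto_leg S.isCompact S.nonempty hψc (fun n => hψnc _) hlim p).add_const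
          _).const_sub _
    have t3 : Tendsto (fun n => ∫ q, ψn (φ n) q ∂σ) atTop (𝓝 (∫ q, ψ q ∂σ)) := by
      refine tendsto_integral_of_dominated_convergence (fun _ => c - m + 1 + L * R₀)
        (fun n => (S.integrable (hψnc _)).aestronglyMeasurable) (integrable_const _)
        (fun n => S.ae_mem.mono fun q hq => hnb _ q hq)
        (S.ae_mem.mono fun q hq => hlim.tendsto_at hq)
    refine le_of_tendsto_of_tendsto' t1 (t2.sub t3) fun n => ?_
    refine (hlt (φ n)).le.trans (sub_le_sub_right ?_ _)
    exact energy_topHeight_le_energy_topHeight hr hΩ (hQn _) hQ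
  refine ⟨ψ, hψ, hψC, fun ψ' hψ' => ?_⟩
  obtain ⟨B, hB⟩ := exists_bound_leg S.isCompact S.nonempty S.subset r₀ H hψ'
  refine (S.objective_le_dleg_leg hψ' hδ).trans (le_trans ?_ hmax)
  exact le_csSup hA ⟨_, lipschitzWith_dleg hr S.H_pos hB, rfl⟩

theorem strictMonoOn_pressure (hψ : ContinuousOn ψ Δ) (hδ : 0 < δ) (s : ℝ) :
    StrictMonoOn (fun z => pressure Δ δ ψ (s, z)) (Icc 0 H) := by
  intro z _ z' _ h
  have h1 : leg Δ ψ (s, z) ≤ leg Δ ψ (s, z') := leg_mono S.isCompact S.nonempty S.subset hψ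
    (show ((s, z) : ℝ × ℝ) ≤ (s, z') from ⟨le_rfl, h.le⟩)
  exact add_lt_add_of_le_of_lt h1 (mul_lt_mul_of_pos_left h hδ)

theorem ae_unique_minimizer (hψ : ContinuousOn ψ Δ) (hδ : δ ∈ Ioc 0 1) :
    ∀ᵐ z ∂volume.restrict (Icc 0 H), ∀ τ ∈ heights r₀,
      IsMinOn (fun t => boundaryEnergy r₀ Ω (pressure Δ δ ψ) t z) (heights r₀) τ →
        τ = topHeight r₀ Ω (pressure Δ δ ψ) z := by
  obtain ⟨B, hB⟩ := S.exists_regular_pressure hψ ⟨hδ.1.le, hδ.2⟩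
  have hcount := (countable_multiple_minimizers (Ω := Ω) S.r₀_pos hB
    fun s _ => S.strictMonoOn_pressure hψ hδ.1 s).ae_notMem volume
  filter_upwards [ae_restrict_of_ae hcount, ae_restrict_mem measurableSet_Icc] with z hz hzI τ hτ
    hmin
  by_contra hne
  have hle := le_topHeight S.r₀_pos S.Ω_pos hB hzI hτ hmin
  obtain ⟨h1, h2⟩ := topHeight_mem S.r₀_pos S.Ω_pos hB hzI
  exact hz ⟨hzI, _, h1, τ, hτ, lt_of_le_of_ne hle hne, h2, hmin⟩

theorem ae_differentiableAt_leg (hψ : ContinuousOn ψ Δ) :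
    ∀ᵐ p : ℝ × ℝ, DifferentiableAt ℝ (leg Δ ψ) p :=
  (lipschitzWith_leg S.isCompact S.nonempty S.subset hψ).ae_differentiableAt

/-- First variation of the objective at a maximizer. -/
theorem integral_comp_grad_le (hψ : ContinuousOn ψ Δ) (hδ : δ ∈ Ioc 0 1)
    (hmax : ∀ ψ', ContinuousOn ψ' Δ → objective r₀ H Ω Δ σ δ ψ' ≤ objective r₀ H Ω Δ σ δ ψ)
    (φ : ℝ × ℝ →ᵇ ℝ) :
    ∫ p, φ (grad (leg Δ ψ) p) ∂fluid r₀ H (topHeight r₀ Ω (pressure Δ δ ψ)) ≤ ∫ q, φ q ∂σ := by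
  have hr := S.r₀_pos
  have hΩ := S.Ω_pos
  have hprob := S.prob
  have hδ' : δ ∈ Icc (0 : ℝ) 1 := ⟨hδ.1.le, hδ.2⟩
  obtain ⟨C, hC⟩ := S.isCompact.exists_bound_of_continuousOn hψ
  let ε : ℕ → ℝ := fun n => 1 / ((n : ℝ) + 1)
  have hε0 : ∀ n, 0 < ε n := fun n => by positivity
  have hε1 : ∀ n, ε n ≤ 1 := fun n => by
    rw [div_le_one (by positivity)]
    linarith [(Nat.cast_nonneg n : (0 : ℝ) ≤ n)]
  have hεlim : Tendsto ε atTop (𝓝 0) := tendsto_one_div_add_atTop_nhds_zero_nat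
  -- Competitors in the direction φ.
  let ψn : ℕ → ℝ × ℝ → ℝ := fun n q => ψ q + ε n * φ q
  have hφ : ∀ q, |φ q| ≤ ‖φ‖ := fun q => φ.norm_coe_le_norm q
  have hdiff : ∀ n q, |ψ q - ψn n q| ≤ ε n * ‖φ‖ := by
    intro n q
    have : ψ q - ψn n q = -(ε n * φ q) := by simp only [ψn]; ring
    rw [this, abs_neg, abs_mul, abs_of_pos (hε0 n)]
    exact mul_le_mul_of_nonneg_left (hφ q) (hε0 n).le
  have hψnc : ∀ n, ContinuousOn (ψn n) Δ := fun n =>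
    hψ.add (continuous_const.mul φ.continuous).continuousOn
  have hψnC : ∀ n, ∀ q ∈ Δ, |ψn n q| ≤ C + ‖φ‖ := by
    intro n q hq
    have h1 := abs_sub_abs_le_abs_sub (ψn n q) (ψ q)
    rw [abs_sub_comm] at h1
    have h2 := mul_le_mul_of_nonneg_right (hε1 n) (norm_nonneg φ)
    have h3 : |ψ q| ≤ C := hC q hq
    linarith [hdiff n q]
  have hlim : TendstoUniformlyOn ψn ψ atTop Δ := by
    rw [Metric.tendstoUniformlyOn_iff]
    intro η hη
    have : Tendsto (fun n => ε n * ‖φ‖) atTop (𝓝 0) := by simpa using hεlim.mul_const ‖φ‖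
    filter_upwards [this.eventually (gt_mem_nhds hη)] with n hn q _
    rw [Real.dist_eq]
    exact (hdiff n q).trans_lt hn
  set Q := pressure Δ δ ψ
  let Qn : ℕ → ℝ × ℝ → ℝ := fun n => pressure Δ δ (ψn n)
  have hQ : Regular r₀ H (pressureBound r₀ H R₀ (C + ‖φ‖)) Q := S.regular_pressure hψ
    (fun q hq => (hC q hq).trans (le_add_of_nonneg_right (norm_nonneg φ))) hδ'
  have hQn : ∀ n, Regular r₀ H (pressureBound r₀ H R₀ (C + ‖φ‖)) (Qn n) :=
    fun n => S.regular_pressure (hψnc n) (hψnC n) hδ'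
  set T := cutoff r₀ Ω (pressureBound r₀ H R₀ (C + ‖φ‖))
  have hT : T ∈ heights r₀ := cutoff_mem_heights hr hΩ _
  have hρ := isHeight_topHeight hr hΩ hQ
  have hρn := fun n => isHeight_topHeight hr hΩ (hQn n)
  have hρT : ∀ z ∈ Icc 0 H, topHeight r₀ Ω Q z ≤ T := topHeight_le_cutoff hr hΩ hQ
  have hρnT : ∀ n, ∀ z ∈ Icc 0 H, topHeight r₀ Ω (Qn n) z ≤ T :=
    fun n => topHeight_le_cutoff hr hΩ (hQn n)
  have hleg := tendsto_leg S.isCompact S.nonempty hψ hψnc hlim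
  -- Here δ > 0 is essential: minimizers are a.e. unique, so the fluid domains of the competitors
  -- converge.
  have hρlim : ∀ᵐ z ∂volume.restrict (Icc 0 H),
      Tendsto (fun n => topHeight r₀ Ω (Qn n) z) atTop (𝓝 (topHeight r₀ Ω Q z)) := by
    filter_upwards [S.ae_unique_minimizer hψ hδ, ae_restrict_mem measurableSet_Icc] with z hz hzI
    refine tendsto_minimizer hr hT hQn hzI (fun n => ⟨((hρn n).2 z hzI).1, hρnT n z hzI⟩)
      (fun s _ => (hleg (s, z)).add_const _)
      (fun n => (topHeight_mem hr hΩ (hQn n) hzI).2) hz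
  let gn : ℕ → ℝ × ℝ → ℝ := fun n p => (leg Δ ψ p - leg Δ (ψn n) p) / ε n
  have hgnC : ∀ n p, |gn n p| ≤ ‖φ‖ := by
    intro n p
    rw [abs_div, abs_of_pos (hε0 n), div_le_iff₀ (hε0 n), mul_comm]
    exact abs_leg_sub_leg_le S.isCompact S.nonempty hψ (hψnc n) (fun q _ => hdiff n q) p
  have hgnc : ∀ n, Continuous (gn n) := fun n =>
    ((lipschitzWith_leg S.isCompact S.nonempty S.subset hψ).continuous.sub
      (lipschitzWith_leg S.isCompact S.nonempty S.subset (hψnc n)).continuous).div_const _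
  -- The difference quotient is squeezed between φ at a maximizer for the perturbed potential and φ
  -- at the maximizer ∇P(p) for ψ.
  have hglim : ∀ᵐ p : ℝ × ℝ, Tendsto (fun n => gn n p) atTop (𝓝 (φ (grad (leg Δ ψ) p))) := by
    filter_upwards [S.ae_differentiableAt_leg hψ] with p hd
    obtain ⟨hmem, he⟩ := grad_leg_mem S.isCompact S.nonempty hψ hd
    choose qn hqn hen using fun n => exists_leg_eq S.isCompact S.nonempty (hψnc n) p
    have hqlim := tendsto_argmax S.isCompact S.nonempty hψ hψnc hlim hd hqn hen
    refine tendsto_of_tendsto_of_tendsto_of_le_of_le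
      ((φ.continuous.tendsto _).comp hqlim) tendsto_const_nhds (fun n => ?_) fun n => ?_
    · simp only [Function.comp_apply, gn]
      rw [le_div_iff₀ (hε0 n), hen n]
      have := le_leg S.isCompact hψ p (hqn n)
      simp only [ψn]
      linarith
    · simp only [gn]
      rw [div_le_iff₀ (hε0 n), he]
      have := le_leg S.isCompact (hψnc n) p hmem
      simp only [ψn] at this
      linarith
  have hconv := tendsto_integral_fluid hr hT hρn hρnT hρ hρT hρlim
    (fun n => (hgnc n).aestronglyMeasurable)
    (fun n => Eventually.of_forall (hgnC n)) (ae_restrict_of_ae hglim)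
  refine le_of_tendsto' hconv fun n => ?_
  have hfin := isFiniteMeasure_fluid_of_le hr hT (hρnT n)
  have hcen := integrable_centrifugal_of_le (Ω := Ω) hr (hρn n) hT (hρnT n)
  -- On the competitor's domain ρₙ, the integral of Q − Qₙ equals E(Qₙ, ρₙ) − E(Q, ρₙ). This is at
  -- most the difference of the minimal energies, hence at most ε ∫ φ dσ by maximality.
  have h1 := energy_sub_energy (hQn n) hQ (hρn n) hcen
  have h2 := energy_topHeight_le_energy_topHeight hr hΩ hQ (hQn n)
  have h3 := hmax (ψn n) (hψnc n)
  have h4 : ∫ q, ψn n q ∂σ = ∫ q, ψ q ∂σ + ε n * ∫ q, φ q ∂σ := by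
    rw [← integral_const_mul]
    exact integral_add (S.integrable hψ) ((φ.integrable σ).const_mul _)
  have h5 : ∫ p, gn n p ∂fluid r₀ H (topHeight r₀ Ω (Qn n)) =
      (∫ p, (Q p - Qn n p) ∂fluid r₀ H (topHeight r₀ Ω (Qn n))) / ε n := by
    rw [← integral_div]
    congr 1; ext p
    simp only [gn, Q, Qn, pressure]
    ring
  rw [h5, div_le_iff₀ (hε0 n), ← h1]
  unfold objective at h3
  rw [h4] at h3
  simp only [Qn, Q] at *
  linarith

/-- Solution of the perturbed problem. -/
theorem exists_perturbed_solution : ∃ C : ℝ, ∀ δ ∈ Ioc (0 : ℝ) 1,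
    ∃ ψ, LipschitzWith (1 / (2 * r₀ ^ 2) + H).toNNReal ψ ∧ (∀ q ∈ Δ, |ψ q| ≤ C) ∧
      (fluid r₀ H (topHeight r₀ Ω (pressure Δ δ ψ))).map (grad (leg Δ ψ)) = σ := by
  obtain ⟨C, hC⟩ := S.exists_objective_max
  refine ⟨C, fun δ hδ => ?_⟩
  have hδ' : δ ∈ Icc (0 : ℝ) 1 := ⟨hδ.1.le, hδ.2⟩
  obtain ⟨ψ, hψ, hψC, hmax⟩ := hC δ hδ'
  refine ⟨ψ, hψ, hψC, ?_⟩
  have hr := S.r₀_pos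
  have hΩ := S.Ω_pos
  have hprob := S.prob
  have hψc := hψ.continuous.continuousOn (s := Δ)
  have hQ := S.regular_pressure hψc hψC hδ'
  have hfin := isFiniteMeasure_fluid_of_le hr (cutoff_mem_heights hr hΩ _)
    (topHeight_le_cutoff hr hΩ hQ)
  refine ext_of_forall_integral_eq_of_IsFiniteMeasure fun φ => ?_
  rw [integral_map (measurable_grad _).aemeasurable φ.continuous.aestronglyMeasurable]
  refine le_antisymm (S.integral_comp_grad_le hψc hδ hmax φ) ?_
  -- The variation in the direction −φ turns the inequality into an equality.
  have h := S.integral_comp_grad_le hψc hδ hmax (-φ)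
  simp only [BoundedContinuousFunction.coe_neg, Pi.neg_apply, integral_neg] at h
  linarith

end Setting

/-! ### Sequences of monotone functions -/

/-- Helly's selection theorem. -/
theorem exists_subseq_tendsto_of_monotone {T : ℝ} {fn : ℕ → ℝ → ℝ} (hmono : ∀ n, Monotone (fn n))
    (hT : ∀ n x, fn n x ∈ Icc 0 T) :
    ∃ f : ℝ → ℝ, Monotone f ∧ ∃ φ : ℕ → ℕ, StrictMono φ ∧
      ∀ᵐ x, Tendsto (fun n => fn (φ n) x) atTop (𝓝 (f x)) := by
  have hcomp : IsCompact (univ.pi fun _ : ℚ => Icc (0 : ℝ) T) :=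
    isCompact_univ_pi fun _ => isCompact_Icc
  obtain ⟨g, hg, φ, hφ, hlim⟩ := hcomp.tendsto_subseq (x := fun n (q : ℚ) => fn n q)
    fun n q _ => hT n q
  rw [tendsto_pi_nhds] at hlim
  have hgT : ∀ q, g q ∈ Icc 0 T := fun q => hg q (mem_univ q)
  have hgm : ∀ q q' : ℚ, q ≤ q' → g q ≤ g q' := fun q q' h =>
    le_of_tendsto_of_tendsto' (hlim q) (hlim q') fun n => hmono _ (Rat.cast_le.2 h)
  -- The supremum of the limits at rationals to the left. At a continuity point of f, rationals on
  -- both sides squeeze the sequence.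
  let f : ℝ → ℝ := fun x => sSup (g '' {q | (q : ℝ) < x})
  have hbdd : ∀ x : ℝ, BddAbove (g '' {q | (q : ℝ) < x}) := fun x => by
    refine ⟨T, ?_⟩
    rintro _ ⟨q, -, rfl⟩
    exact (hgT q).2
  have hnon : ∀ x : ℝ, (g '' {q | (q : ℝ) < x}).Nonempty := fun x => by
    obtain ⟨q, hq⟩ := exists_rat_lt x
    exact ⟨_, q, hq, rfl⟩
  have hfm : Monotone f := fun x y hxy =>
    csSup_le_csSup (hbdd y) (hnon x) (image_mono fun q hq => lt_of_lt_of_le hq hxy)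
  refine ⟨f, hfm, φ, hφ, ?_⟩
  filter_upwards [hfm.countable_not_continuousAt.ae_notMem volume] with x hx
  have hc : ContinuousAt f x := by
    by_contra h
    exact hx h
  rw [tendsto_order]
  constructor
  · intro a ha
    obtain ⟨l, hl, hsub⟩ := exists_Ioc_subset_of_mem_nhds (hc.eventually (lt_mem_nhds ha))
      (exists_lt x)
    obtain ⟨x₁, h1, h2⟩ := exists_between hl
    obtain ⟨q, hq1, hq2⟩ := exists_rat_btwn h2
    have h3 : a < f x₁ := hsub ⟨h1, h2.le⟩
    have h4 : f x₁ ≤ g q := csSup_le (hnon _) (by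
      rintro _ ⟨q', hq', rfl⟩
      exact hgm q' q (Rat.cast_le.1 (hq'.trans hq1).le))
    filter_upwards [(hlim q).eventually (lt_mem_nhds (h3.trans_le h4))] with n hn
    exact lt_of_lt_of_le hn (hmono _ hq2.le)
  · intro a ha
    obtain ⟨u, hu, hsub⟩ := exists_Ico_subset_of_mem_nhds (hc.eventually (gt_mem_nhds ha))
      (exists_gt x)
    obtain ⟨x₁, h1, h2⟩ := exists_between hu
    obtain ⟨q, hq1, hq2⟩ := exists_rat_btwn h1
    have h3 : f x₁ < a := hsub ⟨h1.le, h2⟩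
    have h4 : g q ≤ f x₁ := le_csSup (hbdd _) ⟨q, hq2, rfl⟩
    filter_upwards [(hlim q).eventually (gt_mem_nhds (h4.trans_lt h3))] with n hn
    exact lt_of_le_of_lt (hmono _ hq1.le) hn

theorem frequently_nhdsGT_of_ae {p : ℝ → Prop} (hp : ∀ᵐ x, p x) (z : ℝ) : ∃ᶠ x in 𝓝[>] z, p x := by
  intro h
  obtain ⟨u, hu, hsub⟩ := mem_nhdsGT_iff_exists_Ioo_subset.1 h
  have h0 : volume (Ioo z u) = 0 := measure_mono_null hsub hp
  rw [Real.volume_Ioo, ENNReal.ofReal_eq_zero] at h0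
  linarith [mem_Ioi.1 hu]

theorem frequently_nhdsLT_of_ae {p : ℝ → Prop} (hp : ∀ᵐ x, p x) (z : ℝ) : ∃ᶠ x in 𝓝[<] z, p x := by
  intro h
  obtain ⟨u, hu, hsub⟩ := mem_nhdsLT_iff_exists_Ioo_subset.1 h
  have h0 : volume (Ioo u z) = 0 := measure_mono_null hsub hp
  rw [Real.volume_Ioo, ENNReal.ofReal_eq_zero] at h0
  linarith [mem_Iio.1 hu]

/-- Every value of `ρ` on `[0, H]` is a limit of values at points of any given set of full
measure. -/
def Approachable (H : ℝ) (ρ : ℝ → ℝ) : Prop :=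
  ∀ p : ℝ → Prop, (∀ᵐ z ∂volume.restrict (Icc 0 H), p z) → ∀ z ∈ Icc 0 H,
    ∃ zn : ℕ → ℝ, (∀ n, zn n ∈ Icc 0 H ∧ p (zn n)) ∧ Tendsto zn atTop (𝓝 z) ∧
      Tendsto (fun n => ρ (zn n)) atTop (𝓝 (ρ z))

/-- A monotone function agrees almost everywhere on `[0, H]` with an approachable one. -/
theorem exists_approachable {H : ℝ} (hH : 0 < H) {f : ℝ → ℝ} (hf : Monotone f) :
    ∃ ρ : ℝ → ℝ, MonotoneOn ρ (Icc 0 H) ∧ Approachable H ρ ∧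
      ∀ᵐ z ∂volume.restrict (Icc 0 H), ρ z = f z := by
  classical
  -- One-sided limits are values approached along any set of full measure. At H only the left side
  -- lies in [0, H].
  let ρ : ℝ → ℝ := fun z => if z < H then Function.rightLim f z else Function.leftLim f H
  have hlt : ∀ z < H, ρ z = Function.rightLim f z := fun z hz => if_pos hz
  have hHH : ρ H = Function.leftLim f H := if_neg (lt_irrefl H)
  have hae : ∀ᵐ z : ℝ, z < H → ρ z = f z := by
    filter_upwards [hf.countable_not_continuousAt.ae_notMem volume] with z hz hzH
    have hc : ContinuousAt f z := by
      by_contra h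
      exact hz h
    rw [hlt z hzH]
    exact tendsto_nhds_unique (hf.tendsto_rightLim z) (hc.tendsto.mono_left nhdsWithin_le_nhds)
  refine ⟨ρ, ?_, ?_, ?_⟩
  · intro x _ y hy hxy
    rcases hy.2.lt_or_eq with h | h
    · rw [hlt x (hxy.trans_lt h), hlt y h]
      exact hf.rightLim hxy
    · subst h
      rcases hxy.lt_or_eq with h' | h'
      · rw [hlt x h', hHH]
        exact hf.rightLim_le_leftLim h'
      · rw [h']
  · intro p hp z hz
    have hp' := (ae_restrict_iff' measurableSet_Icc).1 hp
    rcases hz.2.lt_or_eq with h | h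
    · have hev : ∀ᶠ x in 𝓝[>] z, x ∈ Ioo z H := Ioo_mem_nhdsGT h
      obtain ⟨zn, hzn, hpz⟩ := exists_seq_forall_of_frequently
        (((frequently_nhdsGT_of_ae (hp'.and hae) z)).and_eventually hev)
      refine ⟨zn, fun n => ?_, hzn.mono_right nhdsWithin_le_nhds, ?_⟩
      · have hm : zn n ∈ Icc 0 H := ⟨hz.1.trans (hpz n).2.1.le, (hpz n).2.2.le⟩
        exact ⟨hm, (hpz n).1.1 hm⟩
      · rw [hlt z h]
        refine ((hf.tendsto_rightLim z).comp hzn).congr fun n => ?_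
        exact ((hpz n).1.2 (hpz n).2.2).symm
    · subst h
      have hev : ∀ᶠ x in 𝓝[<] z, x ∈ Ioo 0 z := Ioo_mem_nhdsLT hH
      obtain ⟨zn, hzn, hpz⟩ := exists_seq_forall_of_frequently
        (((frequently_nhdsLT_of_ae (hp'.and hae) z)).and_eventually hev)
      refine ⟨zn, fun n => ?_, hzn.mono_right nhdsWithin_le_nhds, ?_⟩
      · have hm : zn n ∈ Icc 0 z := ⟨(hpz n).2.1.le, (hpz n).2.2.le⟩
        exact ⟨hm, (hpz n).1.1 hm⟩
      · rw [hHH]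
        refine ((hf.tendsto_leftLim z).comp hzn).congr fun n => ?_
        exact ((hpz n).1.2 (hpz n).2.2).symm
  · filter_upwards [ae_restrict_of_ae hae, ae_restrict_mem measurableSet_Icc,
      ae_restrict_of_ae (Measure.ae_ne volume H)] with z h1 h2 h3
    exact h1 (lt_of_le_of_ne h2.2 h3)

/-- Closed conditions pass from almost every z to every z; this is the purpose of choosing an
approachable representative. -/
theorem Approachable.of_isClosed {H : ℝ} {ρ : ℝ → ℝ} (hρ : Approachable H ρ) {K : Set ℝ}
    (hK : IsClosed K) (h : ∀ᵐ z ∂volume.restrict (Icc 0 H), ρ z ∈ K) : ∀ z ∈ Icc 0 H, ρ z ∈ K := by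
  intro z hz
  obtain ⟨zn, hzn, -, hlim⟩ := hρ _ h z hz
  exact hK.mem_of_tendsto hlim (Eventually.of_forall fun n => (hzn n).2)

/-- Minimality almost everywhere is minimality everywhere, for approachable height functions. -/
theorem Approachable.isMinOn {r₀ H Ω B : ℝ} {ρ : ℝ → ℝ} {Q : ℝ × ℝ → ℝ} (hρ : Approachable H ρ)
    (hr : 0 < r₀) (hΩ : 0 < Ω) (hQ : Regular r₀ H B Q) (hmem : ∀ z ∈ Icc 0 H, ρ z ∈ heights r₀)
    (hmin : MinimizesAE r₀ H Ω Q ρ) :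
    ∀ z ∈ Icc 0 H, IsMinOn (fun t => boundaryEnergy r₀ Ω Q t z) (heights r₀) (ρ z) := by
  intro z hz
  obtain ⟨zn, hzn, hlim, hρlim⟩ := hρ _ hmin z hz
  refine isMinOn_boundaryEnergy_of_tendsto hr (cutoff_mem_heights hr hΩ B) (Qn := fun _ => Q)
    (fun _ => hQ)
    (fun n => ⟨(hmem _ (hzn n).1).1,
      le_cutoff_of_isMinOn hr hΩ hQ (hzn n).1 (hmem _ (hzn n).1) (hzn n).2⟩)
    hρlim (fun n => (hzn n).1) (fun s hs => ?_) fun n => (hzn n).2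
  have hw : Tendsto (fun n => (s, zn n)) atTop (𝓝[dom r₀ H] (s, z)) :=
    tendsto_nhdsWithin_iff.2 ⟨tendsto_const_nhds.prodMk_nhds hlim,
      Eventually.of_forall fun n => ⟨hs, (hzn n).1⟩⟩
  exact (hQ.cont (s, z) ⟨hs, hz⟩).tendsto.comp hw

theorem pressure_zero (Δ : Set (ℝ × ℝ)) (ψ : ℝ × ℝ → ℝ) : pressure Δ 0 ψ = leg Δ ψ := by
  ext p; simp [pressure]

theorem fluid_congr_ae {r₀ H : ℝ} {ρ ρ' : ℝ → ℝ} (h : ρ =ᵐ[volume.restrict (Icc 0 H)] ρ') :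
    fluid r₀ H ρ = fluid r₀ H ρ' := by
  unfold fluid
  congr 1
  refine Measure.restrict_congr_set ?_
  have h1 : ∀ᵐ p : ℝ × ℝ, p.2 ∈ Icc 0 H → ρ p.2 = ρ' p.2 :=
    Measure.quasiMeasurePreserving_snd.ae ((ae_restrict_iff' measurableSet_Icc).1 h)
  filter_upwards [h1] with p hp
  refine propext ⟨fun h => ⟨h.1, h.2.1, hp h.1 ▸ h.2.2⟩, fun h => ⟨h.1, h.2.1, ?_⟩⟩
  rw [hp h.1]
  exact h.2.2

/-! ### Passage to the limit δ → 0 -/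

namespace Setting

variable {r₀ H Ω R₀ : ℝ} {Δ : Set (ℝ × ℝ)} {σ : Measure (ℝ × ℝ)}
  (S : Setting r₀ H Ω R₀ Δ σ)

include S

/-- Existence of a pressure and of a free boundary in equilibrium. -/
theorem exists_solution : ∃ (ψ : ℝ × ℝ → ℝ) (ρ : ℝ → ℝ), ContinuousOn ψ Δ ∧
    MonotoneOn ρ (Icc 0 H) ∧ (∀ z ∈ Icc 0 H, ρ z ∈ heights r₀) ∧ Approachable H ρ ∧
    MinimizesAE r₀ H Ω (leg Δ ψ) ρ ∧ (fluid r₀ H ρ).map (grad (leg Δ ψ)) = σ := by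
  have hr := S.r₀_pos
  have hH := S.H_pos
  have hΩ := S.Ω_pos
  have hprob := S.prob
  obtain ⟨C, hC⟩ := S.exists_perturbed_solution
  let δ : ℕ → ℝ := fun n => 1 / ((n : ℝ) + 1)
  have hδ : ∀ n, δ n ∈ Ioc (0 : ℝ) 1 := fun n => by
    refine ⟨by positivity, ?_⟩
    rw [div_le_one (by positivity)]
    linarith [(Nat.cast_nonneg n : (0 : ℝ) ≤ n)]
  have hδ' : ∀ n, δ n ∈ Icc (0 : ℝ) 1 := fun n => ⟨(hδ n).1.le, (hδ n).2⟩
  choose ψn hψn hψnC hmap using fun n => hC (δ n) (hδ n)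
  obtain ⟨ψ, hψ, φ₁, hφ₁, hlim₁⟩ :=
    exists_subseq_tendstoUniformlyOn_of_lipschitzWith S.isCompact hψn hψnC
  have hψc := hψ.continuous.continuousOn (s := Δ)
  have hψnc := fun n => (hψn n).continuous.continuousOn (s := Δ)
  have hψC : ∀ q ∈ Δ, |ψ q| ≤ C := fun q hq =>
    le_of_tendsto (hlim₁.tendsto_at hq).abs (Eventually.of_forall fun n => hψnC _ q hq)
  set B := pressureBound r₀ H R₀ C
  set T := cutoff r₀ Ω B
  have hT : T ∈ heights r₀ := cutoff_mem_heights hr hΩ B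
  let Q : ℕ → ℝ × ℝ → ℝ := fun n => pressure Δ (δ n) (ψn n)
  have hQ : ∀ n, Regular r₀ H B (Q n) := fun n => S.regular_pressure (hψnc n) (hψnC n) (hδ' n)
  -- Clamping to [0, H] makes the heights monotone on the whole line, as Helly's theorem is stated.
  let cl : ℝ → ℝ := fun z => max 0 (min H z)
  have hcl : ∀ z, cl z ∈ Icc 0 H := fun z => ⟨le_max_left _ _, max_le hH.le (min_le_left _ _)⟩
  have hclm : Monotone cl := fun x y h => max_le_max le_rfl (min_le_min le_rfl h)
  have hcle : ∀ z ∈ Icc 0 H, cl z = z := fun z hz => by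
    simp only [cl]
    rw [min_eq_right hz.2, max_eq_right hz.1]
  obtain ⟨f, hf, φ₂, hφ₂, hlim₂⟩ := exists_subseq_tendsto_of_monotone (T := T)
    (fn := fun n z => topHeight r₀ Ω (Q (φ₁ n)) (cl z))
    (fun n x y h => monotoneOn_topHeight hr hΩ (hQ _) (hcl x) (hcl y) (hclm h))
    (fun n z => ⟨(topHeight_mem hr hΩ (hQ _) (hcl z)).1.1,
      topHeight_le_cutoff hr hΩ (hQ _) _ (hcl z)⟩)
  obtain ⟨ρ, hρm, hρa, hρf⟩ := exists_approachable hH hf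
  let ν : ℕ → ℕ := fun n => φ₁ (φ₂ n)
  have hν : Tendsto ν atTop atTop := hφ₁.tendsto_atTop.comp hφ₂.tendsto_atTop
  have hlimψ : TendstoUniformlyOn (fun n => ψn (ν n)) ψ atTop Δ := fun u hu =>
    hφ₂.tendsto_atTop.eventually (hlim₁ u hu)
  have hlimρ : ∀ᵐ z ∂volume.restrict (Icc 0 H),
      Tendsto (fun n => topHeight r₀ Ω (Q (ν n)) z) atTop (𝓝 (ρ z)) := by
    filter_upwards [hρf, ae_restrict_of_ae hlim₂, ae_restrict_mem measurableSet_Icc] with z h1 h2 h3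
    rw [hcle z h3] at h2
    rwa [h1]
  have hnT : ∀ n, ∀ z ∈ Icc 0 H, topHeight r₀ Ω (Q n) z ∈ Icc 0 T := fun n z hz =>
    ⟨(topHeight_mem hr hΩ (hQ _) hz).1.1, topHeight_le_cutoff hr hΩ (hQ _) _ hz⟩
  have hρT : ∀ z ∈ Icc 0 H, ρ z ∈ Icc 0 T := by
    refine hρa.of_isClosed isClosed_Icc ?_
    filter_upwards [hlimρ, ae_restrict_mem measurableSet_Icc] with z h1 h2
    exact isClosed_Icc.mem_of_tendsto h1 (Eventually.of_forall fun n => hnT _ z h2)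
  have hρmem : ∀ z ∈ Icc 0 H, ρ z ∈ heights r₀ := fun z hz =>
    mem_heights_of_le hT (hρT z hz).1 (hρT z hz).2
  have hδlim : Tendsto (fun n => δ (ν n)) atTop (𝓝 0) :=
    (tendsto_one_div_add_atTop_nhds_zero_nat (𝕜 := ℝ)).comp hν
  have hmin : MinimizesAE r₀ H Ω (leg Δ ψ) ρ := by
    filter_upwards [hlimρ, ae_restrict_mem measurableSet_Icc] with z h1 h2
    refine isMinOn_boundaryEnergy_of_tendsto hr hT (Qn := fun n => Q (ν n)) (fun n => hQ _)
      (fun n => hnT _ z h2) h1 (fun _ => h2) (fun s _ => ?_)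
      (fun n => (topHeight_mem hr hΩ (hQ _) h2).2)
    have := (tendsto_leg S.isCompact S.nonempty hψc (fun n => hψnc (ν n)) hlimψ (s, z)).add
      (hδlim.mul_const z)
    simpa [Q, pressure] using this
  have hρ := isHeight_of_monotoneOn hρm hρmem
  refine ⟨ψ, ρ, hψc, hρm, hρmem, hρa, hmin, ?_⟩
  have hfin := isFiniteMeasure_fluid_of_le (ρ := ρ) hr hT fun z hz => (hρT z hz).2
  refine ext_of_forall_integral_eq_of_IsFiniteMeasure fun φ => ?_
  rw [integral_map (measurable_grad _).aemeasurable φ.continuous.aestronglyMeasurable]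
  -- Where all the transforms are differentiable, their gradients are the maximizers and therefore
  -- converge, so the push-forward identity survives the limit.
  have hdn : ∀ᵐ p : ℝ × ℝ, ∀ n, DifferentiableAt ℝ (leg Δ (ψn n)) p :=
    ae_all_iff.2 fun n => S.ae_differentiableAt_leg (hψnc n)
  have hconv := tendsto_integral_fluid (ρn := fun n => topHeight r₀ Ω (Q (ν n))) hr hT
    (fun n => isHeight_topHeight hr hΩ (hQ _))
    (fun n z hz => (hnT _ z hz).2) hρ (fun z hz => (hρT z hz).2) hlimρ
    (gn := fun n p => φ (grad (leg Δ (ψn (ν n))) p)) (g := fun p => φ (grad (leg Δ ψ) p))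
    (C := ‖φ‖)
    (fun n => (φ.continuous.measurable.comp (measurable_grad _)).aestronglyMeasurable)
    (fun n => Eventually.of_forall fun p => φ.norm_coe_le_norm _) (ae_restrict_of_ae (by
      filter_upwards [hdn, S.ae_differentiableAt_leg hψc] with p h1 h2
      refine (φ.continuous.tendsto _).comp ?_
      refine tendsto_argmax S.isCompact S.nonempty hψc (fun n => hψnc _) hlimψ h2
        (fun n => (grad_leg_mem S.isCompact S.nonempty (hψnc _) (h1 _)).1)
        fun n => (grad_leg_mem S.isCompact S.nonempty (hψnc _) (h1 _)).2))
  refine tendsto_nhds_unique hconv (tendsto_const_nhds.congr fun n => ?_)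
  rw [← hmap (ν n), integral_map (measurable_grad _).aemeasurable
    φ.continuous.aestronglyMeasurable]

end Setting

/-! ### Preliminaries on transport plans and the cost -/

theorem Regular.congr {r₀ H B : ℝ} {Q Q' : ℝ × ℝ → ℝ} (hQ : Regular r₀ H B Q)
    (h : EqOn Q' Q (dom r₀ H)) : Regular r₀ H B Q' where
  cont := hQ.cont.congr h
  abs_le p hp := by rw [h hp]; exact hQ.abs_le p hp
  mono s hs z hz z' hz' hzz := by
    have h1 : Q' (s, z) = Q (s, z) := h ⟨hs, hz⟩
    have h2 : Q' (s, z') = Q (s, z') := h ⟨hs, hz'⟩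
    simp only [h1, h2]
    exact hQ.mono s hs hz hz' hzz

theorem closure_dom {r₀ H : ℝ} (hr : 0 < r₀) :
    closure (dom r₀ H) = Icc 0 (1 / (2 * r₀ ^ 2)) ×ˢ Icc 0 H := by
  have : (0 : ℝ) < 1 / (2 * r₀ ^ 2) := by positivity
  rw [dom, heights, closure_prod_eq, closure_Ico this.ne, closure_Icc]

theorem interior_mem_nhds {r₀ H : ℝ} {p : ℝ × ℝ}
    (hp : p ∈ Ioo 0 (1 / (2 * r₀ ^ 2)) ×ˢ Ioo 0 H) : dom r₀ H ∈ 𝓝 p :=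
  mem_of_superset ((isOpen_Ioo.prod isOpen_Ioo).mem_nhds hp)
    (prod_mono Ioo_subset_Ico_self Ioo_subset_Icc_self)

theorem quadrant_mem_nhds {q : ℝ × ℝ} (h1 : 0 < q.1) (h2 : 0 < q.2) : quadrant ∈ 𝓝 q :=
  prod_mem_nhds (Ici_mem_nhds h1) (Ici_mem_nhds h2)

theorem isFiniteMeasure_of_isPlan {μ ν : Measure (ℝ × ℝ)} {γ : Measure ((ℝ × ℝ) × (ℝ × ℝ))}
    [IsFiniteMeasure ν] (h : IsPlan μ ν γ) : IsFiniteMeasure γ := by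
  constructor
  have h1 : γ.map Prod.snd univ = ν univ := by rw [h.2]
  rw [Measure.map_apply measurable_snd MeasurableSet.univ, preimage_univ] at h1
  rw [h1]
  exact measure_lt_top _ _

theorem IsPlan.ae_fst {μ ν : Measure (ℝ × ℝ)} {γ : Measure ((ℝ × ℝ) × (ℝ × ℝ))}
    (hγ : IsPlan μ ν γ) {p : ℝ × ℝ → Prop} (h : ∀ᵐ x ∂μ, p x) : ∀ᵐ x ∂γ, p x.1 := by
  rw [← hγ.1] at h
  exact ae_of_ae_map measurable_fst.aemeasurable h

theorem IsPlan.ae_snd {μ ν : Measure (ℝ × ℝ)} {γ : Measure ((ℝ × ℝ) × (ℝ × ℝ))}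
    (hγ : IsPlan μ ν γ) {p : ℝ × ℝ → Prop} (h : ∀ᵐ x ∂ν, p x) : ∀ᵐ x ∂γ, p x.2 := by
  rw [← hγ.2] at h
  exact ae_of_ae_map measurable_snd.aemeasurable h

/-- A measure concentrated on a graph is determined by its first marginal. -/
theorem map_graph_eq_iff {μ : Measure (ℝ × ℝ)} {γ : Measure ((ℝ × ℝ) × (ℝ × ℝ))}
    (hγ : γ.map Prod.fst = μ) {T : ℝ × ℝ → ℝ × ℝ} (hT : Measurable T) :
    μ.map (fun p => (p, T p)) = γ ↔ ∀ᵐ x ∂γ, T x.1 = x.2 := by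
  have hm : Measurable fun p : ℝ × ℝ => (p, T p) := measurable_id.prodMk hT
  constructor
  · intro h
    rw [← h, ae_map_iff hm.aemeasurable]
    · exact Eventually.of_forall fun _ => rfl
    · exact measurableSet_eq_fun (hT.comp measurable_fst) measurable_snd
  · intro h
    rw [← hγ, Measure.map_map hm measurable_fst]
    conv_rhs => rw [← Measure.map_id (μ := γ)]
    exact Measure.map_congr (h.mono fun x hx => Prod.ext rfl hx)

theorem map_graph_snd_eq_iff {μ : Measure (ℝ × ℝ)} {γ : Measure ((ℝ × ℝ) × (ℝ × ℝ))}
    (hγ : γ.map Prod.snd = μ) {T : ℝ × ℝ → ℝ × ℝ} (hT : Measurable T) :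
    μ.map (fun q => (T q, q)) = γ ↔ ∀ᵐ x ∂γ, T x.2 = x.1 := by
  have hm : Measurable fun q : ℝ × ℝ => (T q, q) := hT.prodMk measurable_id
  constructor
  · intro h
    rw [← h, ae_map_iff hm.aemeasurable]
    · exact Eventually.of_forall fun _ => rfl
    · exact measurableSet_eq_fun (hT.comp measurable_snd) measurable_fst
  · intro h
    rw [← hγ, Measure.map_map hm measurable_snd]
    conv_rhs => rw [← Measure.map_id (μ := γ)]
    exact Measure.map_congr (h.mono fun x hx => Prod.ext hx rfl)

/-- The part of the cost that depends only on `q`. -/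
noncomputable def momentumCost (r₀ Ω : ℝ) (q : ℝ × ℝ) : ℝ := q.1 / (2 * r₀ ^ 2) - Ω * √q.1

theorem continuous_momentumCost (r₀ Ω : ℝ) : Continuous (momentumCost r₀ Ω) := by
  unfold momentumCost; fun_prop

/-- The integrand of the primal functional. -/
noncomputable def cost (r₀ Ω : ℝ) (x : (ℝ × ℝ) × (ℝ × ℝ)) : ℝ :=
  momentumCost r₀ Ω x.2 + centrifugal r₀ Ω x.1.1 - dot x.1 x.2

theorem primal_eq (r₀ H Ω : ℝ) (Δ : Set (ℝ × ℝ)) (ρ : ℝ → ℝ)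
    (γ : Measure ((ℝ × ℝ) × (ℝ × ℝ))) :
    primal r₀ H Ω Δ ρ γ = extInt (γ.restrict (region H ρ ×ˢ Δ)) (cost r₀ Ω) := by
  unfold primal
  congr 1; ext x
  unfold cost momentumCost centrifugal
  have : 1 - 2 * x.1.1 * r₀ ^ 2 = 1 - 2 * r₀ ^ 2 * x.1.1 := by ring
  rw [this]
  ring

theorem measurable_dot : Measurable fun x : (ℝ × ℝ) × (ℝ × ℝ) => dot x.1 x.2 := by
  unfold dot; fun_prop

theorem measurable_cost (r₀ Ω : ℝ) : Measurable (cost r₀ Ω) :=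
  (((continuous_momentumCost r₀ Ω).measurable.comp measurable_snd).add
    ((measurable_centrifugal r₀ Ω).comp (measurable_fst.comp measurable_fst))).sub measurable_dot

/-- The contact set of a pair, up to `γ`-null sets. -/
def TightAE (γ : Measure ((ℝ × ℝ) × (ℝ × ℝ))) (P Ψ : ℝ × ℝ → ℝ) : Prop :=
  ∀ᵐ x ∂γ, P x.1 + Ψ x.2 = dot x.1 x.2

namespace Setting

variable {r₀ H Ω R₀ : ℝ} {Δ : Set (ℝ × ℝ)} {σ : Measure (ℝ × ℝ)} {P Ψ : ℝ × ℝ → ℝ}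
  {ρ : ℝ → ℝ} {γ : Measure ((ℝ × ℝ) × (ℝ × ℝ))}
  (S : Setting r₀ H Ω R₀ Δ σ)

include S

theorem subset_quadrant : Δ ⊆ quadrant := S.subset.trans (box_subset_quadrant R₀)

/-! ### Properties of Legendre pairs -/

theorem continuousOn_snd_of_mem (hf : (P, Ψ) ∈ dualPairs r₀ H) : ContinuousOn Ψ Δ :=
  hf.2.1.mono S.subset_quadrant

/-- P is prescribed only on 𝒟; this replaces it by a function that is Lipschitz on the whole plane.
-/
theorem eqOn_leg (hf : (P, Ψ) ∈ legendrePairs r₀ H Δ) : EqOn P (leg Δ Ψ) (dom r₀ H) :=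
  fun p hp => (hf.2.1 p hp).unique
    (isLUB_leg S.isCompact S.nonempty (S.continuousOn_snd_of_mem hf.1) p)

theorem exists_regular (hf : (P, Ψ) ∈ legendrePairs r₀ H Δ) : ∃ B, Regular r₀ H B P := by
  obtain ⟨B, hB⟩ := S.exists_regular_pressure (S.continuousOn_snd_of_mem hf.1)
    (δ := 0) ⟨le_rfl, zero_le_one⟩
  rw [pressure_zero] at hB
  exact ⟨B, hB.congr (S.eqOn_leg hf)⟩

theorem eqOn_dleg (hf : (P, Ψ) ∈ legendrePairs r₀ H Δ) : EqOn Ψ (dleg r₀ H P) quadrant := by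
  obtain ⟨B, hB⟩ := S.exists_regular hf
  exact fun q hq => (hf.2.2 q hq).unique (isLUB_dleg S.r₀_pos S.H_pos hB.abs_le q)

theorem grad_eq_grad_leg (hf : (P, Ψ) ∈ legendrePairs r₀ H Δ) {p : ℝ × ℝ}
    (hp : p ∈ Ioo 0 (1 / (2 * r₀ ^ 2)) ×ˢ Ioo 0 H) : grad P p = grad (leg Δ Ψ) p :=
  grad_congr (eventually_of_mem (interior_mem_nhds hp) fun _ h => S.eqOn_leg hf h)

theorem tight_iff_grad_eq (hf : (P, Ψ) ∈ legendrePairs r₀ H Δ) {p q : ℝ × ℝ}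
    (hp : p ∈ Ioo 0 (1 / (2 * r₀ ^ 2)) ×ˢ Ioo 0 H) (hd : DifferentiableAt ℝ (leg Δ Ψ) p)
    (hq : q ∈ Δ) : P p + Ψ q = dot p q ↔ grad P p = q := by
  have hc := S.continuousOn_snd_of_mem hf.1
  rw [S.grad_eq_grad_leg hf hp, S.eqOn_leg hf (mem_of_mem_nhds (interior_mem_nhds hp))]
  constructor
  · intro h
    exact grad_leg_eq S.isCompact hc hq hd (by linarith)
  · rintro rfl
    linarith [(grad_leg_mem S.isCompact S.nonempty hc hd).2]

/-- The domain is not closed at s = 1/(2 r₀²), so the supremum defining Ψ need only be attained on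
the closure. The continuity of P up to there is what makes this work. -/
theorem exists_contact (hf : (P, Ψ) ∈ legendrePairs r₀ H Δ) {q : ℝ × ℝ} (hq : q ∈ quadrant) :
    ∃ p ∈ closure (dom r₀ H), P p + Ψ q = dot p q ∧
      ∀ q' ∈ quadrant, dot p q' ≤ P p + Ψ q' := by
  have hcl := closure_dom (H := H) S.r₀_pos
  have hcomp : IsCompact (closure (dom r₀ H)) := by
    rw [hcl]; exact isCompact_Icc.prod isCompact_Icc
  have hne : (closure (dom r₀ H)).Nonempty :=
    ⟨_, subset_closure (zero_mem_dom S.r₀_pos S.H_pos)⟩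
  have hc : ∀ q', ContinuousOn (fun p => dot p q' - P p) (closure (dom r₀ H)) := fun q' =>
    (continuous_dot_left q').continuousOn.sub hf.1.1
  obtain ⟨p, hp, hmax⟩ := hcomp.exists_isMaxOn hne (hc q)
  have hle : ∀ q' ∈ quadrant, dot p q' - P p ≤ Ψ q' := fun q' hq' =>
    le_on_closure (f := fun p => dot p q' - P p) (g := fun _ => Ψ q')
      (fun p' hp' => by linarith [hf.1.2.2 p' hp' q' hq']) (hc q') continuousOn_const hp
  refine ⟨p, hp, ?_, fun q' hq' => by linarith [hle q' hq']⟩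
  have h1 : Ψ q ≤ dot p q - P p := (hf.2.2 q hq).2 (by
    rintro _ ⟨p', hp', rfl⟩
    exact hmax (subset_closure hp'))
  linarith [hle q hq]

theorem tight_iff_grad_snd_eq (hf : (P, Ψ) ∈ legendrePairs r₀ H Δ) {p q : ℝ × ℝ}
    (hp : p ∈ dom r₀ H) (hq : quadrant ∈ 𝓝 q) (hd : DifferentiableAt ℝ Ψ q) :
    P p + Ψ q = dot p q ↔ grad Ψ q = p := by
  have hcomm : ∀ a b : ℝ × ℝ, dot a b = dot b a := fun a b => by unfold dot; ring
  constructor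
  · intro h
    refine grad_eq_of_touching hd (eventually_of_mem hq fun q' hq' => ?_)
    rw [hcomm q', hcomm q]
    have := hf.1.2.2 p hp q' hq'
    simp only at this
    linarith
  · rintro rfl
    -- A contact point p' exists in the closure; differentiability forces it to be the gradient,
    -- that is, the given p.
    obtain ⟨p', -, he, hle⟩ := S.exists_contact hf (mem_of_mem_nhds hq)
    have : grad Ψ q = p' := by
      refine grad_eq_of_touching hd (eventually_of_mem hq fun q' hq' => ?_)
      rw [hcomm q', hcomm q]
      linarith [hle q' hq']
    rw [this]
    exact he

theorem ae_fluid_good (hf : (P, Ψ) ∈ legendrePairs r₀ H Δ) (hρ : IsHeight r₀ H ρ) :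
    ∀ᵐ p ∂fluid r₀ H ρ, p ∈ Ioo 0 (1 / (2 * r₀ ^ 2)) ×ˢ Ioo 0 H ∧
      DifferentiableAt ℝ (leg Δ Ψ) p := by
  filter_upwards [hρ.ae_fluid_mem_interior, (fluid_absolutelyContinuous_volume r₀ H ρ).ae_le
    (S.ae_differentiableAt_leg (S.continuousOn_snd_of_mem hf.1))] with p h1 h2
  exact ⟨h1, h2⟩

/-- Absolute continuity discards the axes and, by Rademacher's theorem, the points of
non-differentiability. -/
theorem ae_good_snd (hf : (P, Ψ) ∈ legendrePairs r₀ H Δ) (hac : σ ≪ volume) :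
    ∀ᵐ q ∂σ, quadrant ∈ 𝓝 q ∧ DifferentiableAt ℝ Ψ q := by
  obtain ⟨B, hB⟩ := S.exists_regular hf
  have h1 : ∀ᵐ p : ℝ × ℝ, p.1 ≠ 0 := Measure.quasiMeasurePreserving_fst.ae (Measure.ae_ne volume 0)
  have h2 : ∀ᵐ p : ℝ × ℝ, p.2 ≠ 0 := Measure.quasiMeasurePreserving_snd.ae (Measure.ae_ne volume 0)
  have h3 : ∀ᵐ q : ℝ × ℝ, DifferentiableAt ℝ (dleg r₀ H P) q :=
    (lipschitzWith_dleg S.r₀_pos S.H_pos hB.abs_le).ae_differentiableAt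
  filter_upwards [hac.ae_le h1, hac.ae_le h2, hac.ae_le h3, S.ae_mem] with q h1 h2 h3 hq
  have hq' := S.subset_quadrant hq
  have hn : quadrant ∈ 𝓝 q :=
    quadrant_mem_nhds (lt_of_le_of_ne hq'.1 h1.symm) (lt_of_le_of_ne hq'.2 h2.symm)
  exact ⟨hn, h3.congr_of_eventuallyEq (eventually_of_mem hn fun _ h => S.eqOn_dleg hf h)⟩

/-! ### Optimal plans -/

theorem tightAE_iff_map_grad (hf : (P, Ψ) ∈ legendrePairs r₀ H Δ) (hρ : IsHeight r₀ H ρ)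
    (hγ : IsPlan (fluid r₀ H ρ) σ γ) :
    TightAE γ P Ψ ↔ (fluid r₀ H ρ).map (fun p => (p, grad P p)) = γ := by
  have h1 : TightAE γ P Ψ ↔ ∀ᵐ x ∂γ, grad P x.1 = x.2 := by
    have hgood : ∀ᵐ x ∂γ, (P x.1 + Ψ x.2 = dot x.1 x.2 ↔ grad P x.1 = x.2) := by
      filter_upwards [hγ.ae_fst (S.ae_fluid_good hf hρ), hγ.ae_snd S.ae_mem]
        with x h1 h2
      exact S.tight_iff_grad_eq hf h1.1 h1.2 h2
    exact eventually_congr hgood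
  rw [h1, map_graph_eq_iff hγ.1 (measurable_grad P)]

theorem tightAE_iff_map_grad_snd (hf : (P, Ψ) ∈ legendrePairs r₀ H Δ) (hρ : IsHeight r₀ H ρ)
    (hγ : IsPlan (fluid r₀ H ρ) σ γ) (hac : σ ≪ volume) :
    TightAE γ P Ψ ↔ σ.map (fun q => (grad Ψ q, q)) = γ := by
  have h1 : TightAE γ P Ψ ↔ ∀ᵐ x ∂γ, grad Ψ x.2 = x.1 := by
    have hgood : ∀ᵐ x ∂γ, (P x.1 + Ψ x.2 = dot x.1 x.2 ↔ grad Ψ x.2 = x.1) := by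
      filter_upwards [hγ.ae_fst hρ.ae_fluid_mem,
        hγ.ae_snd (S.ae_good_snd hf hac)] with x h1 h2
      exact S.tight_iff_grad_snd_eq hf (hρ.region_subset_dom h1) h2.1 h2.2
    exact eventually_congr hgood
  rw [h1, map_graph_snd_eq_iff hγ.2 (measurable_grad Ψ)]

/-! ### Duality -/

theorem dual_eq (hf : (P, Ψ) ∈ legendrePairs r₀ H Δ) :
    dual r₀ H Ω σ (P, Ψ) = ((∫ q, (momentumCost r₀ Ω q - Ψ q) ∂σ +
      energy r₀ H Ω P (topHeight r₀ Ω P) : ℝ) : EReal) := by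
  obtain ⟨B, hB⟩ := S.exists_regular hf
  rw [dual, dualBoundary_eq_energy S.r₀_pos S.Ω_pos hB, EReal.coe_add]
  rfl

theorem restrict_plan (hρ : IsHeight r₀ H ρ) (hγ : IsPlan (fluid r₀ H ρ) σ γ) :
    γ.restrict (region H ρ ×ˢ Δ) = γ := by
  refine Measure.restrict_eq_self_of_ae_mem ?_
  filter_upwards [hγ.ae_fst hρ.ae_fluid_mem, hγ.ae_snd S.ae_mem] with x h1 h2
  exact ⟨h1, h2⟩

theorem integrable_dot (hρ : IsHeight r₀ H ρ) (hγ : IsPlan (fluid r₀ H ρ) σ γ) :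
    Integrable (fun x => dot x.1 x.2) γ := by
  have := S.prob
  have := isFiniteMeasure_of_isPlan hγ
  refine Integrable.of_bound measurable_dot.aestronglyMeasurable
    (R₀ * (1 / (2 * r₀ ^ 2) + H)) ?_
  filter_upwards [hγ.ae_fst hρ.ae_fluid_mem, hγ.ae_snd S.ae_mem] with x h1 h2
  have hd := hρ.region_subset_dom h1
  rw [Real.norm_eq_abs, abs_of_nonneg (dot_nonneg_of_mem hd (S.subset_quadrant h2))]
  exact dot_le_of_mem hd (S.subset h2)

theorem integrable_comp_snd (hγ : IsPlan (fluid r₀ H ρ) σ γ) {g : ℝ × ℝ → ℝ}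
    (hg : ContinuousOn g Δ) : Integrable (fun x => g x.2) γ := by
  have h := S.integrable hg
  rw [← hγ.2] at h
  exact h.comp_measurable measurable_snd

theorem integral_comp_snd (hγ : IsPlan (fluid r₀ H ρ) σ γ) {g : ℝ × ℝ → ℝ}
    (hg : ContinuousOn g Δ) : ∫ x, g x.2 ∂γ = ∫ q, g q ∂σ := by
  have h := S.integrable hg
  rw [← hγ.2] at h
  conv_rhs => rw [← hγ.2]
  exact (integral_map measurable_snd.aemeasurable h.aestronglyMeasurable).symm

/-- All other terms of the cost are bounded almost everywhere for γ. -/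
theorem integrable_centrifugal_of_primal_ne_top (hρ : IsHeight r₀ H ρ)
    (hγ : IsPlan (fluid r₀ H ρ) σ γ) (h : primal r₀ H Ω Δ ρ γ ≠ ⊤) :
    Integrable (fun p : ℝ × ℝ => centrifugal r₀ Ω p.1) (fluid r₀ H ρ) := by
  have := S.prob
  have := isFiniteMeasure_of_isPlan hγ
  rw [primal_eq, S.restrict_plan hρ hγ] at h
  have hmc := (continuous_momentumCost r₀ Ω).continuousOn (s := Δ)
  obtain ⟨C, hC⟩ := S.isCompact.exists_bound_of_continuousOn hmc
  have hi : Integrable (cost r₀ Ω) γ := by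
    refine integrable_of_extInt_ne_top (measurable_cost r₀ Ω).aestronglyMeasurable
      (C := C + R₀ * (1 / (2 * r₀ ^ 2) + H)) ?_ h
    filter_upwards [hγ.ae_fst hρ.ae_fluid_mem, hγ.ae_snd S.ae_mem] with x h1 h2
    have hd := hρ.region_subset_dom h1
    have h3 := (abs_le.1 (hC _ h2)).1
    have h4 := dot_le_of_mem hd (S.subset h2)
    have h5 := centrifugal_nonneg S.r₀_pos Ω hd.1
    unfold cost
    linarith
  have hi2 : Integrable (fun x : (ℝ × ℝ) × (ℝ × ℝ) => centrifugal r₀ Ω x.1.1) γ := by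
    refine ((hi.add (S.integrable_dot hρ hγ)).sub (S.integrable_comp_snd hγ hmc)).congr
      (Eventually.of_forall fun x => ?_)
    simp only [cost, Pi.add_apply, Pi.sub_apply]
    ring
  rw [← hγ.1]
  exact (integrable_map_measure
    ((measurable_centrifugal r₀ Ω).comp measurable_fst).aestronglyMeasurable
    measurable_fst.aemeasurable).2 hi2

/-- The primal functional as a sum of the dual one and of two nonnegative gaps. -/
theorem primal_eq_of_integrable (hf : (P, Ψ) ∈ legendrePairs r₀ H Δ) (hρ : IsHeight r₀ H ρ)
    (hγ : IsPlan (fluid r₀ H ρ) σ γ) [IsFiniteMeasure (fluid r₀ H ρ)]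
    (hc : Integrable (fun p : ℝ × ℝ => centrifugal r₀ Ω p.1) (fluid r₀ H ρ)) :
    ∃ gap : ℝ, 0 ≤ gap ∧ (gap = 0 ↔ TightAE γ P Ψ) ∧
      primal r₀ H Ω Δ ρ γ = ((gap + ∫ q, (momentumCost r₀ Ω q - Ψ q) ∂σ +
        energy r₀ H Ω P ρ : ℝ) : EReal) := by
  obtain ⟨B, hB⟩ := S.exists_regular hf
  have hΨ := S.continuousOn_snd_of_mem hf.1
  have hmc := (continuous_momentumCost r₀ Ω).continuousOn (s := Δ)
  have hP := hB.integrable_fluid hρ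
  have hPγ : Integrable (fun x => P x.1) γ := by
    have h := hP
    rw [← hγ.1] at h
    exact h.comp_measurable measurable_fst
  have hgap : Integrable (fun x => P x.1 + Ψ x.2 - dot x.1 x.2) γ :=
    (hPγ.add (S.integrable_comp_snd hγ hΨ)).sub (S.integrable_dot hρ hγ)
  have hcP := hc.sub hP
  have hcPγ : Integrable (fun x => centrifugal r₀ Ω x.1.1 - P x.1) γ := by
    have h := hcP
    rw [← hγ.1] at h
    exact h.comp_measurable measurable_fst
  have hmΨ : Integrable (fun x => momentumCost r₀ Ω x.2 - Ψ x.2) γ :=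
    S.integrable_comp_snd hγ (hmc.sub hΨ)
  have hnn : 0 ≤ᵐ[γ] fun x => P x.1 + Ψ x.2 - dot x.1 x.2 := by
    filter_upwards [hγ.ae_fst hρ.ae_fluid_mem, hγ.ae_snd S.ae_mem] with x h1 h2
    exact sub_nonneg.2 (hf.1.2.2 _ (hρ.region_subset_dom h1) _ (S.subset_quadrant h2))
  refine ⟨∫ x, (P x.1 + Ψ x.2 - dot x.1 x.2) ∂γ, integral_nonneg_of_ae hnn, ?_, ?_⟩
  · rw [integral_eq_zero_iff_of_nonneg_ae hnn hgap]
    exact eventually_congr (Eventually.of_forall fun x => by simp [sub_eq_zero])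
  · have hsum : cost r₀ Ω = fun x => (P x.1 + Ψ x.2 - dot x.1 x.2) +
        (momentumCost r₀ Ω x.2 - Ψ x.2) + (centrifugal r₀ Ω x.1.1 - P x.1) := by
      ext x; unfold cost; ring
    have e1 : ∫ x, (centrifugal r₀ Ω x.1.1 - P x.1) ∂γ = energy r₀ H Ω P ρ := by
      have h := hcP.aestronglyMeasurable
      rw [← hγ.1] at h
      rw [energy, ← hγ.1]
      exact (integral_map measurable_fst.aemeasurable h).symm
    have e2 := S.integral_comp_snd hγ (hmc.sub hΨ)
    simp only [Pi.sub_apply] at e2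
    rw [primal_eq, S.restrict_plan hρ hγ, hsum,
      extInt_eq_integral (f := fun x : (ℝ × ℝ) × (ℝ × ℝ) => (P x.1 + Ψ x.2 - dot x.1 x.2) +
        (momentumCost r₀ Ω x.2 - Ψ x.2) + (centrifugal r₀ Ω x.1.1 - P x.1)) ((hgap.add hmΨ).add hcPγ),
      integral_add (f := fun x => (P x.1 + Ψ x.2 - dot x.1 x.2) +
        (momentumCost r₀ Ω x.2 - Ψ x.2)) (hgap.add hmΨ) hcPγ, integral_add hgap hmΨ, e1, e2]

/-- Weak duality with the cases of equality. -/
theorem weak_duality (hf : (P, Ψ) ∈ legendrePairs r₀ H Δ) (hx : (ρ, γ) ∈ admissible r₀ H σ) :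
    dual r₀ H Ω σ (P, Ψ) ≤ primal r₀ H Ω Δ ρ γ ∧
      (primal r₀ H Ω Δ ρ γ = dual r₀ H Ω σ (P, Ψ) ↔
        TightAE γ P Ψ ∧ MinimizesAE r₀ H Ω P ρ) := by
  obtain ⟨hρ, hmass, hγ⟩ := hx
  simp only at hρ hmass hγ
  have hr := S.r₀_pos
  have hΩ := S.Ω_pos
  have := isProbabilityMeasure_fluid hmass
  obtain ⟨B, hB⟩ := S.exists_regular hf
  rw [S.dual_eq hf]
  by_cases hc : Integrable (fun p : ℝ × ℝ => centrifugal r₀ Ω p.1) (fluid r₀ H ρ)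
  · obtain ⟨gap, hgap, hgap0, he⟩ := S.primal_eq_of_integrable hf hρ hγ hc
    have hle := energy_topHeight_le hr hΩ hB hρ hc
    rw [he, EReal.coe_le_coe_iff, EReal.coe_eq_coe_iff, minimizesAE_iff_energy_eq hr hΩ hB hρ hc,
      ← hgap0]
    refine ⟨by linarith, fun h => ⟨by linarith, by linarith⟩, fun h => by rw [h.1, h.2, zero_add]⟩
  · have htop : primal r₀ H Ω Δ ρ γ = ⊤ := by
      by_contra h
      exact hc (S.integrable_centrifugal_of_primal_ne_top hρ hγ h)
    rw [htop]
    -- With infinite primal value neither side of the equivalence can hold: a slicewise minimizer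
    -- stays a.e. below the cutoff, where the centrifugal term is bounded.
    refine ⟨le_top, fun h => absurd h.symm (EReal.coe_ne_top _), fun h => absurd ?_ hc⟩
    exact integrable_centrifugal_of_ae_le hr hρ (cutoff_mem_heights hr hΩ B)
      (ae_fluid_le_cutoff_of_minimizesAE hr hΩ hB hρ h.2)

/-- Passing to the Legendre transforms increases the dual functional. -/
theorem dual_le_dual_leg (hf : (P, Ψ) ∈ dualPairs r₀ H) :
    dual r₀ H Ω σ (P, Ψ) ≤ dual r₀ H Ω σ (leg Δ Ψ, dleg r₀ H (leg Δ Ψ)) := by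
  have h := S
  obtain ⟨hr, hH, hΩ, hΔ, hne, hR, -, hae⟩ := h
  have hΨ := S.continuousOn_snd_of_mem hf
  have hmc := (continuous_momentumCost r₀ Ω).continuousOn (s := Δ)
  obtain ⟨B, hB⟩ := exists_bound_leg hΔ hne hR r₀ H hΨ
  have hd := (lipschitzWith_dleg hr hH hB).continuous.continuousOn (s := Δ)
  obtain ⟨B', hB'⟩ := S.exists_regular (leg_mem_legendrePairs hΔ hne hR hr hH hΨ)
  refine add_le_add (EReal.coe_le_coe_iff.2 ?_) ?_
  · refine integral_mono_ae (S.integrable (hmc.sub hΨ)) (S.integrable (hmc.sub hd)) ?_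
    filter_upwards [hae] with q hq
    exact sub_le_sub_left (dleg_leg_le hΔ hne hR hr hH hΨ hq) _
  -- P need not be monotone in z, so the lemmas on `Regular` pressures do not apply to it. Boundary
  -- energies are compared for each ρ, using that the transform of Ψ lies below P on 𝒟.
  · refine iInf₂_mono fun ρ hρ => extInt_mono ?_
    filter_upwards [ae_restrict_mem measurableSet_Icc] with z hz
    have hρz := hρ.2 z hz
    have h0 := zero_mem_heights hr
    rw [boundaryEnergy_eq, boundaryEnergy_eq]
    have hcP : ContinuousOn (fun s => (centrifugal r₀ Ω s - P (s, z)) * weight r₀ s)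
        (heights r₀) :=
      ((continuousOn_centrifugal hr Ω).sub (hf.1.comp (by fun_prop)
        fun s hs => subset_closure ⟨hs, hz⟩)).mul (continuousOn_weight hr)
    refine intervalIntegral.integral_mono_on hρz.1
      (hcP.mono (uIcc_subset_heights h0 hρz)).intervalIntegrable
      (intervalIntegrable_energy hr hB' hz h0 hρz) fun s hs => ?_
    refine mul_le_mul_of_nonneg_right (sub_le_sub_left ?_ _) (weight_nonneg _ _)
    obtain ⟨q, hq, e⟩ := exists_leg_eq hΔ hne hΨ (s, z)
    rw [e]
    have := hf.2.2 (s, z) ⟨mem_heights_of_le hρz hs.1 hs.2, hz⟩ q (S.subset_quadrant hq)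
    simp only at this
    linarith

end Setting

/-! ### Measure-theoretic tools for the uniqueness proofs -/

theorem IsHeight.ae_volume_of_ae_fluid {r₀ H : ℝ} {ρ : ℝ → ℝ} (hρ : IsHeight r₀ H ρ)
    (hr : 0 < r₀) {p : ℝ × ℝ → Prop} (h : ∀ᵐ x ∂fluid r₀ H ρ, p x) :
    ∀ᵐ x, x ∈ region H ρ → p x := by
  rw [fluid, ae_withDensity_iff (measurable_density r₀),
    ae_restrict_iff' hρ.measurableSet_region] at h
  filter_upwards [h] with x hx hxm
  exact hx hxm (ENNReal.ofReal_pos.2 (weight_pos hr (hρ.region_subset_dom hxm).1)).ne'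

theorem ae_ae_of_ae_volume {p : ℝ × ℝ → Prop} (h : ∀ᵐ x : ℝ × ℝ, p x) :
    ∀ᵐ z : ℝ, ∀ᵐ s : ℝ, p (s, z) := by
  rw [Measure.volume_eq_prod] at h
  exact Measure.ae_ae_of_ae_prod
    ((Measure.measurePreserving_swap (μ := (volume : Measure ℝ))
      (ν := (volume : Measure ℝ))).quasiMeasurePreserving.ae h)

/-- A set of reals of positive measure has a point with positive measure on its left. -/
theorem exists_mem_measure_inter_Iio_ne_zero {A : Set ℝ} (hb : BddAbove A) (hA : volume A ≠ 0) :
    ∃ x ∈ A, volume (A ∩ Iio x) ≠ 0 := by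
  by_contra! h
  have hne : A.Nonempty := nonempty_of_measure_ne_zero hA
  -- Apart from its supremum, the set is covered by its parts to the left of points uₙ of the set
  -- that tend to the supremum.
  obtain ⟨u, -, hu, huA⟩ := exists_seq_tendsto_sSup hne hb
  refine hA (measure_mono_null (t := (⋃ n, A ∩ Iio (u n)) ∪ {sSup A}) (fun x hx => ?_) ?_)
  · rcases (le_csSup hb hx).lt_or_eq with hlt | heq
    · obtain ⟨n, hn⟩ := (hu.eventually (lt_mem_nhds hlt)).exists
      exact Or.inl (mem_iUnion.2 ⟨n, hx, hn⟩)
    · exact Or.inr heq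
  · exact measure_union_null (measure_iUnion_null fun n => h _ (huA n)) (measure_singleton _)

/-- Constancy to the right of z suffices, since the two-sided derivative exists. -/
theorem grad_snd_eq_zero {f : ℝ × ℝ → ℝ} {s z z' : ℝ} (hd : DifferentiableAt ℝ f (s, z))
    (hz : z < z') (h : ∀ ζ ∈ Icc z z', f (s, ζ) = f (s, z)) : (grad f (s, z)).2 = 0 := by
  have hc : HasDerivAt (fun ζ : ℝ => (s, ζ)) ((0 : ℝ), (1 : ℝ)) z :=
    (hasDerivAt_const z s).prodMk (hasDerivAt_id z)
  have h1 : HasDerivWithinAt (fun ζ => f (s, ζ)) (fderiv ℝ f (s, z) (0, 1)) (Icc z z') z :=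
    (hd.hasFDerivAt.comp_hasDerivAt z hc).hasDerivWithinAt
  have h2 : HasDerivWithinAt (fun ζ => f (s, ζ)) 0 (Icc z z') z :=
    (hasDerivWithinAt_const z _ (f (s, z))).congr h rfl
  exact (uniqueDiffOn_Icc hz z ⟨le_rfl, hz.le⟩).eq_deriv _ h1 h2

theorem hasDerivAt_slice {f : ℝ × ℝ → ℝ} {s z : ℝ} (hd : DifferentiableAt ℝ f (s, z)) :
    HasDerivAt (fun σ => f (σ, z)) (grad f (s, z)).1 s :=
  hd.hasFDerivAt.comp_hasDerivAt s ((hasDerivAt_id s).prodMk (hasDerivAt_const s z))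

namespace Setting

variable {r₀ H Ω R₀ : ℝ} {Δ : Set (ℝ × ℝ)} {σ : Measure (ℝ × ℝ)} {P Ψ P' Ψ' : ℝ × ℝ → ℝ}
  {ρ ρ' : ℝ → ℝ} {γ : Measure ((ℝ × ℝ) × (ℝ × ℝ))}
  (S : Setting r₀ H Ω R₀ Δ σ)

include S

/-! ### Uniqueness of the free boundary -/

/-- Otherwise ρ' < r < ρ on a set of positive measure for some rational r. Comparing its points ζ
with a later point z' of the set gives crossing minimizers, so P is constant in z on [ζ, z'] at
heights between ρ'(z') and r. Then ∂P/∂z vanishes on a part of D_ρ of positive area, although ∇P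
pushes the fluid to a measure that does not charge {Z = 0}. -/
theorem ae_le_of_minimizesAE (hf : (P, Ψ) ∈ legendrePairs r₀ H Δ) (hρ : IsHeight r₀ H ρ)
    (hρ' : IsHeight r₀ H ρ') (hmin : MinimizesAE r₀ H Ω P ρ) (hmin' : MinimizesAE r₀ H Ω P ρ')
    (hmap : (fluid r₀ H ρ).map (grad P) = σ) (hσ : σ {q | q.2 = 0} = 0) :
    ∀ᵐ z ∂volume.restrict (Icc 0 H), ρ z ≤ ρ' z := by
  have hr := S.r₀_pos
  obtain ⟨B, hB⟩ := S.exists_regular hf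
  have hgood : ∀ᵐ p ∂fluid r₀ H ρ, (grad P p).2 ≠ 0 ∧
      p ∈ Ioo 0 (1 / (2 * r₀ ^ 2)) ×ˢ Ioo 0 H ∧ DifferentiableAt ℝ (leg Δ Ψ) p := by
    have h1 : ∀ᵐ q ∂σ, q.2 ≠ 0 := by
      rw [ae_iff]
      simpa using hσ
    rw [← hmap] at h1
    exact (ae_of_ae_map (measurable_grad P).aemeasurable h1).and (S.ae_fluid_good hf hρ)
  have hvol := hρ.ae_volume_of_ae_fluid hr hgood
  let N : ℚ → Set ℝ := fun r => {z | z ∈ Icc 0 H ∧ ρ' z < r ∧ (r : ℝ) < ρ z ∧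
    IsMinOn (fun t => boundaryEnergy r₀ Ω P t z) (heights r₀) (ρ z) ∧
    IsMinOn (fun t => boundaryEnergy r₀ Ω P t z) (heights r₀) (ρ' z)}
  have hN : ∀ r, volume (N r) = 0 := by
    intro r
    by_contra hne
    obtain ⟨z', hz', hpos⟩ := exists_mem_measure_inter_Iio_ne_zero
      (⟨H, fun z hz => hz.1.2⟩ : BddAbove (N r)) hne
    have hsub : Ioo (ρ' z') r ×ˢ (N r ∩ Iio z') ⊆ {p | ¬(p ∈ region H ρ → (grad P p).2 ≠ 0 ∧
        p ∈ Ioo 0 (1 / (2 * r₀ ^ 2)) ×ˢ Ioo 0 H ∧ DifferentiableAt ℝ (leg Δ Ψ) p)} := by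
      rintro ⟨s, ζ⟩ ⟨hs, hζ, hζz⟩ himp
      have hs0 : 0 ≤ s := (hρ'.2 z' hz'.1).1.trans hs.1.le
      have hsρ : s < ρ ζ := hs.2.trans hζ.2.2.1
      obtain ⟨hne0, hint, hd⟩ := himp ⟨hζ.1, hs0, hsρ.le⟩
      have hsm : s ∈ heights r₀ := mem_heights_of_le (hρ.2 ζ hζ.1) hs0 hsρ.le
      have hcross := (pressure_eq_of_minimizers_cross hr hB hζ.1 hz'.1 (le_of_lt hζz)
        (hρ.2 ζ hζ.1) (hρ'.2 z' hz'.1) hζ.2.2.2.1 hz'.2.2.2.2 (hz'.2.1.trans hζ.2.2.1)).1 s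
        ⟨hs.1.le, hsρ.le⟩
      refine hne0 (grad_snd_eq_zero (z' := z') (hd.congr_of_eventuallyEq
        (eventually_of_mem (interior_mem_nhds hint) fun _ h => S.eqOn_leg hf h)) hζz
        fun z hz => ?_)
      have hzI : z ∈ Icc 0 H := ⟨hζ.1.1.trans hz.1, hz.2.trans hz'.1.2⟩
      refine le_antisymm ?_ (hB.mono s hsm hζ.1 hzI hz.1)
      rw [← hcross]
      exact hB.mono s hsm hzI hz'.1 hz.2
    have h0 : volume (Ioo (ρ' z') (r : ℝ) ×ˢ (N r ∩ Iio z')) = 0 := measure_mono_null hsub hvol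
    rw [Measure.volume_eq_prod, Measure.prod_prod, mul_eq_zero] at h0
    rcases h0 with h0 | h0
    · rw [Real.volume_Ioo, ENNReal.ofReal_eq_zero] at h0
      linarith [hz'.2.1]
    · exact hpos h0
  have hNae : ∀ᵐ z : ℝ, ∀ r, z ∉ N r := ae_all_iff.2 fun r => measure_eq_zero_iff_ae_notMem.1 (hN r)
  filter_upwards [ae_restrict_of_ae hNae, hmin, hmin', ae_restrict_mem measurableSet_Icc]
    with z h1 h2 h3 h4
  by_contra! hlt
  obtain ⟨r, hr1, hr2⟩ := exists_rat_btwn hlt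
  exact h1 r ⟨h4, hr1, hr2, h2, h3⟩

/-! ### Uniqueness of the pressure -/

theorem map_grad_eq_of_tightAE (hf : (P, Ψ) ∈ legendrePairs r₀ H Δ) (hρ : IsHeight r₀ H ρ)
    (hγ : IsPlan (fluid r₀ H ρ) σ γ) (ht : TightAE γ P Ψ) :
    (fluid r₀ H ρ).map (grad P) = σ := by
  have h := (S.tightAE_iff_map_grad hf hρ hγ).1 ht
  have hm : Measurable fun p => (p, grad P p) := measurable_id.prodMk (measurable_grad P)
  rw [← hγ.2, ← h, Measure.map_map measurable_snd hm]
  rfl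

theorem ae_grad_eq (hf : (P, Ψ) ∈ legendrePairs r₀ H Δ) (hf' : (P', Ψ') ∈ legendrePairs r₀ H Δ)
    (hρ : IsHeight r₀ H ρ) (hγ : IsPlan (fluid r₀ H ρ) σ γ) (ht : TightAE γ P Ψ)
    (ht' : TightAE γ P' Ψ') : ∀ᵐ p ∂fluid r₀ H ρ, grad P' p = grad P p := by
  have h := (S.tightAE_iff_map_grad hf hρ hγ).1 ht
  have h' := (map_graph_eq_iff hγ.1 (measurable_grad P')).1
    ((S.tightAE_iff_map_grad hf' hρ hγ).1 ht')
  rw [← h] at h'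
  exact ae_of_ae_map (measurable_id.prodMk (measurable_grad P)).aemeasurable h'

/-- Two optimal pressures agree below the free boundary. -/
theorem pressure_eq_on_region (hf : (P, Ψ) ∈ legendrePairs r₀ H Δ)
    (hf' : (P', Ψ') ∈ legendrePairs r₀ H Δ) (hρ : IsHeight r₀ H ρ) (hρa : Approachable H ρ)
    (hγ : IsPlan (fluid r₀ H ρ) σ γ) (ht : TightAE γ P Ψ) (ht' : TightAE γ P' Ψ')
    (hmin : MinimizesAE r₀ H Ω P ρ) (hmin' : MinimizesAE r₀ H Ω P' ρ) :
    ∀ p ∈ region H ρ, 0 < ρ p.2 → P' p = P p := by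
  have hr := S.r₀_pos
  obtain ⟨B, hB⟩ := S.exists_regular hf
  obtain ⟨B', hB'⟩ := S.exists_regular hf'
  have hm := hρa.isMinOn hr S.Ω_pos hB hρ.2 hmin
  have hm' := hρa.isMinOn hr S.Ω_pos hB' hρ.2 hmin'
  have hc := S.continuousOn_snd_of_mem hf.1
  have hc' := S.continuousOn_snd_of_mem hf'.1
  have hL := lipschitzWith_leg S.isCompact S.nonempty S.subset hc
  have hL' := lipschitzWith_leg S.isCompact S.nonempty S.subset hc'
  have hgood : ∀ᵐ p ∂fluid r₀ H ρ, grad (leg Δ Ψ') p = grad (leg Δ Ψ) p ∧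
      DifferentiableAt ℝ (leg Δ Ψ) p ∧ DifferentiableAt ℝ (leg Δ Ψ') p := by
    filter_upwards [S.ae_grad_eq hf hf' hρ hγ ht ht', S.ae_fluid_good hf hρ,
      S.ae_fluid_good hf' hρ] with p h1 h2 h3
    rw [S.grad_eq_grad_leg hf h2.1, S.grad_eq_grad_leg hf' h2.1] at h1
    exact ⟨h1, h2.2, h3.2⟩
  have hsl := ae_ae_of_ae_volume (hρ.ae_volume_of_ae_fluid hr hgood)
  have hae : ∀ᵐ z ∂volume.restrict (Icc 0 H), 0 < ρ z →
      ∀ s ∈ Icc 0 (ρ z), leg Δ Ψ' (s, z) = leg Δ Ψ (s, z) := by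
    filter_upwards [ae_restrict_of_ae hsl, ae_restrict_mem measurableSet_Icc] with z hz hzI hpos s hs
    have hslice : Isometry fun s : ℝ => (s, z) := fun a b => by simp [Prod.edist_eq]
    have hD := ((hL'.comp hslice.lipschitz).sub (hL.comp hslice.lipschitz)).lipschitzOnWith
      (s := uIcc s (ρ z)) |>.absolutelyContinuousOnInterval.integral_deriv_eq_sub
    -- The gradients agree a.e. in the fluid, and Lipschitz slices are absolutely continuous, so the
    -- difference of the pressures is constant in s. At s = ρ(z) it vanishes, both pressures being
    -- equal to the centrifugal term there.
    have h0 : ∫ x in s..ρ z, deriv (fun x => (leg Δ Ψ' ∘ fun s => (s, z)) x -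
        (leg Δ Ψ ∘ fun s => (s, z)) x) x = 0 := by
      refine intervalIntegral.integral_zero_ae ?_
      filter_upwards [hz] with x hx hxm
      rw [uIoc_of_le hs.2] at hxm
      obtain ⟨e, d, d'⟩ := hx ⟨hzI, hs.1.trans hxm.1.le, hxm.2⟩
      have := ((hasDerivAt_slice d').sub (hasDerivAt_slice d)).deriv
      rw [e, sub_self] at this
      exact this
    have hb : leg Δ Ψ' (ρ z, z) = leg Δ Ψ (ρ z, z) := by
      have hd : (ρ z, z) ∈ dom r₀ H := ⟨hρ.2 z hzI, hzI⟩
      rw [← S.eqOn_leg hf hd, ← S.eqOn_leg hf' hd,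
        centrifugal_eq_of_isMinOn hr hB hzI (hρ.2 z hzI) hpos (hm z hzI),
        centrifugal_eq_of_isMinOn hr hB' hzI (hρ.2 z hzI) hpos (hm' z hzI)]
    rw [h0] at hD
    simp only [Function.comp_apply] at hD
    linarith
  rintro ⟨s, z⟩ hp hpos
  have hd := hρ.region_subset_dom hp
  rw [S.eqOn_leg hf hd, S.eqOn_leg hf' hd]
  obtain ⟨zn, hzn, hlim, hρlim⟩ := hρa _ hae z hp.1
  -- Truncating s by ρ(zₙ) keeps the approximating points in the region.
  have hpair : Tendsto (fun n => (min s (ρ (zn n)), zn n)) atTop (𝓝 (s, z)) := by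
    have h1 : Tendsto (fun n => min s (ρ (zn n))) atTop (𝓝 (min s (ρ z))) :=
      tendsto_const_nhds.min hρlim
    rw [min_eq_left hp.2.2] at h1
    exact h1.prodMk_nhds hlim
  refine tendsto_nhds_unique ((hL'.continuous.tendsto _).comp hpair)
    (((hL.continuous.tendsto _).comp hpair).congr' ?_)
  filter_upwards [hρlim.eventually (lt_mem_nhds hpos)] with n hn
  exact ((hzn n).2 hn _ ⟨le_min hp.2.1 hn.le, min_le_right _ _⟩).symm

/-- On the contact set Ψ equals ⟨p, q⟩ − P, so equal pressures give equal potentials σ-a.e. The set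
where the two continuous transforms agree is closed and hence contains the support. -/
theorem snd_eq_on_support (hf : (P, Ψ) ∈ legendrePairs r₀ H Δ)
    (hf' : (P', Ψ') ∈ legendrePairs r₀ H Δ) (hρ : IsHeight r₀ H ρ)
    (hγ : IsPlan (fluid r₀ H ρ) σ γ) (ht : TightAE γ P Ψ) (ht' : TightAE γ P' Ψ')
    (hP : ∀ p ∈ region H ρ, 0 < ρ p.2 → P' p = P p) (hσ : σ.support ⊆ Δ) :
    ∀ q ∈ σ.support, Ψ' q = Ψ q := by
  obtain ⟨B, hB⟩ := S.exists_regular hf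
  obtain ⟨B', hB'⟩ := S.exists_regular hf'
  have hclosed : IsClosed {q | dleg r₀ H P' q = dleg r₀ H P q} :=
    isClosed_eq (lipschitzWith_dleg S.r₀_pos S.H_pos hB'.abs_le).continuous
      (lipschitzWith_dleg S.r₀_pos S.H_pos hB.abs_le).continuous
  have hae : ∀ᵐ q ∂σ, dleg r₀ H P' q = dleg r₀ H P q := by
    rw [← hγ.2, ae_map_iff measurable_snd.aemeasurable hclosed.measurableSet]
    filter_upwards [ht, ht', hγ.ae_fst hρ.ae_fluid_mem, hγ.ae_fst hρ.ae_fluid_mem_interior,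
      hγ.ae_snd S.ae_mem] with x h1 h2 h3 h4 h5
    have hq := S.subset_quadrant h5
    rw [← S.eqOn_dleg hf hq, ← S.eqOn_dleg hf' hq]
    have := hP x.1 h3 (h4.1.1.trans_le h3.2.2)
    linarith
  intro q hq
  have hq' := S.subset_quadrant (hσ hq)
  rw [S.eqOn_dleg hf hq', S.eqOn_dleg hf' hq']
  exact Measure.support_subset_of_isClosed hclosed hae hq

end Setting

end Axisym

/-! ### Assembly of the theorem -/

theorem mainTheorem2 (r₀ H Ω R₀ : ℝ) (hr₀ : 0 < r₀) (hH : 0 < H) (hΩ : 0 < Ω) (hR₀ : 0 < R₀)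
    (Δ : Set (ℝ × ℝ)) (hΔ : IsClosed Δ) (hΔR : Δ ⊆ Icc 0 R₀ ×ˢ Icc 0 R₀)
    (σ : Measure (ℝ × ℝ)) [IsProbabilityMeasure σ] (hσ : σ.support ⊆ Δ) :
    -- (i) a maximizer over `𝒰` that is a Legendre pair
    (∃ f ∈ Axisym.legendrePairs r₀ H Δ,
      IsMaxOn (Axisym.dual r₀ H Ω σ) (Axisym.dualPairs r₀ H) f) ∧
    -- (ii) weak duality and the cases of equality
    (∀ P Ψ, (P, Ψ) ∈ Axisym.legendrePairs r₀ H Δ →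
      ∀ ρ γ, (ρ, γ) ∈ Axisym.admissible r₀ H σ →
        Axisym.dual r₀ H Ω σ (P, Ψ) ≤ Axisym.primal r₀ H Ω Δ ρ γ ∧
        (Axisym.primal r₀ H Ω Δ ρ γ = Axisym.dual r₀ H Ω σ (P, Ψ) ↔
          (Axisym.fluid r₀ H ρ).map (fun p => (p, Axisym.grad P p)) = γ ∧
            Axisym.MinimizesAE r₀ H Ω P ρ) ∧
        (σ ≪ volume →
          (Axisym.primal r₀ H Ω Δ ρ γ = Axisym.dual r₀ H Ω σ (P, Ψ) ↔
            σ.map (fun q => (Axisym.grad Ψ q, q)) = γ ∧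
              Axisym.MinimizesAE r₀ H Ω P ρ))) ∧
    -- (iii) the minimizer of the primal problem
    (∃ ρ₀ γ₀, (ρ₀, γ₀) ∈ Axisym.admissible r₀ H σ ∧
      (∀ ρ γ, (ρ, γ) ∈ Axisym.admissible r₀ H σ →
        Axisym.primal r₀ H Ω Δ ρ₀ γ₀ ≤ Axisym.primal r₀ H Ω Δ ρ γ) ∧
      (σ {q | q.2 = 0} = 0 → ∀ ρ γ, (ρ, γ) ∈ Axisym.admissible r₀ H σ →
        Axisym.primal r₀ H Ω Δ ρ γ = Axisym.primal r₀ H Ω Δ ρ₀ γ₀ →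
          γ = γ₀ ∧ ρ =ᵐ[volume.restrict (Icc 0 H)] ρ₀) ∧
      MonotoneOn ρ₀ (Icc 0 H) ∧
      (∀ P₀ Ψ₀, (P₀, Ψ₀) ∈ Axisym.legendrePairs r₀ H Δ →
        IsMaxOn (Axisym.dual r₀ H Ω σ) (Axisym.dualPairs r₀ H) (P₀, Ψ₀) →
          Axisym.dual r₀ H Ω σ (P₀, Ψ₀) = Axisym.primal r₀ H Ω Δ ρ₀ γ₀ ∧
          (∀ z ∈ Icc 0 H, 0 ≤ ρ₀ z ∧ ρ₀ z ≤ Axisym.heightBound r₀ H Ω R₀ P₀) ∧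
          Axisym.heightBound r₀ H Ω R₀ P₀ < 1 / (2 * r₀ ^ 2) ∧
          (∀ z ∈ Icc 0 H, 0 < ρ₀ z →
            2 * (1 - 2 * r₀ ^ 2 * ρ₀ z) * P₀ (ρ₀ z, z) = r₀ ^ 2 * Ω ^ 2) ∧
          (Axisym.fluid r₀ H ρ₀).map (Axisym.grad P₀) = σ ∧
          (σ ≪ volume →
            σ.map (fun q => (Axisym.grad Ψ₀ q, q)) = γ₀ ∧
            (∀ᵐ p ∂Axisym.fluid r₀ H ρ₀, Axisym.grad Ψ₀ (Axisym.grad P₀ p) = p) ∧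
            (∀ᵐ q ∂σ, Axisym.grad P₀ (Axisym.grad Ψ₀ q) = q))) ∧
      -- (iv) uniqueness of the dual maximizer over `𝒰₀`
      (∀ P₀ Ψ₀ P₁ Ψ₁, (P₀, Ψ₀) ∈ Axisym.legendrePairs r₀ H Δ →
        IsMaxOn (Axisym.dual r₀ H Ω σ) (Axisym.legendrePairs r₀ H Δ) (P₀, Ψ₀) →
        (P₁, Ψ₁) ∈ Axisym.legendrePairs r₀ H Δ →
        Axisym.dual r₀ H Ω σ (P₀, Ψ₀) = Axisym.dual r₀ H Ω σ (P₁, Ψ₁) →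
          (∀ p ∈ Axisym.region H ρ₀, 0 < ρ₀ p.2 → P₁ p = P₀ p) ∧
          (∀ q ∈ σ.support, Ψ₁ q = Ψ₀ q) ∧
          (σ.support = Δ →
            (∀ p ∈ Axisym.region H ρ₀, P₁ p = P₀ p) ∧ ∀ q ∈ Δ, Ψ₁ q = Ψ₀ q))) := by
  have hprob : IsProbabilityMeasure σ := inferInstance
  have hsupp : σ.support.Nonempty := Measure.nonempty_support (NeZero.ne σ)
  have S : Axisym.Setting r₀ H Ω R₀ Δ σ :=
    { r₀_pos := hr₀
      H_pos := hH
      Ω_pos := hΩ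
      isCompact := (isCompact_Icc.prod isCompact_Icc).of_isClosed_subset hΔ hΔR
      nonempty := hsupp.mono hσ
      subset := hΔR
      prob := hprob
      ae_mem := Filter.mem_of_superset Measure.support_mem_ae hσ }
  obtain ⟨ψ, ρ₀, hψ, hmono, hmem, happ, hmin, hmap⟩ := S.exists_solution
  have hρ₀ : Axisym.IsHeight r₀ H ρ₀ := Axisym.isHeight_of_monotoneOn hmono hmem
  set P := Axisym.leg Δ ψ
  set Ψ := Axisym.dleg r₀ H P
  have hf : (P, Ψ) ∈ Axisym.legendrePairs r₀ H Δ :=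
    Axisym.leg_mem_legendrePairs S.isCompact S.nonempty S.subset hr₀ hH hψ
  have hgm : Measurable fun p => (p, Axisym.grad P p) :=
    measurable_id.prodMk (Axisym.measurable_grad P)
  set γ₀ := (Axisym.fluid r₀ H ρ₀).map fun p => (p, Axisym.grad P p) with hγ₀
  have hplan : Axisym.IsPlan (Axisym.fluid r₀ H ρ₀) σ γ₀ := by
    refine ⟨?_, ?_⟩
    · rw [hγ₀, Measure.map_map measurable_fst hgm]
      exact Measure.map_id
    · rw [hγ₀, Measure.map_map measurable_snd hgm]
      exact hmap
  -- The mass constraint was not imposed on ρ₀; it follows because the fluid measure is pushed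
  -- forward to σ.
  have hfp : IsProbabilityMeasure (Axisym.fluid r₀ H ρ₀) := by
    refine ⟨?_⟩
    have h1 := measure_univ (μ := σ)
    rwa [← hmap, Measure.map_apply (Axisym.measurable_grad P) MeasurableSet.univ,
      preimage_univ] at h1
  have hadm : (ρ₀, γ₀) ∈ Axisym.admissible r₀ H σ :=
    ⟨hρ₀, Axisym.integral_weight_region_eq_one, hplan⟩
  have htight : Axisym.TightAE γ₀ P Ψ := (S.tightAE_iff_map_grad hf hρ₀ hplan).2 rfl
  have heq : Axisym.primal r₀ H Ω Δ ρ₀ γ₀ = Axisym.dual r₀ H Ω σ (P, Ψ) :=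
    (S.weak_duality hf hadm).2.2 ⟨htight, hmin⟩
  have hmax : ∀ f ∈ Axisym.dualPairs r₀ H,
      Axisym.dual r₀ H Ω σ f ≤ Axisym.dual r₀ H Ω σ (P, Ψ) := by
    rintro ⟨P', Ψ'⟩ hf'
    rw [← heq]
    exact (S.dual_le_dual_leg hf').trans (S.weak_duality (Axisym.leg_mem_legendrePairs S.isCompact
      S.nonempty S.subset hr₀ hH (S.continuousOn_snd_of_mem hf')) hadm).1
  -- Any pair at least as good as (P, Ψ) closes the duality gap with the same (ρ₀, γ₀), and so
  -- inherits both equality conditions. The claims about arbitrary maximizers rest on this.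
  have hopt : ∀ P' Ψ', (P', Ψ') ∈ Axisym.legendrePairs r₀ H Δ →
      Axisym.dual r₀ H Ω σ (P, Ψ) ≤ Axisym.dual r₀ H Ω σ (P', Ψ') →
      Axisym.dual r₀ H Ω σ (P', Ψ') = Axisym.primal r₀ H Ω Δ ρ₀ γ₀ ∧
        Axisym.TightAE γ₀ P' Ψ' ∧ Axisym.MinimizesAE r₀ H Ω P' ρ₀ := by
    intro P' Ψ' hf' hle
    have h1 := S.weak_duality hf' hadm
    have h2 := le_antisymm h1.1 (heq.trans_le hle)
    exact ⟨h2, h1.2.1 h2.symm⟩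
  refine ⟨⟨(P, Ψ), hf, fun f hf' => hmax f hf'⟩, ?_, ρ₀, γ₀, hadm, ?_, ?_, hmono, ?_, ?_⟩
  · intro P' Ψ' hf' ρ γ hx
    have h1 := S.weak_duality hf' hx
    refine ⟨h1.1, ?_, fun hac => ?_⟩
    · rw [h1.2, S.tightAE_iff_map_grad hf' hx.1 hx.2.2]
    · rw [h1.2, S.tightAE_iff_map_grad_snd hf' hx.1 hx.2.2 hac]
  · intro ρ γ hx
    rw [heq]
    exact (S.weak_duality hf hx).1
  · intro hZ ρ γ hx he
    rw [heq] at he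
    obtain ⟨ht, hm⟩ := (S.weak_duality hf hx).2.1 he
    have hle := S.ae_le_of_minimizesAE hf hx.1 hρ₀ hm hmin
      (S.map_grad_eq_of_tightAE hf hx.1 hx.2.2 ht) hZ
    have hge := S.ae_le_of_minimizesAE hf hρ₀ hx.1 hmin hm hmap hZ
    have hae : ρ =ᵐ[volume.restrict (Icc 0 H)] ρ₀ := by
      filter_upwards [hle, hge] with z h1 h2
      exact le_antisymm h1 h2
    refine ⟨?_, hae⟩
    rw [hγ₀, ← Axisym.fluid_congr_ae hae]
    exact ((S.tightAE_iff_map_grad hf hx.1 hx.2.2).1 ht).symm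
  · intro P₀ Ψ₀ hf₀ hmax₀
    obtain ⟨hd, ht, hm⟩ := hopt P₀ Ψ₀ hf₀ (hmax₀ hf.1)
    obtain ⟨B, hB⟩ := S.exists_regular hf₀
    have hmz := happ.isMinOn hr₀ hΩ hB hmem hm
    have hgrad := (S.tightAE_iff_map_grad hf₀ hρ₀ hplan).1 ht
    refine ⟨hd, fun z hz => ⟨(hmem z hz).1, ?_⟩, (Axisym.heightBound_lt hr₀ hΩ P₀).2,
      fun z hz hpos => ?_, S.map_grad_eq_of_tightAE hf₀ hρ₀ hplan ht, fun hac => ?_⟩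
    · refine Axisym.le_heightBound_of_isMinOn hr₀ hΩ hB hz (hmem z hz) (hmz z hz) fun p hp => ?_
      rw [S.eqOn_leg hf₀ hp, S.eqOn_leg hf₀ (Axisym.zero_mem_dom hr₀ hH)]
      exact Axisym.leg_le_add S.isCompact S.nonempty S.subset
        (S.continuousOn_snd_of_mem hf₀.1) hp
    · have hpos' := Axisym.one_sub_pos_of_mem_heights hr₀ (hmem z hz)
      rw [Axisym.centrifugal_eq_of_isMinOn hr₀ hB hz (hmem z hz) hpos (hmz z hz),
        Axisym.centrifugal]
      have e : 2 * (1 - 2 * r₀ ^ 2 * ρ₀ z) = 2 * (1 - 2 * ρ₀ z * r₀ ^ 2) := by ring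
      rw [e, mul_div_cancel₀ _ (mul_pos two_pos hpos').ne', mul_comm]
    · have hsnd := (S.tightAE_iff_map_grad_snd hf₀ hρ₀ hplan hac).1 ht
      have h1 := (Axisym.map_graph_eq_iff hplan.1 (Axisym.measurable_grad P₀)).1 hgrad
      have h2 := (Axisym.map_graph_snd_eq_iff hplan.2 (Axisym.measurable_grad Ψ₀)).1 hsnd
      refine ⟨hsnd, ?_, ?_⟩
      · rw [← hgrad] at h2
        exact ae_of_ae_map (measurable_id.prodMk (Axisym.measurable_grad P₀)).aemeasurable h2
      · rw [← hsnd] at h1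
        exact ae_of_ae_map ((Axisym.measurable_grad Ψ₀).prodMk measurable_id).aemeasurable h1
  · intro P₀ Ψ₀ P₁ Ψ₁ hf₀ hmax₀ hf₁ he
    have hle₀ : Axisym.dual r₀ H Ω σ (P, Ψ) ≤ Axisym.dual r₀ H Ω σ (P₀, Ψ₀) := hmax₀ hf
    obtain ⟨-, ht₀, hm₀⟩ := hopt P₀ Ψ₀ hf₀ hle₀
    obtain ⟨-, ht₁, hm₁⟩ := hopt P₁ Ψ₁ hf₁ (hle₀.trans_eq he)
    have hP := S.pressure_eq_on_region hf₀ hf₁ hρ₀ happ hplan ht₀ ht₁ hm₀ hm₁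
    have hΨ := S.snd_eq_on_support hf₀ hf₁ hρ₀ hplan ht₀ ht₁ hP hσ
    refine ⟨hP, hΨ, fun hs => ?_⟩
    -- P is the transform of Ψ over Δ, so equality of the potentials on Δ also covers the points
    -- with ρ₀(z) = 0, where no boundary condition is available.
    rw [hs] at hΨ
    refine ⟨fun p hp => ?_, hΨ⟩
    have hd := hρ₀.region_subset_dom hp
    rw [S.eqOn_leg hf₀ hd, S.eqOn_leg hf₁ hd, Axisym.leg_congr hΨ]
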